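/- **Model.** Fix dimensions $q,r,t$ and an integer $K\ge 2$. For every $N$ there are $N$ units, a known undirected network $G$ on $[N]$, and user-specified measurable feature maps. An observation law $P$ on $N$ units is generated by the structural equations $$C_i\leftarrow \varepsilon_{C_i},\qquad W_i\leftarrow \mathrm{Bernoulli}\big(h^0(C_i,Z_i)\big),\qquad Y_i\leftarrow W_i\,g_1^0(C_i,X_i)+(1-W_i)\,g_0^0(C_i,X_i)+\varepsilon_{Y_i},$$ where the confounders $C_i\in\mathbb R^q$ are i.i.d.; the spillover feature $Z_i\in\mathbb R^t$ is a function of $\{C_j\}_{j\ne i}$ and $G$; the spillover feature $X_i\in\mathbb R^r$ is a function of $\{(W_j,C_j)\}_{j\neq i}$ and $G$; given the confounders, the treatments $W_i\in\{0,1\}$ are independent; and the errors $\varepsilon_{Y_i}$ are produced from $(W_i,C_i,X_i)$ and independent noise variables and satisfy $E[\varepsilon_{Y_i}\mid W_i,C_i,X_i]=0$ (this covers additive i.i.d. centred errors and Bernoulli outcomes). Put $S_i=(W_i,C_i,X_i,Z_i,Y_i)$, $D_i=(C_i,X_i)$, $U_i=(C_i,Z_i)$, $\eta=(g_1,g_0,h)$,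 $\eta^0=(g_1^0,g_0^0,h^0)$, and $$\phi(S_i,\eta)=g_1(D_i)-g_0(D_i)+\frac{W_i}{h(U_i)}\big(Y_i-g_1(D_i)\big)-\frac{1-W_i}{1-h(U_i)}\big(Y_i-g_0(D_i)\big).$$ Let $\theta_i^0=E\big[Y_i^{do(W_i=1)}-Y_i^{do(W_i=0)}\big]$; the expected average treatment effect (EATE) is $\theta_N^0=\frac1N\sum_{i=1}^N\theta_i^0$. Put $\psi(S_i,\theta_i^0,\eta)=\phi(S_i,\eta)-\theta_i^0$. **Dependency graph.** A variable is *present* in a feature if the feature depends on it. Unit $i$ receives contributions from itself, from each $l$ with $C_l$ present in $Z_i$ or $X_i$, from each $m$ with $W_m$ present in $X_i$, and from each $l$ with $C_l$ present in $Z_m$ for such an $m$. Two units $i\neq j$ are adjacent in the dependency graph $G_D$ if some unit contributes to both; $d_{\max}$ is the maximal degree of $G_D$. **Estimator.** Let $I_1,\dots,I_K$ be a partition of $[N]$ whose sizes differ by at most one. For each $k$, $\mathcal S_{I_k^c}$ consists of the data $S_j$ with $j\notin I_k$ such that $j$ has no neighbour in $I_k$ in $G_D$; $\hat\eta^{I_k^c}$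 is a (jointly measurable) machine-learning estimator of $\eta^0$ computed from $\mathcal S_{I_k^c}$. The cross-fitted AIPW estimator is $$\hat\theta=\frac1K\sum_{k=1}^K\frac1{|I_k|}\sum_{i\in I_k}\phi\big(S_i,\hat\eta^{I_k^c}\big).$$ **Assumptions.** Let $\delta_N,\Delta_N\ge0$ be sequences with $\delta_N\to0$ and $\Delta_N\to0$, let $p\ge4$, and let $\mathcal P_N$ be sets of such laws $P$ (each with its $\eta^0$). All constants below are independent of $N$ and $P$ unless stated otherwise. For all $N\ge K$, $P\in\mathcal P_N$, $i\in[N]$: 1. (Regularity) $\|W_i\|_{P,p}+\|C_i\|_{P,p}+\|X_i\|_{P,p}+\|Z_i\|_{P,p}+\|Y_i\|_{P,p}\le C_1$; $\|Y_i\|_{P,\infty}+\|g_1^0(D_i)\|_{P,\infty}+\|g_0^0(D_i)\|_{P,\infty}+\|h^0(U_i)\|_{P,\infty}\le C_2$; $P(C_3\le h^0(U_i)\le1-C_3)=1$ with $C_3>0$; $|\theta_i^0|\le C_4$. 2. (Degree) $d_{\max}=o(N^{1/4})$. 3. (Variance) There is $\sigma_\infty^2\in(0,\infty)$ such that $\mathrm{Var}_{P}\big(N^{-1/2}\sum_{i=1}^N\psi(S_i,\theta_i^0,\eta^0)\big)\to\sigma_\infty^2$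 as $N\to\infty$ along every sequence of laws $P=P_N\in\mathcal P_N$, i.e. uniformly over $P\in\mathcal P_N$. 4. (Nuisance estimation) There is a set $\mathcal T_N$ (which may depend on $P$) of measurable $\eta=(g_1,g_0,h)$ that contains $\eta^0$, whose elements, evaluated at $D_i$ and $U_i$, have finite $p$-th moments and are bounded in $\|\cdot\|_{P,\infty}$ uniformly over $\mathcal T_N$ (by a bound that may depend on $N$ and $P$), and such that for all $\eta\in\mathcal T_N$: $P(C_3\le h(U_i)\le 1-C_3)=1$; $$\|h^0(U_i)-h(U_i)\|_{P,2}\big(\|g_1^0(D_i)-g_1(D_i)\|_{P,2}+\|g_0^0(D_i)-g_0(D_i)\|_{P,2}+\|h^0(U_i)-h(U_i)\|_{P,2}\big)\le C_5\,\delta_NN^{-1/2};$$ and, for some $\kappa\ge0$ with $d_{\max}N^{-2\kappa}\le C_6$, $$\|h^0(U_i)-h(U_i)\|_{P,2}+\|g_1^0(D_i)-g_1(D_i)\|_{P,2}+\|g_0^0(D_i)-g_0(D_i)\|_{P,2}\le C_7\sqrt{\delta_N}\,N^{-\kappa}.$$ For every $k\in[K]$, $\hat\eta^{I_k^c}\in\mathcal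 T_N$ with $P$-probability at least $1-\Delta_N$. **Theorem.** Under these assumptions $\sqrt N(\hat\theta-\theta_N^0)\xrightarrow{d}\mathcal N(0,\sigma_\infty^2)$, uniformly over the law: $$\lim_{N\to\infty}\ \sup_{P\in\mathcal P_N}\ \sup_{x\in\mathbb R}\Big|P\big(\sqrt N(\hat\theta-\theta_N^0)\le x\big)-\mathcal N(0,\sigma_\infty^2)\big((-\infty,x]\big)\Big|=0 .$$ In particular, the convergence in distribution holds along every sequence of laws $P_N\in\mathcal P_N$. -/

import Mathlib

open MeasureTheory ProbabilityTheory Filter Topology Asymptotics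
open scoped NNReal ENNReal

noncomputable section

namespace NetworkAIPW

/-- Values of the confounder `C_i`. -/
abbrev Conf (q : ℕ) := EuclideanSpace ℝ (Fin q)

/-- Values of a spillover feature of dimension `r`. -/
abbrev Feat (r : ℕ) := EuclideanSpace ℝ (Fin r)

/-- The unit-level data `S_i = (W_i, C_i, X_i, Z_i, Y_i)`. -/
abbrev UnitData (q r t : ℕ) := Bool × Conf q × Feat r × Feat t × ℝ

/-- A binary treatment as a real number. -/
def ind (b : Bool) : ℝ := if b then 1 else 0

/-- Nuisance functions `η = (g₁, g₀, h)`; `g₁, g₀` are functions of `D_i = (C_i, X_i)` and `h` is a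
function of `U_i = (C_i, Z_i)`. -/
structure Nuisance (q r t : ℕ) where
  g1 : Conf q × Feat r → ℝ
  g0 : Conf q × Feat r → ℝ
  h : Conf q × Feat t → ℝ

/-- The score `φ(S, η)`. -/
def score {q r t : ℕ} (s : UnitData q r t) (η : Nuisance q r t) : ℝ :=
  match s with
  | (w, c, x, z, y) =>
    η.g1 (c, x) - η.g0 (c, x)
      + ind w / η.h (c, z) * (y - η.g1 (c, x))
      - (1 - ind w) / (1 - η.h (c, z)) * (y - η.g0 (c, x))

/-- A known undirected network on `N` units together with the user-specified feature maps. The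
`X`-feature of unit `i` is computed from the treatments and confounders of the units other than
`i` (and the network), the `Z`-feature of unit `i` from the confounders of the units other than
`i` (and the network). -/
structure Network (N q r t : ℕ) where
  graph : SimpleGraph (Fin N)
  fx : (i : Fin N) → ({j : Fin N // j ≠ i} → Bool × Conf q) → SimpleGraph (Fin N) → Feat r
  fz : (i : Fin N) → ({j : Fin N // j ≠ i} → Conf q) → SimpleGraph (Fin N) → Feat t
  measurable_fx : ∀ i, Measurable fun v => fx i v graph
  measurable_fz : ∀ i, Measurable fun v => fz i v graph

namespace Network

variable {N q r t : ℕ} (net : Network N q r t)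

/-- The feature `X_i` as a function of all treatments and confounders. -/
def featX (w : Fin N → Bool) (c : Fin N → Conf q) (i : Fin N) : Feat r :=
  net.fx i (fun j => (w j, c j)) net.graph

/-- The feature `Z_i` as a function of all confounders. -/
def featZ (c : Fin N → Conf q) (i : Fin N) : Feat t :=
  net.fz i (fun j => c j) net.graph

/-- `W_m` is present in `X_i`: changing `W_m` alone can change the value of the feature. -/
def TreatInX (i m : Fin N) : Prop :=
  ∃ v v' : {j : Fin N // j ≠ i} → Bool × Conf q,
    (∀ j : {j : Fin N // j ≠ i}, (j : Fin N) ≠ m → v j = v' j) ∧ (∀ j, (v j).2 = (v' j).2) ∧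
      net.fx i v net.graph ≠ net.fx i v' net.graph

/-- `C_m` is present in `X_i`: changing `C_m` alone can change the value of the feature. -/
def ConfInX (i m : Fin N) : Prop :=
  ∃ v v' : {j : Fin N // j ≠ i} → Bool × Conf q,
    (∀ j : {j : Fin N // j ≠ i}, (j : Fin N) ≠ m → v j = v' j) ∧ (∀ j, (v j).1 = (v' j).1) ∧
      net.fx i v net.graph ≠ net.fx i v' net.graph

/-- `C_m` is present in `Z_i`. -/
def ConfInZ (i m : Fin N) : Prop :=
  ∃ v v' : {j : Fin N // j ≠ i} → Conf q,
    (∀ j : {j : Fin N // j ≠ i}, (j : Fin N) ≠ m → v j = v' j) ∧ net.fz i v net.graph ≠ net.fz i v' net.graph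

/-- The units from which the unit-level data `S_i` receive a contribution: `i` itself, the units
whose confounder is present in `Z_i` or `X_i`, the units `m` whose treatment is present in `X_i`,
and the units whose confounder is present in `Z_m` for such an `m` (it is a cause of `W_m`). -/
def sources (i : Fin N) : Set (Fin N) :=
  {l | l = i ∨ net.ConfInZ i l ∨ net.ConfInX i l ∨
    ∃ m, net.TreatInX i m ∧ (l = m ∨ net.ConfInZ m l)}

/-- The dependency graph `G_D` on the unit-level data: two distinct units are adjacent if they
receive spillover effects from a common unit, or one of them receives one from the other. -/
def depGraph : SimpleGraph (Fin N) where
  Adj i j := i ≠ j ∧ (net.sources i ∩ net.sources j).Nonempty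
  symm := ⟨fun _ _ h => ⟨h.1.symm, by rw [Set.inter_comm]; exact h.2⟩⟩
  loopless := ⟨fun _ h => h.1 rfl⟩

open Classical in
/-- The maximal degree of the dependency graph. -/
def maxDeg : ℕ := net.depGraph.maxDegree

/-- The units whose data are used to estimate the nuisance functions for fold `k`: those outside
of fold `k` that have no neighbour in fold `k` in the dependency graph. -/
def train {K : ℕ} (fold : Fin N → Fin K) (k : Fin K) : Set (Fin N) :=
  {j | fold j ≠ k ∧ ∀ i, fold i = k → ¬ net.depGraph.Adj i j}

end Network

/-- A structural equation model for `N` units. The confounders are i.i.d. with law `confLaw`; the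
treatments are Bernoulli with success probability `nuis.h (C_i, Z_i)`; the outcome is
`Y_i = W_i g₁(C_i, X_i) + (1 - W_i) g₀(C_i, X_i) + ε_i`, where the error
`ε_i = err i W_i C_i X_i V_i`, with independent noise variables `V_i` of law `noiseLaw`, is centred
given `(W_i, C_i, X_i)`. (An additive centred error `V_i` gives the model for continuous outcomes;
`V_i` uniform on `[0, 1]` and `1{V_i ≤ p} - p` with `p` the conditional mean gives the Bernoulli
model for dichotomous outcomes.) -/
structure SEM (N q r t : ℕ) where
  confLaw : Measure (Conf q)
  noiseLaw : Measure ℝ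
  nuis : Nuisance q r t
  err : Fin N → Bool → Conf q → Feat r → ℝ → ℝ
  prob_conf : IsProbabilityMeasure confLaw
  prob_noise : IsProbabilityMeasure noiseLaw
  measurable_g1 : Measurable nuis.g1
  measurable_g0 : Measurable nuis.g0
  measurable_h : Measurable nuis.h
  h_mem : ∀ u, nuis.h u ∈ Set.Icc (0 : ℝ) 1
  measurable_err : ∀ i, Measurable fun p : Bool × Conf q × Feat r × ℝ =>
    err i p.1 p.2.1 p.2.2.1 p.2.2.2
  integrable_err : ∀ i w c x, Integrable (err i w c x) noiseLaw
  centred_err : ∀ i w c x, ∫ v, err i w c x v ∂noiseLaw = 0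

/-- The space of the exogenous variables: for every unit the confounder, a uniform variable that
decides the treatment, and the noise of the outcome. -/
abbrev Exo (N q : ℕ) := Fin N → Conf q × ℝ × ℝ

/-- The uniform distribution on `[0, 1]`. -/
def unifLaw : Measure ℝ := volume.restrict (Set.Icc 0 1)

instance : IsProbabilityMeasure unifLaw := ⟨by simp [unifLaw]⟩

namespace SEM

variable {N q r t : ℕ} (M : SEM N q r t) (net : Network N q r t)

/-- The law of the exogenous variables, all of which are independent. -/
def P : Measure (Exo N q) :=
  Measure.pi fun _ => M.confLaw.prod (unifLaw.prod M.noiseLaw)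

instance : IsProbabilityMeasure M.P := by
  have := M.prob_conf
  have := M.prob_noise
  unfold P
  infer_instance

/-- The confounders `C_i`. -/
def C (ω : Exo N q) (i : Fin N) : Conf q := (ω i).1

/-- The features `Z_i`. -/
def Z (ω : Exo N q) (i : Fin N) : Feat t := net.featZ (C ω) i

/-- The treatments `W_i ← Bernoulli(h(C_i, Z_i))`. -/
def W (ω : Exo N q) (i : Fin N) : Bool := decide ((ω i).2.1 ≤ M.nuis.h (C ω i, Z net ω i))

/-- The outcome equation of unit `i` when the units receive the treatments `w`. -/
def outcome (w : Fin N → Bool) (ω : Exo N q) (i : Fin N) : ℝ :=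
  ind (w i) * M.nuis.g1 (C ω i, net.featX w (C ω) i)
    + (1 - ind (w i)) * M.nuis.g0 (C ω i, net.featX w (C ω) i)
    + M.err i (w i) (C ω i) (net.featX w (C ω) i) (ω i).2.2

/-- The features `X_i`. -/
def X (ω : Exo N q) (i : Fin N) : Feat r := net.featX (M.W net ω) (C ω) i

/-- The outcomes `Y_i`. -/
def Y (ω : Exo N q) (i : Fin N) : ℝ := M.outcome net (M.W net ω) ω i

/-- The outcome of unit `i` under the intervention `do(W_i = b)`. -/
def Ydo (b : Bool) (ω : Exo N q) (i : Fin N) : ℝ :=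
  M.outcome net (Function.update (M.W net ω) i b) ω i

/-- The unit-level data `S_i`. -/
def S (ω : Exo N q) (i : Fin N) : UnitData q r t :=
  (M.W net ω i, C ω i, M.X net ω i, Z net ω i, M.Y net ω i)

/-- `D_i = (C_i, X_i)`. -/
def D (ω : Exo N q) (i : Fin N) : Conf q × Feat r := (C ω i, M.X net ω i)

/-- `U_i = (C_i, Z_i)`. -/
def U (ω : Exo N q) (i : Fin N) : Conf q × Feat t := (C ω i, Z net ω i)

/-- The unit-level direct effect `θ_i⁰`. -/
def unitEffect (i : Fin N) : ℝ := ∫ ω, (M.Ydo net true ω i - M.Ydo net false ω i) ∂M.P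

/-- The expected average treatment effect `θ_N⁰`. -/
def eate : ℝ := (1 / (N : ℝ)) * ∑ i, M.unitEffect net i

/-- `σ_N²`, the variance of `N^{-1/2} ∑ ψ(S_i, θ_i⁰, η⁰)` with `ψ(S, θ, η) = φ(S, η) - θ`. -/
def scoreVariance : ℝ :=
  variance (fun ω => (1 / √(N : ℝ)) *
    ∑ i, (score (M.S net ω i) M.nuis - M.unitEffect net i)) M.P

/-- `‖g₁⁰(D_i) - g₁(D_i)‖_{P,2}`. -/
def errG1 (η : Nuisance q r t) (i : Fin N) : ℝ≥0∞ :=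
  eLpNorm (fun ω => M.nuis.g1 (M.D net ω i) - η.g1 (M.D net ω i)) 2 M.P

/-- `‖g₀⁰(D_i) - g₀(D_i)‖_{P,2}`. -/
def errG0 (η : Nuisance q r t) (i : Fin N) : ℝ≥0∞ :=
  eLpNorm (fun ω => M.nuis.g0 (M.D net ω i) - η.g0 (M.D net ω i)) 2 M.P

/-- `‖h⁰(U_i) - h(U_i)‖_{P,2}`. -/
def errH (η : Nuisance q r t) (i : Fin N) : ℝ≥0∞ :=
  eLpNorm (fun ω => M.nuis.h (U net ω i) - η.h (U net ω i)) 2 M.P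

/-- The unit-level data of the training set of fold `k`. -/
def trainData {K : ℕ} (fold : Fin N → Fin K) (k : Fin K) (ω : Exo N q) :
    net.train fold k → UnitData q r t :=
  fun j => M.S net ω j

/-- The cross-fitted estimator `θ̂`; `learner k` maps the training data of fold `k` to the
estimated nuisance functions. -/
def thetaHat {K : ℕ} (fold : Fin N → Fin K)
    (learner : (k : Fin K) → (net.train fold k → UnitData q r t) → Nuisance q r t)
    (ω : Exo N q) : ℝ :=
  (1 / (K : ℝ)) * ∑ k : Fin K, (1 / ((Finset.univ.filter fun i => fold i = k).card : ℝ)) *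
    ∑ i ∈ Finset.univ.filter (fun i => fold i = k),
      score (M.S net ω i) (learner k (M.trainData net fold k ω))

/-- `√N (θ̂ - θ_N⁰)`. -/
def scaledError {K : ℕ} (fold : Fin N → Fin K)
    (learner : (k : Fin K) → (net.train fold k → UnitData q r t) → Nuisance q r t)
    (ω : Exo N q) : ℝ :=
  √(N : ℝ) * (M.thetaHat net fold learner ω - M.eate net)

end SEM

/-- A learner is measurable: the value of each estimated nuisance function at a point depends
measurably on the training data and the point. -/
structure MeasurableLearner {ι : Type} {q r t : ℕ}
    (L : (ι → UnitData q r t) → Nuisance q r t) : Prop where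
  g1 : Measurable fun p : (ι → UnitData q r t) × (Conf q × Feat r) => (L p.1).g1 p.2
  g0 : Measurable fun p : (ι → UnitData q r t) × (Conf q × Feat r) => (L p.1).g0 p.2
  h : Measurable fun p : (ι → UnitData q r t) × (Conf q × Feat t) => (L p.1).h p.2

/-- Regularity of the model: moments, boundedness, overlap, and bounded unit-level effects. -/
structure Regular {N q r t : ℕ} (M : SEM N q r t) (net : Network N q r t)
    (p C₁ C₂ : ℝ≥0) (C₃ C₄ : ℝ) : Prop where
  moments : ∀ i,
    eLpNorm (fun ω => ind (M.W net ω i)) p M.P + eLpNorm (fun ω => SEM.C ω i) p M.P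
      + eLpNorm (fun ω => M.X net ω i) p M.P + eLpNorm (fun ω => SEM.Z net ω i) p M.P
      + eLpNorm (fun ω => M.Y net ω i) p M.P ≤ C₁
  bounded : ∀ i,
    eLpNorm (fun ω => M.Y net ω i) ∞ M.P + eLpNorm (fun ω => M.nuis.g1 (M.D net ω i)) ∞ M.P
      + eLpNorm (fun ω => M.nuis.g0 (M.D net ω i)) ∞ M.P
      + eLpNorm (fun ω => M.nuis.h (SEM.U net ω i)) ∞ M.P ≤ C₂
  overlap : ∀ i, ∀ᵐ ω ∂M.P, M.nuis.h (SEM.U net ω i) ∈ Set.Icc C₃ (1 - C₃)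
  effects : ∀ i, |M.unitEffect net i| ≤ C₄

/-- `T` is an admissible nuisance realization set: it contains the true nuisance functions, its
elements are measurable with finite `p`-th moments, are uniformly bounded, respect the overlap
condition, satisfy the product rate (with bound `ρ`), and the sum of their errors is at most
`τ`. -/
structure RealizationSet {N q r t : ℕ} (M : SEM N q r t) (net : Network N q r t)
    (T : Set (Nuisance q r t)) (p : ℝ≥0) (C₃ ρ τ : ℝ) : Prop where
  true_mem : M.nuis ∈ T
  measurable : ∀ η ∈ T, Measurable η.g1 ∧ Measurable η.g0 ∧ Measurable η.h
  moments : ∀ η ∈ T, ∀ i,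
    MemLp (fun ω => η.g1 (M.D net ω i)) p M.P ∧ MemLp (fun ω => η.g0 (M.D net ω i)) p M.P ∧
      MemLp (fun ω => η.h (SEM.U net ω i)) p M.P
  bounded : ∃ B : ℝ≥0, ∀ η ∈ T, ∀ i,
    eLpNorm (fun ω => η.g1 (M.D net ω i)) ∞ M.P ≤ B ∧
      eLpNorm (fun ω => η.g0 (M.D net ω i)) ∞ M.P ≤ B ∧
      eLpNorm (fun ω => η.h (SEM.U net ω i)) ∞ M.P ≤ B
  overlap : ∀ η ∈ T, ∀ i, ∀ᵐ ω ∂M.P, η.h (SEM.U net ω i) ∈ Set.Icc C₃ (1 - C₃)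
  product : ∀ η ∈ T, ∀ i,
    M.errH net η i * (M.errG1 net η i + M.errG0 net η i + M.errH net η i) ≤ ENNReal.ofReal ρ
  errors : ∀ η ∈ T, ∀ i,
    M.errH net η i + M.errG1 net η i + M.errG0 net η i ≤ ENNReal.ofReal τ

end NetworkAIPW

end

/-!
# Asymptotic normality of the cross-fitted AIPW estimator under interference

The scaled error of the estimator is compared with `oracleError`, the normalized sum of the centred
scores at the true nuisance functions. Both steps rest on one structural fact (`SEM.dependsOn_S`):
the data of unit `i` are a function of the exogenous variables of the units in `sources i`, so the
data of sets of units without common sources are independent (`DependsOn.indepFun`).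

*The oracle error is asymptotically normal.* The scores are centred (`Regular.integral_score_nuis`)
and bounded, and their dependency graph has degree `o(N^{1/4})`. For a sum `S` of such variables
the characteristic function `φ` satisfies `φ'(t) = i E[S exp(itS)]`; subtracting from `S` the
neighbourhood sum of a summand makes the exponential independent of it, and a first order expansion
gives `φ'(t) = -v t φ(t)` with `v = Var S`, up to a third moment error of order `D² / √N` and the
fluctuation of the quadratic form `∑_k X_k ∑_{l ∈ nb k} X_l` around `v`, of order `√(D³ / N)`.
Integrating the differential equation yields `LocallyDependent.norm_charFun_sub_le`.

*Estimating the nuisance functions is negligible.* The training data of a fold are independent of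
the data in the fold (`indepFun_trainData`), so by Fubini's theorem the estimates may be replaced by
fixed elements `η` of the realization set (`measure_sum_score_sub_ge_le`). For a fixed `η` the bias
of the score is at most the product of the nuisance errors (`Regular.abs_integral_score_sub_le`),
because the score is orthogonal: averaging over the treatment and noise variables of unit `i` alone
(`SEM.integral_score_resample`) leaves only products of errors. The variance of a sum of score
differences is at most the number of units times the degree times the squared nuisance error
(`integral_sum_sq_le`). The degree condition on `κ` makes both vanish after scaling.

*Uniformity.* All bounds hold simultaneously for all laws in a set, so the characteristic functions
converge uniformly over the sets of laws. Along a sequence of laws that violate the claim,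
if there were one, Lévy's theorem and Pólya's theorem give uniform convergence of the distribution
functions (`cdf_uniform_of_charFun_uniform`).
-/

/-! ### Functions of disjoint sets of coordinates of a product space -/

namespace NetworkAIPW

section Product

variable {ι : Type*} {α : ι → Type*} {β γ : Type*}

theorem _root_.DependsOn.map {f : (∀ i, α i) → β} {s : Set ι} (hf : DependsOn f s) (g : β → γ) :
    DependsOn (fun ω => g (f ω)) s :=
  fun _ _ h => congrArg g (hf h)

theorem _root_.DependsOn.map₂ {δ : Type*} {f : (∀ i, α i) → β} {f' : (∀ i, α i) → γ} {s t u : Set ι}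
    (hf : DependsOn f s) (hf' : DependsOn f' t) (hs : s ⊆ u) (ht : t ⊆ u) (g : β → γ → δ) :
    DependsOn (fun ω => g (f ω) (f' ω)) u :=
  fun _ _ h => congrArg₂ g (hf.mono hs h) (hf'.mono ht h)

theorem _root_.DependsOn.sum {κ : Type*} {X : κ → (∀ i, α i) → ℝ} {src : κ → Set ι} {u : Set ι}
    (A : Finset κ) (hX : ∀ k, DependsOn (X k) (src k)) (hu : ∀ k ∈ A, src k ⊆ u) :
    DependsOn (fun ω => ∑ k ∈ A, X k ω) u :=
  fun _ _ h => Finset.sum_congr rfl fun k hk => (hX k).mono (hu k hk) h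

variable [Fintype ι] [∀ i, MeasurableSpace (α i)] (μ : ∀ i, Measure (α i))
  [∀ i, IsProbabilityMeasure (μ i)]

/-- Measurable functions of disjoint sets of independent coordinates are independent. -/
theorem _root_.DependsOn.indepFun [MeasurableSpace β] [MeasurableSpace γ]
    {f : (∀ i, α i) → β} {g : (∀ i, α i) → γ} {s t : Set ι}
    (hf : DependsOn f s) (hg : DependsOn g t) (hfm : Measurable f) (hgm : Measurable g)
    (hst : Disjoint s t) : IndepFun f g (Measure.pi μ) := by
  classical
  have : ∀ i, Nonempty (α i) := fun i => nonempty_of_isProbabilityMeasure (μ i)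
  let a : ∀ i, α i := fun i => Classical.arbitrary _
  -- A function of the coordinates in `s` factors through the restriction to `s`, measurably.
  let ext (u : Finset ι) (x : ∀ i : u, α i) : ∀ i, α i := fun i => if h : i ∈ u then x ⟨i, h⟩ else a i
  have hext : ∀ u : Finset ι, Measurable (ext u) := fun u => by
    refine measurable_pi_lambda _ fun i => ?_
    by_cases h : i ∈ u
    · simpa [ext, h] using measurable_pi_apply _
    · simp [ext, h]
  have key : IndepFun (fun (ω : ∀ i, α i) (i : s.toFinset) => ω i)
      (fun ω (i : t.toFinset) => ω i) (Measure.pi μ) :=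
    (iIndepFun_pi (μ := μ) (X := fun _ x => x) fun _ => aemeasurable_id).indepFun_finset
      s.toFinset t.toFinset (by simpa using hst) fun i => measurable_pi_apply i
  have h1 : f = (f ∘ ext s.toFinset) ∘ fun (ω : ∀ i, α i) (i : s.toFinset) => ω i := by
    funext ω
    exact hf fun i hi => by simp [ext, hi]
  have h2 : g = (g ∘ ext t.toFinset) ∘ fun (ω : ∀ i, α i) (i : t.toFinset) => ω i := by
    funext ω
    exact hg fun i hi => by simp [ext, hi]
  rw [h1, h2]
  exact key.comp (hfm.comp (hext _)) (hgm.comp (hext _))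

/-- Replacing a coordinate by an independent copy preserves a product measure. -/
theorem measurePreserving_update [DecidableEq ι] (i : ι) :
    MeasurePreserving (fun p : (∀ j, α j) × α i => Function.update p.1 i p.2)
      ((Measure.pi μ).prod (μ i)) (Measure.pi μ) := by
  have hm : Measurable fun p : (∀ j, α j) × α i => Function.update p.1 i p.2 := by
    exact measurable_update'
  refine ⟨hm, (Measure.pi_eq fun s hs => ?_).symm⟩
  have : (fun p : (∀ j, α j) × α i => Function.update p.1 i p.2) ⁻¹' Set.univ.pi s
      = (Set.univ.pi (Function.update s i Set.univ)) ×ˢ s i := by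
    ext ⟨ω, a⟩
    simp only [Set.mem_preimage, Set.mem_pi, Set.mem_univ, true_implies, Set.mem_prod]
    constructor
    · refine fun h => ⟨fun j => ?_, by simpa using h i⟩
      by_cases hj : j = i
      · subst hj; simp
      · simpa [hj] using h j
    · rintro ⟨h, ha⟩ j
      by_cases hj : j = i
      · subst hj; simpa using ha
      · simpa [hj] using h j
  rw [Measure.map_apply hm (MeasurableSet.univ_pi hs), this, Measure.prod_prod, Measure.pi_pi,
    ← Finset.prod_erase_mul _ _ (Finset.mem_univ i), ← Finset.prod_erase_mul _ _ (Finset.mem_univ i)]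
  simp only [Function.update_self, measure_univ, mul_one]
  congr 1
  refine Finset.prod_congr rfl fun j hj => ?_
  rw [Function.update_of_ne (Finset.ne_of_mem_erase hj)]

end Product

/-! ### Second moments of sums with few dependent pairs -/

/-- If each summand is orthogonal to all but `D` of the summands and has second moment at most `m`,
the second moment of a sum of `n` summands is at most `n D m` instead of `n² m`. -/
theorem integral_sum_sq_le {Ω κ : Type*} [MeasurableSpace Ω] {μ : Measure Ω}
    (s : Finset κ) (Y : κ → Ω → ℝ) (rel : κ → Finset κ) (D : ℕ) {m : ℝ}
    (hY : ∀ p ∈ s, MemLp (Y p) 2 μ) (hm : ∀ p ∈ s, ∫ ω, Y p ω ^ 2 ∂μ ≤ m)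
    (hD : ∀ p ∈ s, (rel p).card ≤ D)
    (horth : ∀ p ∈ s, ∀ p' ∈ s, p' ∉ rel p → ∫ ω, Y p ω * Y p' ω ∂μ = 0) :
    ∫ ω, (∑ p ∈ s, Y p ω) ^ 2 ∂μ ≤ s.card * D * m := by
  classical
  have hint : ∀ p ∈ s, ∀ p' ∈ s, Integrable (fun ω => Y p ω * Y p' ω) μ := fun p hp p' hp' =>
    (hY p hp).integrable_mul (hY p' hp')
  have h1 : ∫ ω, (∑ p ∈ s, Y p ω) ^ 2 ∂μ = ∑ p ∈ s, ∑ p' ∈ s, ∫ ω, Y p ω * Y p' ω ∂μ := by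
    simp_rw [sq, Finset.sum_mul_sum]
    rw [integral_finsetSum _ fun p hp => integrable_finsetSum _ fun p' hp' => hint p hp p' hp']
    exact Finset.sum_congr rfl fun p hp => integral_finsetSum _ fun p' hp' => hint p hp p' hp'
  have h2 : ∀ p ∈ s, ∀ p' ∈ s, ∫ ω, Y p ω * Y p' ω ∂μ ≤ m := by
    intro p hp p' hp'
    have hp2 := (hY p hp).integrable_sq
    have hp2' := (hY p' hp').integrable_sq
    calc ∫ ω, Y p ω * Y p' ω ∂μ
        ≤ ∫ ω, (1 / 2) * (Y p ω ^ 2 + Y p' ω ^ 2) ∂μ :=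
          integral_mono (hint p hp p' hp') ((hp2.add hp2').const_mul _) fun ω => by
            have := sq_nonneg (Y p ω - Y p' ω)
            dsimp
            nlinarith
      _ = (1 / 2) * (∫ ω, Y p ω ^ 2 ∂μ + ∫ ω, Y p' ω ^ 2 ∂μ) := by
          rw [integral_const_mul, integral_add hp2 hp2']
      _ ≤ m := by linarith [hm p hp, hm p' hp']
  have hm0 : ∀ p ∈ s, 0 ≤ m := fun p hp =>
    (integral_nonneg fun ω => sq_nonneg (Y p ω)).trans (hm p hp)
  have h3 : ∀ p ∈ s, ∑ p' ∈ s, ∫ ω, Y p ω * Y p' ω ∂μ ≤ D * m := by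
    intro p hp
    calc ∑ p' ∈ s, ∫ ω, Y p ω * Y p' ω ∂μ
        = ∑ p' ∈ s with p' ∈ rel p, ∫ ω, Y p ω * Y p' ω ∂μ := by
          rw [Finset.sum_filter]
          refine Finset.sum_congr rfl fun p' hp' => ?_
          split_ifs with h
          · rfl
          · exact horth p hp p' hp' h
      _ ≤ (s.filter (· ∈ rel p)).card • m :=
          Finset.sum_le_card_nsmul _ _ _ fun p' hp' => h2 p hp p' (Finset.mem_filter.1 hp').1
      _ ≤ D * m := by
          rw [nsmul_eq_mul]
          refine mul_le_mul_of_nonneg_right ?_ (hm0 p hp)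
          exact_mod_cast (Finset.card_le_card fun x hx => (Finset.mem_filter.1 hx).2).trans (hD p hp)
  rw [h1, mul_assoc, ← nsmul_eq_mul]
  exact Finset.sum_le_card_nsmul _ _ _ h3

/-! ### A central limit theorem for sums of locally dependent variables -/

section DependentSum

variable {ι κ : Type*} {α : ι → Type*} [∀ i, MeasurableSpace (α i)] [Fintype ι]

/-- Centred variables `X k`, bounded by `b`, on a product space, where `X k` is a function of the
coordinates in `src k`. The sets `nb k`, of size at most `D`, contain the `l` for which `src l`
meets `src k`; they are the closed neighbourhoods of the dependency graph. -/
structure LocallyDependent (μ : ∀ i, Measure (α i)) (X : κ → (∀ i, α i) → ℝ)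
    (src : κ → Set ι) (nb : κ → Finset κ) (D : ℕ) (b : ℝ) : Prop where
  measurable : ∀ k, Measurable (X k)
  dependsOn : ∀ k, DependsOn (X k) (src k)
  centred : ∀ k, ∫ ω, X k ω ∂(Measure.pi μ) = 0
  bound : ∀ k, ∀ᵐ ω ∂(Measure.pi μ), |X k ω| ≤ b
  nonneg : 0 ≤ b
  symm : ∀ k l, l ∈ nb k → k ∈ nb l
  disjoint : ∀ k l, l ∉ nb k → Disjoint (src k) (src l)
  card_le : ∀ k, (nb k).card ≤ D

theorem norm_exp_neg_sub_le (x : ℝ) :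
    ‖1 - x * Complex.I - Complex.exp (-(x * Complex.I))‖ ≤ 3 * x ^ 2 := by
  have hn : ‖-((x : ℂ) * Complex.I)‖ = |x| := by simp
  by_cases hx : |x| ≤ 1
  · have := Complex.norm_exp_sub_one_sub_id_le (x := -(x * Complex.I)) (by rwa [hn])
    rw [hn, sq_abs] at this
    rw [← norm_neg]
    have h2 : -(1 - x * Complex.I - Complex.exp (-(x * Complex.I)))
        = Complex.exp (-(x * Complex.I)) - 1 - -(x * Complex.I) := by ring
    rw [h2]
    nlinarith [sq_nonneg x]
  · push Not at hx
    have h1 : ‖Complex.exp (-(x * Complex.I))‖ = 1 := by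
      have := Complex.norm_exp_ofReal_mul_I (-x)
      push_cast at this
      rwa [neg_mul] at this
    calc ‖1 - x * Complex.I - Complex.exp (-(x * Complex.I))‖
        ≤ ‖(1 : ℂ)‖ + ‖(x : ℂ) * Complex.I‖ + ‖Complex.exp (-(x * Complex.I))‖ :=
          (norm_sub_le _ _).trans (add_le_add_left (norm_sub_le _ _) _)
      _ = 2 + |x| := by rw [h1]; simp; ring
      _ ≤ 3 * x ^ 2 := by rw [← sq_abs]; nlinarith

namespace LocallyDependent

variable {μ : ∀ i, Measure (α i)} {X : κ → (∀ i, α i) → ℝ}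
  {src : κ → Set ι} {nb : κ → Finset κ} {D : ℕ} {b : ℝ}

/-- The neighbourhood sum `∑_{l ∈ nb k} X l`. -/
def nbSum (X : κ → (∀ i, α i) → ℝ) (nb : κ → Finset κ) (k : κ) (ω : ∀ i, α i) : ℝ :=
  ∑ l ∈ nb k, X l ω

theorem measurable_nbSum (h : LocallyDependent μ X src nb D b) (k : κ) :
    Measurable (nbSum X nb k) :=
  Finset.measurable_fun_sum _ fun l _ => h.measurable l

theorem bound_nbSum [Countable κ] (h : LocallyDependent μ X src nb D b) (k : κ) :
    ∀ᵐ ω ∂(Measure.pi μ), |nbSum X nb k ω| ≤ D * b := by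
  filter_upwards [ae_all_iff.2 h.bound] with ω hω
  calc |nbSum X nb k ω| ≤ ∑ l ∈ nb k, |X l ω| := Finset.abs_sum_le_sum_abs _ _
    _ ≤ (nb k).card • b := Finset.sum_le_card_nsmul _ _ _ fun l _ => hω l
    _ ≤ D * b := by
        rw [nsmul_eq_mul]
        exact mul_le_mul_of_nonneg_right (by exact_mod_cast h.card_le k) h.nonneg

theorem measurable_sum [Fintype κ]
    (h : LocallyDependent μ X src nb D b) : Measurable fun ω => ∑ k, X k ω :=
  Finset.measurable_fun_sum _ fun l _ => h.measurable l

theorem bound_mul (h : LocallyDependent μ X src nb D b) (k l : κ) :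
    ∀ᵐ ω ∂(Measure.pi μ), |X k ω * X l ω| ≤ b ^ 2 := by
  filter_upwards [h.bound k, h.bound l] with ω h1 h2
  rw [abs_mul, sq]
  exact mul_le_mul h1 h2 (abs_nonneg _) h.nonneg

variable [∀ i, IsProbabilityMeasure (μ i)]

theorem integrable_mul_exp {Y S : (∀ i, α i) → ℝ} (hY : Measurable Y) (hS : Measurable S) {B : ℝ}
    (hB : ∀ᵐ ω ∂(Measure.pi μ), |Y ω| ≤ B) (t : ℝ) :
    Integrable (fun ω => (Y ω : ℂ) * Complex.exp (t * S ω * Complex.I)) (Measure.pi μ) := by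
  refine Integrable.of_bound (by fun_prop) B ?_
  filter_upwards [hB] with ω hω
  rw [norm_mul, ← Complex.ofReal_mul, Complex.norm_exp_ofReal_mul_I, mul_one, Complex.norm_real]
  exact hω

theorem integral_mul_eq_zero (h : LocallyDependent μ X src nb D b) {k l : κ} (hl : l ∉ nb k) :
    ∫ ω, X k ω * X l ω ∂(Measure.pi μ) = 0 := by
  rw [(DependsOn.indepFun μ (h.dependsOn k) (h.dependsOn l) (h.measurable k) (h.measurable l)
    (h.disjoint k l hl)).integral_fun_mul_eq_mul_integral (h.measurable k).aestronglyMeasurable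
    (h.measurable l).aestronglyMeasurable, h.centred k, zero_mul]

theorem memLp_two (h : LocallyDependent μ X src nb D b) (k : κ) : MemLp (X k) 2 (Measure.pi μ) :=
  MemLp.of_bound (h.measurable k).aestronglyMeasurable b (by simpa using h.bound k)

theorem integrable_mul (h : LocallyDependent μ X src nb D b) (k l : κ) :
    Integrable (fun ω => X k ω * X l ω) (Measure.pi μ) :=
  (h.memLp_two k).integrable_mul (h.memLp_two l)

variable [Fintype κ]

/-- `X k` is uncorrelated with `exp(i t (S - ∑_{l ∈ nb k} X l))`. -/
theorem integral_mul_exp_sub (h : LocallyDependent μ X src nb D b) (t : ℝ) (k : κ) :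
    ∫ ω, (X k ω : ℂ) * Complex.exp (t * ((∑ l, X l ω) - nbSum X nb k ω : ℝ) * Complex.I)
      ∂(Measure.pi μ) = 0 := by
  classical
  have hdep : DependsOn (fun ω => (∑ l, X l ω) - nbSum X nb k ω) (src k)ᶜ := by
    have : (fun ω => (∑ l, X l ω) - nbSum X nb k ω)
        = fun ω => ∑ l ∈ Finset.univ \ nb k, X l ω := by
      funext ω
      rw [nbSum, sub_eq_iff_eq_add, Finset.sum_sdiff (Finset.subset_univ _)]
    rw [this]
    refine DependsOn.sum _ h.dependsOn fun l hl => ?_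
    exact (h.disjoint k l (Finset.mem_sdiff.1 hl).2).subset_compl_left
  have hm := h.measurable_sum.sub (h.measurable_nbSum k)
  have hind := DependsOn.indepFun μ (h.dependsOn k) hdep (h.measurable k) hm disjoint_compl_right
  have hXm := h.measurable k
  have := hind.integral_fun_comp_mul_comp (f := fun x : ℝ => (x : ℂ))
    (g := fun x : ℝ => Complex.exp (t * (x : ℝ) * Complex.I))
    hXm.aemeasurable hm.aemeasurable (by fun_prop) (by fun_prop)
  rw [this, integral_complex_ofReal, h.centred k]
  simp

/-- Removing the neighbourhood of `k` from the exponent, to first order. -/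
theorem norm_integral_mul_exp_sub_le (h : LocallyDependent μ X src nb D b) (t : ℝ) (k : κ) :
    ‖∫ ω, (X k ω : ℂ) * Complex.exp (t * (∑ l, X l ω : ℝ) * Complex.I) ∂(Measure.pi μ)
      - t * Complex.I * ∫ ω, ((X k ω * nbSum X nb k ω : ℝ) : ℂ)
        * Complex.exp (t * (∑ l, X l ω : ℝ) * Complex.I) ∂(Measure.pi μ)‖
      ≤ b * (3 * (t * (D * b)) ^ 2) := by
  have hXm := h.measurable k
  have hSm := h.measurable_sum
  have hTm := h.measurable_nbSum k
  have hXT : ∀ᵐ ω ∂(Measure.pi μ), |X k ω * nbSum X nb k ω| ≤ b * (D * b) := by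
    filter_upwards [h.bound k, h.bound_nbSum k] with ω h1 h2
    rw [abs_mul]
    exact mul_le_mul h1 h2 (abs_nonneg _) h.nonneg
  have i1 := integrable_mul_exp (μ := μ) hXm hSm (h.bound k) t
  have i2 : Integrable (fun ω => ((X k ω * nbSum X nb k ω : ℝ) : ℂ)
      * Complex.exp (t * (∑ l, X l ω : ℝ) * Complex.I)) (Measure.pi μ) :=
    integrable_mul_exp (hXm.mul hTm) hSm hXT t
  have i3 : Integrable (fun ω => (X k ω : ℂ)
      * Complex.exp (t * ((∑ l, X l ω) - nbSum X nb k ω : ℝ) * Complex.I)) (Measure.pi μ) :=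
    integrable_mul_exp hXm (hSm.sub hTm) (h.bound k) t
  have i4 : Integrable (fun ω => (X k ω : ℂ) * Complex.exp (t * (∑ l, X l ω : ℝ) * Complex.I)
      - t * Complex.I * (((X k ω * nbSum X nb k ω : ℝ) : ℂ)
        * Complex.exp (t * (∑ l, X l ω : ℝ) * Complex.I))) (Measure.pi μ) :=
    i1.sub (i2.const_mul _)
  rw [← integral_const_mul, ← integral_sub i1 (i2.const_mul _),
    ← sub_zero (∫ ω, _ ∂(Measure.pi μ)), ← h.integral_mul_exp_sub t k,
    ← integral_sub i4 i3]
  have hb : ∀ᵐ ω ∂(Measure.pi μ), ‖(X k ω : ℂ) * Complex.exp (t * (∑ l, X l ω : ℝ) * Complex.I)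
      - t * Complex.I * (((X k ω * nbSum X nb k ω : ℝ) : ℂ)
        * Complex.exp (t * (∑ l, X l ω : ℝ) * Complex.I))
      - (X k ω : ℂ) * Complex.exp (t * ((∑ l, X l ω) - nbSum X nb k ω : ℝ) * Complex.I)‖
      ≤ b * (3 * (t * (D * b)) ^ 2) := by
    filter_upwards [h.bound k, h.bound_nbSum k] with ω h1 h2
    have e1 : Complex.exp (t * ((∑ l, X l ω) - nbSum X nb k ω : ℝ) * Complex.I)
        = Complex.exp (t * (∑ l, X l ω : ℝ) * Complex.I)
          * Complex.exp (-((t * nbSum X nb k ω : ℝ) * Complex.I)) := by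
      rw [← Complex.exp_add]
      congr 1
      push_cast
      ring
    have e2 : (X k ω : ℂ) * Complex.exp (t * (∑ l, X l ω : ℝ) * Complex.I)
      - t * Complex.I * (((X k ω * nbSum X nb k ω : ℝ) : ℂ)
        * Complex.exp (t * (∑ l, X l ω : ℝ) * Complex.I))
      - (X k ω : ℂ) * Complex.exp (t * ((∑ l, X l ω) - nbSum X nb k ω : ℝ) * Complex.I)
      = X k ω * (Complex.exp ((t * (∑ l, X l ω) : ℝ) * Complex.I)
        * (1 - (t * nbSum X nb k ω : ℝ) * Complex.I
          - Complex.exp (-((t * nbSum X nb k ω : ℝ) * Complex.I)))) := by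
      rw [e1]
      push_cast
      ring
    rw [e2, norm_mul, norm_mul, Complex.norm_exp_ofReal_mul_I, one_mul, Complex.norm_real]
    refine mul_le_mul h1 ((norm_exp_neg_sub_le _).trans ?_) (norm_nonneg _) h.nonneg
    have : (t * nbSum X nb k ω) ^ 2 ≤ (t * (D * b)) ^ 2 := by
      rw [mul_pow, mul_pow]
      refine mul_le_mul_of_nonneg_left ?_ (sq_nonneg _)
      exact sq_le_sq' (abs_le.1 h2).1 (abs_le.1 h2).2
    linarith
  refine (norm_integral_le_of_norm_le_const hb).trans ?_
  simp

/-- Only neighbouring pairs contribute to the second moment of the sum. -/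
theorem integral_sum_sq_eq (h : LocallyDependent μ X src nb D b) :
    ∫ ω, (∑ k, X k ω) ^ 2 ∂(Measure.pi μ)
      = ∑ k, ∑ l ∈ nb k, ∫ ω, X k ω * X l ω ∂(Measure.pi μ) := by
  simp_rw [sq, Finset.sum_mul_sum]
  rw [integral_finsetSum _ fun k _ => integrable_finsetSum _ fun l _ => h.integrable_mul k l]
  refine Finset.sum_congr rfl fun k _ => ?_
  rw [integral_finsetSum _ fun l _ => h.integrable_mul k l]
  refine (Finset.sum_subset (Finset.subset_univ _) fun l _ hl => ?_).symm
  exact h.integral_mul_eq_zero hl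

/-- The random variable `∑_k X k ∑_{l ∈ nb k} X l`, whose mean is the variance of `∑_k X k`,
concentrates: two of its summands `X k X l` and `X k' X l'` are independent unless one of `k'`,
`l'` is a neighbour of `k` or `l`, which leaves `4 D²` pairs `(k', l')` for every `(k, l)`. -/
theorem integral_sq_quadratic_sub_le (h : LocallyDependent μ X src nb D b) :
    ∫ ω, (∑ k, X k ω * nbSum X nb k ω - ∫ ω, (∑ k, X k ω) ^ 2 ∂(Measure.pi μ)) ^ 2 ∂(Measure.pi μ)
      ≤ 16 * Fintype.card κ * D ^ 3 * b ^ 4 := by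
  classical
  let s : Finset (Σ _ : κ, κ) := Finset.univ.sigma nb
  let m (p : Σ _ : κ, κ) : ℝ := ∫ ω, X p.1 ω * X p.2 ω ∂(Measure.pi μ)
  let Y (p : Σ _ : κ, κ) (ω : ∀ i, α i) : ℝ := X p.1 ω * X p.2 ω - m p
  let near (p : Σ _ : κ, κ) : Finset (Σ _ : κ, κ) := (nb p.1 ∪ nb p.2).sigma nb
  let rel (p : Σ _ : κ, κ) : Finset (Σ _ : κ, κ) :=
    near p ∪ (near p).image fun p' => ⟨p'.2, p'.1⟩
  have hsum : ∀ ω, ∑ k, X k ω * nbSum X nb k ω - ∫ ω, (∑ k, X k ω) ^ 2 ∂(Measure.pi μ)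
      = ∑ p ∈ s, Y p ω := by
    intro ω
    rw [h.integral_sum_sq_eq, Finset.sum_sigma, ← Finset.sum_sub_distrib]
    refine Finset.sum_congr rfl fun k _ => ?_
    rw [nbSum, Finset.mul_sum, ← Finset.sum_sub_distrib]
  have hm : ∀ p, |m p| ≤ b ^ 2 := fun p => by
    have := norm_integral_le_of_norm_le_const (μ := Measure.pi μ)
      (f := fun ω => X p.1 ω * X p.2 ω) (h.bound_mul p.1 p.2)
    simpa [m, -norm_mul] using this
  have hYm : ∀ p, Measurable (Y p) := fun p =>
    ((h.measurable _).mul (h.measurable _)).sub measurable_const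
  have hYb : ∀ p, ∀ᵐ ω ∂(Measure.pi μ), ‖Y p ω‖ ≤ 2 * b ^ 2 := fun p => by
    filter_upwards [h.bound_mul p.1 p.2] with ω h1
    rw [Real.norm_eq_abs]
    have h2 := hm p
    rw [abs_le] at *
    constructor <;> simp only [Y] <;> linarith
  have hnear : ∀ p, (near p).card ≤ 2 * D * D := fun p => by
    rw [Finset.card_sigma]
    refine (Finset.sum_le_card_nsmul _ _ D fun k _ => h.card_le k).trans ?_
    rw [smul_eq_mul]
    refine Nat.mul_le_mul_right _ ((Finset.card_union_le _ _).trans ?_)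
    have := h.card_le p.1
    have := h.card_le p.2
    omega
  have hrel : ∀ p ∈ s, (rel p).card ≤ 4 * D * D := fun p _ => by
    refine (Finset.card_union_le _ _).trans ?_
    have h1 := hnear p
    have h2 := Finset.card_image_le (s := near p) (f := fun p' => (⟨p'.2, p'.1⟩ : Σ _ : κ, κ))
    nlinarith
  have hdepp : ∀ p : (Σ _ : κ, κ), DependsOn (Y p) (src p.1 ∪ src p.2) := fun p =>
    (DependsOn.map₂ (h.dependsOn p.1) (h.dependsOn p.2) Set.subset_union_left
      Set.subset_union_right fun x y => x * y).map fun x => x - m p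
  have hY0 : ∀ p, ∫ ω, Y p ω ∂(Measure.pi μ) = 0 := fun p => by
    rw [integral_sub (h.integrable_mul _ _) (integrable_const _)]
    simp [m]
  have horth : ∀ p ∈ s, ∀ p' ∈ s, p' ∉ rel p → ∫ ω, Y p ω * Y p' ω ∂(Measure.pi μ) = 0 := by
    intro p _ p' hp' hnot
    have hp'2 : p'.2 ∈ nb p'.1 := (Finset.mem_sigma.1 hp').2
    have hn1 : p'.1 ∉ nb p.1 ∪ nb p.2 := fun hmem =>
      hnot (Finset.mem_union_left _ (Finset.mem_sigma.2 ⟨hmem, hp'2⟩))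
    have hn2 : p'.2 ∉ nb p.1 ∪ nb p.2 := fun hmem =>
      hnot (Finset.mem_union_right _ (Finset.mem_image.2
        ⟨⟨p'.2, p'.1⟩, Finset.mem_sigma.2 ⟨hmem, h.symm _ _ hp'2⟩, rfl⟩))
    rw [Finset.mem_union, not_or] at hn1 hn2
    have hdisj : Disjoint (src p.1 ∪ src p.2) (src p'.1 ∪ src p'.2) := by
      rw [Set.disjoint_union_left, Set.disjoint_union_right, Set.disjoint_union_right]
      exact ⟨⟨h.disjoint _ _ hn1.1, h.disjoint _ _ hn2.1⟩,
        ⟨h.disjoint _ _ hn1.2, h.disjoint _ _ hn2.2⟩⟩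
    rw [(DependsOn.indepFun μ (hdepp p) (hdepp p') (hYm p) (hYm p')
      hdisj).integral_fun_mul_eq_mul_integral (hYm p).aestronglyMeasurable
      (hYm p').aestronglyMeasurable, hY0 p, zero_mul]
  have hY2 : ∀ p ∈ s, ∫ ω, Y p ω ^ 2 ∂(Measure.pi μ) ≤ (2 * b ^ 2) ^ 2 := fun p _ => by
    have : ∀ᵐ ω ∂(Measure.pi μ), ‖Y p ω ^ 2‖ ≤ (2 * b ^ 2) ^ 2 := by
      filter_upwards [hYb p] with ω hω
      rw [norm_pow]
      exact pow_le_pow_left₀ (norm_nonneg _) hω 2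
    have := norm_integral_le_of_norm_le_const this
    rw [Real.norm_eq_abs] at this
    simpa using (le_abs_self _).trans this
  have hmain := integral_sum_sq_le s Y rel (4 * D * D)
    (fun p _ => MemLp.of_bound (hYm p).aestronglyMeasurable _ (hYb p)) hY2 hrel horth
  simp_rw [hsum]
  refine hmain.trans ?_
  have hcard : (s.card : ℝ) ≤ Fintype.card κ * D := by
    have : s.card ≤ Fintype.card κ * D := by
      rw [Finset.card_sigma]
      exact Finset.sum_le_card_nsmul _ _ _ fun k _ => h.card_le k
    exact_mod_cast this
  push_cast
  have : (0 : ℝ) ≤ 4 * D * D * (2 * b ^ 2) ^ 2 := by positivity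
  nlinarith [mul_le_mul_of_nonneg_right hcard this]

/-- Stein's identity for the characteristic function of `S = ∑_k X k`, up to an error. -/
theorem norm_integral_sum_mul_exp_sub_le (h : LocallyDependent μ X src nb D b) (t : ℝ) :
    ‖∫ ω, ((∑ k, X k ω : ℝ) : ℂ) * Complex.exp (t * (∑ l, X l ω : ℝ) * Complex.I) ∂(Measure.pi μ)
      - t * Complex.I * ((∫ ω, (∑ k, X k ω) ^ 2 ∂(Measure.pi μ) : ℝ) : ℂ)
        * ∫ ω, Complex.exp (t * (∑ l, X l ω : ℝ) * Complex.I) ∂(Measure.pi μ)‖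
      ≤ 3 * Fintype.card κ * D ^ 2 * b ^ 3 * t ^ 2
        + 4 * √(Fintype.card κ * D ^ 3 * b ^ 4) * |t| := by
  set v : ℝ := ∫ ω, (∑ k, X k ω) ^ 2 ∂(Measure.pi μ) with hv
  set e : (∀ i, α i) → ℂ := fun ω => Complex.exp (t * (∑ l, X l ω : ℝ) * Complex.I) with he
  have hSm := h.measurable_sum
  have hem : Measurable e := by fun_prop
  have hne : ∀ ω, ‖e ω‖ = 1 := fun ω => by
    rw [he]
    dsimp only
    rw [← Complex.ofReal_mul, Complex.norm_exp_ofReal_mul_I]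
  have hie : Integrable e (Measure.pi μ) := Integrable.of_bound hem.aestronglyMeasurable 1
    (Eventually.of_forall fun ω => (hne ω).le)
  have hXT : ∀ k, ∀ᵐ ω ∂(Measure.pi μ), |X k ω * nbSum X nb k ω| ≤ b * (D * b) := fun k => by
    filter_upwards [h.bound k, h.bound_nbSum k] with ω h1 h2
    rw [abs_mul]
    exact mul_le_mul h1 h2 (abs_nonneg _) h.nonneg
  have hXTm : ∀ k, Measurable fun ω => X k ω * nbSum X nb k ω := fun k =>
    (h.measurable k).mul (h.measurable_nbSum k)
  have i1 : ∀ k, Integrable (fun ω => (X k ω : ℂ) * e ω) (Measure.pi μ) := fun k =>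
    integrable_mul_exp (h.measurable k) hSm (h.bound k) t
  have i2 : ∀ k, Integrable (fun ω => ((X k ω * nbSum X nb k ω : ℝ) : ℂ) * e ω) (Measure.pi μ) :=
    fun k => integrable_mul_exp (hXTm k) hSm (hXT k) t
  set Q : (∀ i, α i) → ℝ := fun ω => ∑ k, X k ω * nbSum X nb k ω with hQ
  have hQm : Measurable Q := Finset.measurable_fun_sum _ fun k _ => hXTm k
  have e1 : ∫ ω, ((∑ k, X k ω : ℝ) : ℂ) * e ω ∂(Measure.pi μ)
      = ∑ k, ∫ ω, (X k ω : ℂ) * e ω ∂(Measure.pi μ) := by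
    rw [← integral_finsetSum _ fun k _ => i1 k]
    refine integral_congr_ae (Eventually.of_forall fun ω => ?_)
    simp [Finset.sum_mul]
  have iQ : Integrable (fun ω => (Q ω : ℂ) * e ω) (Measure.pi μ) := by
    refine (integrable_finsetSum Finset.univ fun k _ => i2 k).congr
      (Eventually.of_forall fun ω => ?_)
    simp [hQ, Finset.sum_mul]
  have e2 : ∫ ω, (Q ω : ℂ) * e ω ∂(Measure.pi μ)
      = ∑ k, ∫ ω, ((X k ω * nbSum X nb k ω : ℝ) : ℂ) * e ω ∂(Measure.pi μ) := by
    rw [← integral_finsetSum _ fun k _ => i2 k]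
    refine integral_congr_ae (Eventually.of_forall fun ω => ?_)
    simp [hQ, Finset.sum_mul]
  have b1 : ‖∫ ω, ((∑ k, X k ω : ℝ) : ℂ) * e ω ∂(Measure.pi μ)
      - t * Complex.I * ∫ ω, (Q ω : ℂ) * e ω ∂(Measure.pi μ)‖
      ≤ Fintype.card κ * (b * (3 * (t * (D * b)) ^ 2)) := by
    rw [e1, e2, Finset.mul_sum, ← Finset.sum_sub_distrib]
    refine (norm_sum_le_of_le _ fun k _ => h.norm_integral_mul_exp_sub_le t k).trans ?_
    simp
  have hQb : ∀ᵐ ω ∂(Measure.pi μ), ‖Q ω‖ ≤ Fintype.card κ * (b * (D * b)) := by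
    filter_upwards [ae_all_iff.2 hXT] with ω hω
    refine (norm_sum_le_of_le _ fun k _ => hω k).trans ?_
    simp
  have hQL : MemLp (fun ω => Q ω - v) 2 (Measure.pi μ) :=
    (MemLp.of_bound hQm.aestronglyMeasurable _ hQb).sub (memLp_const v)
  have b2 : ‖∫ ω, (Q ω : ℂ) * e ω ∂(Measure.pi μ) - (v : ℂ) * ∫ ω, e ω ∂(Measure.pi μ)‖
      ≤ 4 * √(Fintype.card κ * D ^ 3 * b ^ 4) := by
    rw [← integral_const_mul, ← integral_sub iQ (hie.const_mul _)]
    calc ‖∫ ω, ((Q ω : ℂ) * e ω - v * e ω) ∂(Measure.pi μ)‖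
        ≤ ∫ ω, ‖(Q ω : ℂ) * e ω - v * e ω‖ ∂(Measure.pi μ) := norm_integral_le_integral_norm _
      _ = ∫ ω, |Q ω - v| ∂(Measure.pi μ) := by
          refine integral_congr_ae (Eventually.of_forall fun ω => ?_)
          dsimp only
          rw [← sub_mul, norm_mul, hne, mul_one, ← Complex.ofReal_sub, Complex.norm_real,
            Real.norm_eq_abs]
      _ ≤ √(∫ ω, (Q ω - v) ^ 2 ∂(Measure.pi μ)) := by
          refine Real.le_sqrt_of_sq_le ?_
          have hvar := variance_nonneg (fun ω => |Q ω - v|) (Measure.pi μ)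
          have habs : MemLp (fun ω => |Q ω - v|) 2 (Measure.pi μ) := hQL.abs
          rw [variance_eq_sub habs] at hvar
          simpa using hvar
      _ ≤ √(4 ^ 2 * (Fintype.card κ * D ^ 3 * b ^ 4)) := by
          refine Real.sqrt_le_sqrt (h.integral_sq_quadratic_sub_le.trans_eq ?_)
          ring
      _ = 4 * √(Fintype.card κ * D ^ 3 * b ^ 4) := by
          rw [Real.sqrt_mul (by norm_num), Real.sqrt_sq (by norm_num)]
  have e3 : ∫ ω, ((∑ k, X k ω : ℝ) : ℂ) * e ω ∂(Measure.pi μ)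
      - t * Complex.I * (v : ℂ) * ∫ ω, e ω ∂(Measure.pi μ)
      = (∫ ω, ((∑ k, X k ω : ℝ) : ℂ) * e ω ∂(Measure.pi μ)
        - t * Complex.I * ∫ ω, (Q ω : ℂ) * e ω ∂(Measure.pi μ))
      + t * Complex.I * (∫ ω, (Q ω : ℂ) * e ω ∂(Measure.pi μ)
        - (v : ℂ) * ∫ ω, e ω ∂(Measure.pi μ)) := by ring
  rw [e3]
  refine (norm_add_le _ _).trans ?_
  have b3 : ‖t * Complex.I * (∫ ω, (Q ω : ℂ) * e ω ∂(Measure.pi μ)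
        - (v : ℂ) * ∫ ω, e ω ∂(Measure.pi μ))‖
      ≤ |t| * (4 * √(Fintype.card κ * D ^ 3 * b ^ 4)) := by
    rw [norm_mul]
    have : ‖(t : ℂ) * Complex.I‖ = |t| := by simp
    rw [this]
    exact mul_le_mul_of_nonneg_left b2 (abs_nonneg _)
  refine (add_le_add b1 b3).trans (le_of_eq ?_)
  ring

/-- The characteristic function of `∑_k X k` is close to that of a normal law of the same
variance. By Stein's identity it solves the differential equation `φ' = -v t φ` of the Gaussian
characteristic function up to a small error. -/
theorem norm_charFun_sub_le (h : LocallyDependent μ X src nb D b) (t : ℝ) :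
    ‖charFun ((Measure.pi μ).map fun ω => ∑ k, X k ω) t
      - Complex.exp (-((∫ ω, (∑ k, X k ω) ^ 2 ∂(Measure.pi μ) : ℝ) : ℂ) * t ^ 2 / 2)‖
      ≤ 3 * Fintype.card κ * D ^ 2 * b ^ 3 * |t| ^ 3
        + 4 * √(Fintype.card κ * D ^ 3 * b ^ 4) * t ^ 2 := by
  set v : ℝ := ∫ ω, (∑ k, X k ω) ^ 2 ∂(Measure.pi μ) with hv
  set ν := (Measure.pi μ).map fun ω => ∑ k, X k ω with hν
  set A : ℝ := 3 * Fintype.card κ * D ^ 2 * b ^ 3 with hA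
  set B : ℝ := 4 * √(Fintype.card κ * D ^ 3 * b ^ 4) with hB
  have hA0 : 0 ≤ A := by have := h.nonneg; positivity
  have hB0 : 0 ≤ B := by positivity
  have hv0 : 0 ≤ v := integral_nonneg fun ω => sq_nonneg _
  have hSm := h.measurable_sum
  have hνp : IsProbabilityMeasure ν := Measure.isProbabilityMeasure_map hSm.aemeasurable
  have hL : MemLp id (1 : ℕ) ν := by
    refine (memLp_map_measure_iff aestronglyMeasurable_id hSm.aemeasurable).2 ?_
    refine MemLp.of_bound hSm.aestronglyMeasurable (Fintype.card κ * b) ?_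
    filter_upwards [ae_all_iff.2 h.bound] with ω hω
    refine (norm_sum_le_of_le _ fun k _ => hω k).trans ?_
    simp
  have hchar : ∀ s : ℝ, charFun ν s
      = ∫ ω, Complex.exp (s * (∑ l, X l ω : ℝ) * Complex.I) ∂(Measure.pi μ) := fun s => by
    rw [charFun_apply_real, hν, integral_map hSm.aemeasurable (by fun_prop)]
  have hder : ∀ s : ℝ, HasDerivAt (charFun ν) (Complex.I * ∫ ω, ((∑ k, X k ω : ℝ) : ℂ)
      * Complex.exp (s * (∑ l, X l ω : ℝ) * Complex.I) ∂(Measure.pi μ)) s := fun s => by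
    have hd : DifferentiableAt ℝ (charFun ν) s :=
      ((contDiff_charFun hL).differentiable (by simp)) s
    have := iteratedDeriv_charFun (t := s) hL
    rw [iteratedDeriv_one] at this
    refine hd.hasDerivAt.congr_deriv ?_
    rw [this, hν, integral_map hSm.aemeasurable (by fun_prop)]
    simp
  let f : ℝ → ℂ := fun s => charFun ν s * Complex.exp ((v * s ^ 2 / 2 : ℝ) : ℂ)
  let f' : ℝ → ℂ := fun s => Complex.I * (∫ ω, ((∑ k, X k ω : ℝ) : ℂ)
      * Complex.exp (s * (∑ l, X l ω : ℝ) * Complex.I) ∂(Measure.pi μ)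
      - s * Complex.I * (v : ℂ) * charFun ν s) * Complex.exp ((v * s ^ 2 / 2 : ℝ) : ℂ)
  have hf : ∀ s, HasDerivAt f (f' s) s := fun s => by
    have h1 : HasDerivAt (fun s : ℝ => v * s ^ 2 / 2) (v * s) s := by
      refine ((((hasDerivAt_id s).pow 2).const_mul v).div_const 2).congr_deriv ?_
      simp
      ring
    have h2 := (hder s).mul h1.ofReal_comp.cexp
    refine h2.congr_deriv ?_
    simp only [f']
    have hI : Complex.I * Complex.I = -1 := Complex.I_mul_I
    push_cast
    linear_combination (s * v * charFun ν s * Complex.exp (v * s ^ 2 / 2)) * hI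
  have hbound : ∀ s ∈ Metric.closedBall (0 : ℝ) |t|,
      ‖f' s‖ ≤ (A * t ^ 2 + B * |t|) * Real.exp (v * t ^ 2 / 2) := fun s hs => by
    have hs' : |s| ≤ |t| := by simpa using hs
    have hs2 : s ^ 2 ≤ t ^ 2 := sq_le_sq.2 hs'
    have hst := h.norm_integral_sum_mul_exp_sub_le s
    rw [← hchar s, ← hv] at hst
    simp only [f']
    rw [norm_mul, norm_mul, Complex.norm_I, one_mul, Complex.norm_exp, Complex.ofReal_re]
    have h3 : Real.exp (v * s ^ 2 / 2) ≤ Real.exp (v * t ^ 2 / 2) := by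
      refine Real.exp_le_exp.2 ?_
      nlinarith
    refine mul_le_mul (hst.trans ?_) h3 (Real.exp_pos _).le (by positivity)
    exact add_le_add (mul_le_mul_of_nonneg_left hs2 hA0) (mul_le_mul_of_nonneg_left hs' hB0)
  have hmv := Convex.norm_image_sub_le_of_norm_hasDerivWithin_le (f := f) (f' := f')
    (fun s _ => (hf s).hasDerivWithinAt) hbound (convex_closedBall (0 : ℝ) |t|)
    (x := 0) (y := t) (by simp) (by simp)
  have h0 : f 0 = 1 := by simp [f]
  rw [h0, sub_zero, Real.norm_eq_abs] at hmv
  have hfac : charFun ν t - Complex.exp (-(v : ℂ) * t ^ 2 / 2)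
      = (f t - 1) * Complex.exp ((-(v * t ^ 2 / 2) : ℝ) : ℂ) := by
    simp only [f]
    rw [sub_mul, mul_assoc, ← Complex.exp_add, one_mul]
    push_cast
    rw [add_neg_cancel, Complex.exp_zero, mul_one]
    ring_nf
  rw [hfac, norm_mul, Complex.norm_exp, Complex.ofReal_re]
  have hexp : Real.exp (v * t ^ 2 / 2) * Real.exp (-(v * t ^ 2 / 2)) = 1 := by
    rw [← Real.exp_add, add_neg_cancel, Real.exp_zero]
  calc ‖f t - 1‖ * Real.exp (-(v * t ^ 2 / 2))
      ≤ (A * t ^ 2 + B * |t|) * Real.exp (v * t ^ 2 / 2) * |t| * Real.exp (-(v * t ^ 2 / 2)) :=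
        mul_le_mul_of_nonneg_right hmv (Real.exp_pos _).le
    _ = (A * t ^ 2 + B * |t|) * |t|
          * (Real.exp (v * t ^ 2 / 2) * Real.exp (-(v * t ^ 2 / 2))) := by ring
    _ = A * |t| ^ 3 + B * t ^ 2 := by rw [hexp, ← sq_abs t]; ring

end LocallyDependent
end DependentSum
/-! ### Uniform convergence of distribution functions -/

theorem continuous_cdf_of_nullSingletonClass (γ : Measure ℝ) [IsProbabilityMeasure γ] [NullSingletonClass γ] :
    Continuous (cdf γ) := by
  refine continuous_iff_continuousAt.2 fun x => ?_
  have h1 : (cdf γ).measure {x} = 0 := by rw [measure_cdf]; exact measure_singleton x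
  rw [StieltjesFunction.measure_singleton, ENNReal.ofReal_eq_zero, sub_nonpos] at h1
  rw [(cdf γ).mono.continuousAt_iff_leftLim_eq_rightLim, StieltjesFunction.rightLim_eq]
  exact le_antisymm ((cdf γ).mono.leftLim_le le_rfl) h1

/-- **Pólya's theorem**: weak convergence to a law without atoms entails uniform convergence of
the distribution functions, by comparison at finitely many quantiles of the limit. -/
theorem eventually_forall_abs_cdf_sub_lt {ν : ℕ → ProbabilityMeasure ℝ} {γ : ProbabilityMeasure ℝ}
    [NullSingletonClass (γ : Measure ℝ)] (h : Tendsto ν atTop (𝓝 γ)) {ε : ℝ} (hε : 0 < ε) :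
    ∀ᶠ N in atTop, ∀ x : ℝ,
      |(ν N : Measure ℝ).real (Set.Iic x) - (γ : Measure ℝ).real (Set.Iic x)| < ε := by
  set Φ : ℝ → ℝ := fun x => (γ : Measure ℝ).real (Set.Iic x) with hΦ
  have hcdf : Φ = cdf (γ : Measure ℝ) := by
    funext x
    rw [cdf_eq_real]
  have hΦm : Monotone Φ := by rw [hcdf]; exact (cdf _).mono
  have hΦ0 : ∀ x, 0 ≤ Φ x := fun x => measureReal_nonneg
  have hΦ1 : ∀ x, Φ x ≤ 1 := fun x => measureReal_le_one
  have hquant : ∀ y ∈ Set.Ioo (0 : ℝ) 1, ∃ x, Φ x = y := fun y hy => by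
    rw [hcdf]
    refine mem_range_of_exists_le_of_exists_ge (continuous_cdf_of_nullSingletonClass _) ?_ ?_
    · exact ((tendsto_cdf_atBot (γ : Measure ℝ)).eventually_le_const hy.1).exists
    · exact ((tendsto_cdf_atTop (γ : Measure ℝ)).eventually_const_le hy.2).exists
  have hpt : ∀ x, Tendsto (fun N => (ν N : Measure ℝ).real (Set.Iic x)) atTop (𝓝 (Φ x)) := fun x => by
    have := ProbabilityMeasure.tendsto_measure_of_null_frontier_of_tendsto' h
      (E := Set.Iic x) (by rw [frontier_Iic]; exact measure_singleton x)
    exact (ENNReal.tendsto_toReal (measure_ne_top _ _)).comp this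
  obtain ⟨m, hm⟩ := exists_nat_gt (3 / ε)
  have hm0 : (0 : ℝ) < m := (by positivity : (0 : ℝ) < 3 / ε).trans hm
  have hmε : 3 / (m : ℝ) < ε := by
    rw [div_lt_iff₀ hε] at hm
    rw [div_lt_iff₀ hm0]
    linarith
  have hgrid : ∀ j : ℕ, ∃ x, 0 < j → j < m → Φ x = j / m := fun j => by
    by_cases hj : 0 < j ∧ j < m
    · obtain ⟨x, hx⟩ := hquant (j / m) ⟨by have := hj.1; positivity,
        by rw [div_lt_one hm0]; exact_mod_cast hj.2⟩
      exact ⟨x, fun _ _ => hx⟩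
    · exact ⟨0, fun h1 h2 => absurd ⟨h1, h2⟩ hj⟩
  choose g hg using hgrid
  have hev : ∀ᶠ N in atTop, ∀ j ∈ Finset.range m,
      |(ν N : Measure ℝ).real (Set.Iic (g j)) - Φ (g j)| < 1 / m := by
    refine (Filter.eventually_all_finset _).2 fun j _ => ?_
    have := (hpt (g j)).sub_const (Φ (g j))
    rw [sub_self] at this
    have h2 := this.abs
    rw [abs_zero] at h2
    exact h2.eventually_lt_const (by positivity)
  filter_upwards [hev] with N hN x
  set F : ℝ → ℝ := fun x => (ν N : Measure ℝ).real (Set.Iic x) with hF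
  have hFm : Monotone F := fun a b hab => measureReal_mono (Set.Iic_subset_Iic.2 hab)
  have hF0 : 0 ≤ F x := measureReal_nonneg
  have hF1 : F x ≤ 1 := measureReal_le_one
  have hmΦ : 0 ≤ m * Φ x := mul_nonneg hm0.le (hΦ0 x)
  have hthree : 3 / (m : ℝ) = 3 * (1 / m) := by ring
  have hpos : (0 : ℝ) < 1 / m := by positivity
  rw [hthree] at hmε
  suffices h : F x ≤ Φ x + 2 * (1 / m) ∧ Φ x - 2 * (1 / m) ≤ F x by
    change |F x - Φ x| < ε
    rw [abs_lt]
    constructor <;> linarith [h.1, h.2]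
  constructor
  · -- the first grid value above `Φ x`
    set j := ⌊(m : ℝ) * Φ x⌋₊ + 1 with hj
    have hj1 : (m : ℝ) * Φ x < j := by
      rw [hj]; push_cast; exact Nat.lt_floor_add_one _
    have hj2 : (j : ℝ) ≤ m * Φ x + 1 := by
      rw [hj]; push_cast; linarith [Nat.floor_le hmΦ]
    have hj3 : (j : ℝ) / m ≤ Φ x + 1 / m := by
      rw [div_le_iff₀ hm0]
      field_simp
      linarith
    have hj4 : Φ x < j / m := by
      rw [lt_div_iff₀ hm0]
      linarith
    by_cases hjm : j < m
    · have hgj := hg j (Nat.succ_pos _) hjm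
      have hx : x ≤ g j := le_of_lt (hΦm.reflect_lt (by rw [hgj]; exact hj4))
      have hNj := (abs_lt.1 (hN j (Finset.mem_range.2 hjm))).2
      rw [hgj] at hNj
      have := hFm hx
      simp only [hF] at this ⊢
      linarith
    · have : (1 : ℝ) ≤ j / m := by
        rw [le_div_iff₀ hm0, one_mul]
        exact_mod_cast not_lt.1 hjm
      linarith
  · -- the last grid value below `Φ x`
    set j := ⌈(m : ℝ) * Φ x⌉₊ - 1 with hj
    by_cases hj0 : 0 < j
    · have hjc : (j : ℝ) + 1 = ⌈(m : ℝ) * Φ x⌉₊ := by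
        have : j + 1 = ⌈(m : ℝ) * Φ x⌉₊ := by omega
        exact_mod_cast this
      have hj1 : (j : ℝ) < m * Φ x := by linarith [Nat.ceil_lt_add_one hmΦ]
      have hj2 : (m : ℝ) * Φ x ≤ j + 1 := by linarith [Nat.le_ceil ((m : ℝ) * Φ x)]
      have hjm : j < m := by
        have : (j : ℝ) < m := hj1.trans_le (by nlinarith [hΦ1 x])
        exact_mod_cast this
      have hgj := hg j hj0 hjm
      have hj3 : Φ x - 1 / m ≤ j / m := by
        rw [le_div_iff₀ hm0]
        field_simp
        linarith
      have hj4 : (j : ℝ) / m < Φ x := by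
        rw [div_lt_iff₀ hm0]
        linarith
      have hx : g j ≤ x := le_of_lt (hΦm.reflect_lt (by rw [hgj]; exact hj4))
      have hNj := (abs_lt.1 (hN j (Finset.mem_range.2 hjm))).1
      rw [hgj] at hNj
      have := hFm hx
      simp only [hF] at this ⊢
      linarith
    · have hc : ⌈(m : ℝ) * Φ x⌉₊ ≤ 1 := by omega
      have : (m : ℝ) * Φ x ≤ 1 := by
        have := Nat.ceil_le.1 hc
        exact_mod_cast this
      have : Φ x ≤ 1 / m := by
        rw [le_div_iff₀ hm0]
        linarith
      linarith

/-- Convergence of the characteristic functions, uniformly over sets of laws, entails weak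
convergence of every sequence picked from the sets. -/
theorem tendsto_of_charFun_uniform {𝓜 : ℕ → Set (ProbabilityMeasure ℝ)} {γ : ProbabilityMeasure ℝ}
    (h : ∀ t : ℝ, ∀ ε > 0, ∀ᶠ N in atTop, ∀ μ ∈ 𝓜 N,
      ‖charFun (μ : Measure ℝ) t - charFun (γ : Measure ℝ) t‖ < ε)
    (ν : ℕ → ProbabilityMeasure ℝ) :
    Tendsto ν (atTop ⊓ 𝓟 {N | ν N ∈ 𝓜 N}) (𝓝 γ) := by
  classical
  -- Lévy's theorem is for sequences along `atTop`: the members outside of the sets become `γ`.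
  have key : Tendsto (fun N => if ν N ∈ 𝓜 N then ν N else γ) atTop (𝓝 γ) := by
    refine ProbabilityMeasure.tendsto_of_tendsto_charFun fun t => ?_
    rw [Metric.tendsto_nhds]
    intro ε hε
    filter_upwards [h t ε hε] with N hN
    split_ifs with hmem
    · rw [dist_eq_norm]
      exact hN _ hmem
    · simpa using hε
  refine (key.mono_left inf_le_left).congr' ?_
  filter_upwards [mem_inf_of_right (mem_principal_self _)] with N hN
  exact if_pos hN

/-- Convergence of the characteristic functions, uniformly over sets of laws, entails uniform
convergence of the distribution functions. -/
theorem cdf_uniform_of_charFun_uniform {𝓜 : ℕ → Set (ProbabilityMeasure ℝ)}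
    {γ : ProbabilityMeasure ℝ} [NullSingletonClass (γ : Measure ℝ)]
    (h : ∀ t : ℝ, ∀ ε > 0, ∀ᶠ N in atTop, ∀ μ ∈ 𝓜 N,
      ‖charFun (μ : Measure ℝ) t - charFun (γ : Measure ℝ) t‖ < ε) {ε : ℝ} (hε : 0 < ε) :
    ∀ᶠ N in atTop, ∀ μ ∈ 𝓜 N, ∀ x : ℝ,
      |(μ : Measure ℝ).real (Set.Iic x) - (γ : Measure ℝ).real (Set.Iic x)| < ε := by
  classical
  let bad (N : ℕ) (μ : ProbabilityMeasure ℝ) : Prop := μ ∈ 𝓜 N ∧ ∃ x : ℝ,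
    ε ≤ |(μ : Measure ℝ).real (Set.Iic x) - (γ : Measure ℝ).real (Set.Iic x)|
  -- A violating member of each set that has one.
  have hex : ∀ N, ∃ μ, (∃ μ', bad N μ') → bad N μ := fun N => by
    by_cases hb : ∃ μ', bad N μ'
    · exact ⟨hb.choose, fun _ => hb.choose_spec⟩
    · exact ⟨γ, fun h => absurd h hb⟩
  choose ν hν using hex
  have key : Tendsto (fun N => if ν N ∈ 𝓜 N then ν N else γ) atTop (𝓝 γ) :=
    Tendsto.if (tendsto_of_charFun_uniform h ν) tendsto_const_nhds
  filter_upwards [eventually_forall_abs_cdf_sub_lt key hε] with N hN μ hμ x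
  by_contra hlt
  have hb := hν N ⟨μ, hμ, x, not_lt.1 hlt⟩
  obtain ⟨y, hy⟩ := hb.2
  have := hN y
  rw [if_pos hb.1] at this
  exact absurd this (not_lt.2 hy)

/-! ### Which exogenous variables enter the data of a unit -/

/-- A function of finitely many variables depends only on those that, changed alone, can change
its value. -/
theorem dependsOn_of_forall_notMem {ι : Type*} [Finite ι] {α : ι → Type*} {β : Type*}
    (f : (∀ i, α i) → β) (s : Set ι)
    (h : ∀ m ∉ s, ∀ v v' : ∀ i, α i, (∀ j, j ≠ m → v j = v' j) → f v = f v') :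
    DependsOn f s := by
  classical
  have := Fintype.ofFinite ι
  suffices H : ∀ A : Finset ι, ∀ v v' : ∀ i, α i, (∀ j ∉ A, v j = v' j) →
      (∀ j ∈ s, v j = v' j) → f v = f v' from
    fun v v' hv => H Finset.univ v v' (fun j hj => absurd (Finset.mem_univ j) hj) hv
  intro A
  induction A using Finset.induction_on with
  | empty => exact fun v v' hv _ => congrArg f (funext fun j => hv j (Finset.notMem_empty j))
  | insert m A hm ih =>
    intro v v' hA hs
    by_cases hms : m ∈ s
    · refine ih v v' (fun j hj => ?_) hs
      by_cases hjm : j = m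
      · subst hjm; exact hs j hms
      · exact hA j (by simp [hjm, hj])
    · rw [h m hms v (Function.update v m (v' m)) fun j hj => by rw [Function.update_of_ne hj]]
      refine ih _ v' (fun j hj => ?_) fun j hj => ?_
      · by_cases hjm : j = m
        · subst hjm; simp
        · rw [Function.update_of_ne hjm]; exact hA j (by simp [hjm, hj])
      · rw [Function.update_of_ne fun hjm : j = m => hms (hjm ▸ hj)]; exact hs j hj

namespace Network

variable {N q r t : ℕ} (net : Network N q r t)

theorem featZ_congr (i : Fin N) {c c' : Fin N → Conf q}
    (h : ∀ l, net.ConfInZ i l → c l = c' l) : net.featZ c i = net.featZ c' i := by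
  have hd : DependsOn (fun v : {j : Fin N // j ≠ i} → Conf q => net.fz i v net.graph)
      {j | net.ConfInZ i j} := by
    refine dependsOn_of_forall_notMem _ _ fun m hm v v' hv => ?_
    by_contra hne
    exact hm ⟨v, v', fun j hj => hv j fun hjm => hj (congrArg Subtype.val hjm), hne⟩
  exact hd fun j hj => h j hj

theorem featX_congr (i : Fin N) {w w' : Fin N → Bool} {c c' : Fin N → Conf q}
    (hw : ∀ m, net.TreatInX i m → w m = w' m) (hc : ∀ l, net.ConfInX i l → c l = c' l) :
    net.featX w c i = net.featX w' c' i := by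
  have hd1 : DependsOn (fun v : {j : Fin N // j ≠ i} → Bool =>
      net.fx i (fun j => (v j, c j)) net.graph) {j | net.TreatInX i j} := by
    refine dependsOn_of_forall_notMem _ _ fun m hm v v' hv => ?_
    by_contra hne
    refine hm ⟨fun j => (v j, c j), fun j => (v' j, c j), fun j hj => ?_, fun j => rfl, hne⟩
    dsimp only
    rw [hv j fun hjm => hj (congrArg Subtype.val hjm)]
  have hd2 : DependsOn (fun v : {j : Fin N // j ≠ i} → Conf q =>
      net.fx i (fun j => (w' j, v j)) net.graph) {j | net.ConfInX i j} := by
    refine dependsOn_of_forall_notMem _ _ fun m hm v v' hv => ?_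
    by_contra hne
    refine hm ⟨fun j => (w' j, v j), fun j => (w' j, v' j), fun j hj => ?_, fun j => rfl, hne⟩
    dsimp only
    rw [hv j fun hjm => hj (congrArg Subtype.val hjm)]
  have h1 : net.featX w c i = net.featX w' c i :=
    hd1 (x := fun j => w j) (y := fun j => w' j) fun j hj => hw j hj
  have h2 : net.featX w' c i = net.featX w' c' i :=
    hd2 (x := fun j => c j) (y := fun j => c' j) fun j hj => hc j hj
  exact h1.trans h2

/-- The feature `X_i` is a function of the treatments and confounders of the other units. -/
theorem featX_congr_of_ne (i : Fin N) {w w' : Fin N → Bool} {c c' : Fin N → Conf q}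
    (hw : ∀ j, j ≠ i → w j = w' j) (hc : ∀ j, j ≠ i → c j = c' j) :
    net.featX w c i = net.featX w' c' i := by
  unfold featX
  congr 1
  funext j
  rw [hw j j.2, hc j j.2]

theorem sources_disjoint {i j : Fin N} (hij : i ≠ j) (h : ¬ net.depGraph.Adj i j) :
    Disjoint (net.sources i) (net.sources j) := by
  rw [Set.disjoint_iff_inter_eq_empty, ← Set.not_nonempty_iff_eq_empty]
  exact fun hn => h ⟨hij, hn⟩

open Classical in
/-- The closed neighbourhood of a unit in the dependency graph. -/
noncomputable def nbhd (i : Fin N) : Finset (Fin N) := insert i (net.depGraph.neighborFinset i)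

theorem mem_nbhd {i j : Fin N} : j ∈ net.nbhd i ↔ j = i ∨ net.depGraph.Adj i j := by
  simp [nbhd]

theorem mem_nbhd_symm {i j : Fin N} (h : j ∈ net.nbhd i) : i ∈ net.nbhd j := by
  rw [mem_nbhd] at *
  exact h.imp Eq.symm fun h => h.symm

theorem sources_disjoint_of_notMem_nbhd {i j : Fin N} (h : j ∉ net.nbhd i) :
    Disjoint (net.sources i) (net.sources j) := by
  rw [mem_nbhd, not_or] at h
  exact net.sources_disjoint (Ne.symm h.1) h.2

theorem card_nbhd_le (i : Fin N) : (net.nbhd i).card ≤ net.maxDeg + 1 := by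
  classical
  refine (Finset.card_insert_le _ _).trans (Nat.succ_le_succ ?_)
  rw [SimpleGraph.card_neighborFinset_eq_degree]
  exact SimpleGraph.degree_le_maxDegree _ _

end Network

namespace SEM

variable {N q r t : ℕ} (M : SEM N q r t) (net : Network N q r t)

theorem Z_congr (i : Fin N) {ω ω' : Exo N q} (h : ∀ l, net.ConfInZ i l → (ω l).1 = (ω' l).1) :
    Z net ω i = Z net ω' i :=
  net.featZ_congr i h

theorem W_congr (m : Fin N) {ω ω' : Exo N q} (h : ∀ l, l = m ∨ net.ConfInZ m l → ω l = ω' l) :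
    M.W net ω m = M.W net ω' m := by
  unfold W C
  rw [Z_congr net m (ω := ω) (ω' := ω') fun l hl => by rw [h l (Or.inr hl)], h m (Or.inl rfl)]

/-- The data `S_i` are a function of the exogenous variables of the units in `sources i`. -/
theorem dependsOn_S (i : Fin N) : DependsOn (fun ω => M.S net ω i) (net.sources i) := by
  intro ω ω' h
  have hi : ω i = ω' i := h i (Or.inl rfl)
  have hZ : Z net ω i = Z net ω' i := Z_congr net i fun l hl => by rw [h l (Or.inr (Or.inl hl))]
  have hW : M.W net ω i = M.W net ω' i := M.W_congr net i fun l hl =>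
    h l (hl.elim Or.inl fun hl => Or.inr (Or.inl hl))
  have hX : M.X net ω i = M.X net ω' i := net.featX_congr i
    (fun m hm => M.W_congr net m fun l hl => h l (Or.inr (Or.inr (Or.inr ⟨m, hm, hl⟩))))
    fun l hl => by
      change (ω l).1 = (ω' l).1
      rw [h l (Or.inr (Or.inr (Or.inl hl)))]
  have hC : C ω i = C ω' i := by unfold C; rw [hi]
  have hX' : net.featX (M.W net ω) (C ω) i = net.featX (M.W net ω') (C ω') i := hX
  simp only [S, Y, outcome, hW, hC, hX, hZ, hX', hi]

end SEM

/-! ### Measurability of the model -/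

theorem measurable_ind : Measurable ind := measurable_of_countable _

namespace SEM

variable {N q r t : ℕ} (M : SEM N q r t) (net : Network N q r t)

theorem measurable_C (i : Fin N) : Measurable fun ω : Exo N q => C ω i :=
  measurable_fst.comp (measurable_pi_apply i)

theorem measurable_Z (i : Fin N) : Measurable fun ω : Exo N q => Z net ω i :=
  (net.measurable_fz i).comp (measurable_pi_lambda _ fun j => measurable_C (j : Fin N))

theorem measurable_U (i : Fin N) : Measurable fun ω : Exo N q => U net ω i :=
  (measurable_C i).prodMk (measurable_Z net i)

theorem measurable_W (i : Fin N) : Measurable fun ω => M.W net ω i := by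
  refine measurable_to_bool ?_
  have : (fun ω => M.W net ω i) ⁻¹' {true} = {ω | (ω i).2.1 ≤ M.nuis.h (U net ω i)} := by
    ext ω
    simp [W, U]
  rw [this]
  refine measurableSet_le ?_ (M.measurable_h.comp (measurable_U net i))
  exact measurable_fst.comp (measurable_snd.comp (measurable_pi_apply i))

theorem measurable_X (i : Fin N) : Measurable fun ω => M.X net ω i :=
  (net.measurable_fx i).comp (measurable_pi_lambda _ fun j =>
    (M.measurable_W net (j : Fin N)).prodMk (measurable_C (j : Fin N)))

theorem measurable_D (i : Fin N) : Measurable fun ω => M.D net ω i :=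
  (measurable_C i).prodMk (M.measurable_X net i)

theorem measurable_noise (i : Fin N) : Measurable fun ω : Exo N q => (ω i).2.2 :=
  measurable_snd.comp (measurable_snd.comp (measurable_pi_apply i))

/-- The outcome of unit `i` as a function of its treatment, its confounder, its feature and its
noise. -/
def outcomeAt (i : Fin N) (b : Bool) (c : Conf q) (x : Feat r) (v : ℝ) : ℝ :=
  ind b * M.nuis.g1 (c, x) + (1 - ind b) * M.nuis.g0 (c, x) + M.err i b c x v

theorem measurable_outcomeAt (i : Fin N) : Measurable fun p : Bool × Conf q × Feat r × ℝ =>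
    M.outcomeAt i p.1 p.2.1 p.2.2.1 p.2.2.2 := by
  have h1 : Measurable fun p : Bool × Conf q × Feat r × ℝ => (p.2.1, p.2.2.1) := by fun_prop
  have hi : Measurable fun p : Bool × Conf q × Feat r × ℝ => ind p.1 :=
    measurable_ind.comp measurable_fst
  exact ((hi.mul (M.measurable_g1.comp h1)).add
    ((measurable_const.sub hi).mul (M.measurable_g0.comp h1))).add (M.measurable_err i)

theorem Y_eq (ω : Exo N q) (i : Fin N) :
    M.Y net ω i = M.outcomeAt i (M.W net ω i) (C ω i) (M.X net ω i) (ω i).2.2 := rfl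

theorem measurable_Y (i : Fin N) : Measurable fun ω => M.Y net ω i :=
  (M.measurable_outcomeAt i).comp ((M.measurable_W net i).prodMk
    ((measurable_C i).prodMk ((M.measurable_X net i).prodMk (measurable_noise i))))

theorem measurable_S (i : Fin N) : Measurable fun ω => M.S net ω i :=
  (M.measurable_W net i).prodMk ((measurable_C i).prodMk ((M.measurable_X net i).prodMk
    ((measurable_Z net i).prodMk (M.measurable_Y net i))))

theorem measurable_trainData {K : ℕ} (fold : Fin N → Fin K) (k : Fin K) :
    Measurable (M.trainData net fold k) :=
  measurable_pi_lambda _ fun j => M.measurable_S net j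

end SEM

/-- The score is jointly measurable in the training data and the unit it is evaluated at. -/
theorem MeasurableLearner.measurable_score {ι : Type} {q r t : ℕ}
    {L : (ι → UnitData q r t) → Nuisance q r t} (hL : MeasurableLearner L) :
    Measurable fun p : (ι → UnitData q r t) × UnitData q r t => score p.2 (L p.1) := by
  have hd : Measurable fun p : (ι → UnitData q r t) × UnitData q r t =>
      (p.1, (p.2.2.1, p.2.2.2.1)) := by fun_prop
  have hu : Measurable fun p : (ι → UnitData q r t) × UnitData q r t =>
      (p.1, (p.2.2.1, p.2.2.2.2.1)) := by fun_prop
  have hy : Measurable fun p : (ι → UnitData q r t) × UnitData q r t => p.2.2.2.2.2 := by fun_prop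
  have hw : Measurable fun p : (ι → UnitData q r t) × UnitData q r t => ind p.2.1 :=
    measurable_ind.comp (measurable_fst.comp measurable_snd)
  have h1 := hL.g1.comp hd
  have h0 := hL.g0.comp hd
  have hh := hL.h.comp hu
  exact ((h1.sub h0).add ((hw.div hh).mul (hy.sub h1))).sub
    (((measurable_const.sub hw).div (measurable_const.sub hh)).mul (hy.sub h0))

theorem measurable_score {q r t : ℕ} {η : Nuisance q r t} (h1 : Measurable η.g1)
    (h0 : Measurable η.g0) (hh : Measurable η.h) :
    Measurable fun s : UnitData q r t => score s η := by
  have hL : MeasurableLearner (fun _ : (Empty → UnitData q r t) => η) :=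
    ⟨h1.comp measurable_snd, h0.comp measurable_snd, hh.comp measurable_snd⟩
  exact hL.measurable_score.comp (measurable_const.prodMk measurable_id :
    Measurable fun s : UnitData q r t => ((fun e : Empty => e.elim : Empty → UnitData q r t), s))

namespace SEM

variable {N q r t : ℕ} (M : SEM N q r t) (net : Network N q r t)

theorem measurable_thetaHat {K : ℕ} (fold : Fin N → Fin K)
    {learner : (k : Fin K) → (net.train fold k → UnitData q r t) → Nuisance q r t}
    (hL : ∀ k, MeasurableLearner (learner k)) : Measurable (M.thetaHat net fold learner) := by
  refine (Finset.measurable_fun_sum _ fun k _ => ?_).const_mul _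
  refine (Finset.measurable_fun_sum _ fun i _ => ?_).const_mul _
  exact (hL k).measurable_score.comp ((M.measurable_trainData net fold k).prodMk
    (M.measurable_S net i))

theorem measurable_scaledError {K : ℕ} (fold : Fin N → Fin K)
    {learner : (k : Fin K) → (net.train fold k → UnitData q r t) → Nuisance q r t}
    (hL : ∀ k, MeasurableLearner (learner k)) : Measurable (M.scaledError net fold learner) :=
  ((M.measurable_thetaHat net fold hL).sub measurable_const).const_mul _

end SEM

/-! ### Averaging over the treatment assignment and the noise of one unit -/

/-- The average of a function of a Bernoulli variable and an independent noise. -/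
theorem integral_bernoulli_prod {ν : Measure ℝ} [IsProbabilityMeasure ν] (F : Bool → ℝ → ℝ)
    (hF : ∀ b, Integrable (F b) ν) {h : ℝ} (hh : h ∈ Set.Icc (0 : ℝ) 1) :
    ∫ a : ℝ × ℝ, F (decide (a.1 ≤ h)) a.2 ∂(unifLaw.prod ν)
      = h * ∫ v, F true v ∂ν + (1 - h) * ∫ v, F false v ∂ν := by
  have hset : MeasurableSet {u : ℝ | u ≤ h} := measurableSet_Iic
  have hm : Measurable fun u : ℝ => ind (decide (u ≤ h)) := by
    refine measurable_ind.comp (measurable_to_bool ?_)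
    convert hset using 1
    ext u
    simp
  have hint : Integrable (fun u : ℝ => ind (decide (u ≤ h))) unifLaw :=
    Integrable.of_bound hm.aestronglyMeasurable 1 (Eventually.of_forall fun u => by
      unfold ind; split_ifs <;> simp)
  have hval : ∫ u, ind (decide (u ≤ h)) ∂unifLaw = h := by
    have : (fun u : ℝ => ind (decide (u ≤ h))) = Set.indicator {u | u ≤ h} fun _ => (1 : ℝ) := by
      funext u
      simp [ind, Set.indicator]
    rw [this, integral_indicator hset, setIntegral_const, smul_eq_mul, mul_one]
    have h2 : {u : ℝ | u ≤ h} ∩ Set.Icc 0 1 = Set.Icc 0 h := by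
      ext u
      simp only [Set.mem_inter_iff, Set.mem_ofPred_eq, Set.mem_Icc]
      exact ⟨fun ⟨h1, h2, _⟩ => ⟨h2, h1⟩, fun ⟨h1, h2⟩ => ⟨h2, h1, h2.trans hh.2⟩⟩
    rw [unifLaw, measureReal_restrict_apply hset, h2]
    simp [hh.1]
  have hval' : ∫ u, (1 - ind (decide (u ≤ h))) ∂unifLaw = 1 - h := by
    rw [integral_sub (integrable_const _) hint, hval]
    simp
  have hsplit : ∀ a : ℝ × ℝ, F (decide (a.1 ≤ h)) a.2
      = ind (decide (a.1 ≤ h)) * F true a.2 + (1 - ind (decide (a.1 ≤ h))) * F false a.2 := by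
    intro a
    by_cases ha : a.1 ≤ h <;> simp [ha, ind]
  have hint' : Integrable (fun u : ℝ => 1 - ind (decide (u ≤ h))) unifLaw :=
    (integrable_const _).sub hint
  simp_rw [hsplit]
  rw [integral_add (hint.mul_prod (hF true)) (hint'.mul_prod (hF false)),
    integral_prod_mul (fun u : ℝ => ind (decide (u ≤ h))) (F true),
    integral_prod_mul (fun u : ℝ => 1 - ind (decide (u ≤ h))) (F false), hval, hval']

namespace SEM

variable {N q r t : ℕ} (M : SEM N q r t) (net : Network N q r t)

/-- The exogenous variables with the treatment and noise variables of unit `i` replaced. -/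
def resample (i : Fin N) (ω : Exo N q) (a : ℝ × ℝ) : Exo N q :=
  Function.update ω i ((ω i).1, a)

theorem measurable_resample (i : Fin N) :
    Measurable fun p : Exo N q × (ℝ × ℝ) => resample i p.1 p.2 :=
  measurable_update'.comp (measurable_fst.prodMk
    ((measurable_fst.comp ((measurable_pi_apply i).comp measurable_fst)).prodMk measurable_snd))

/-- Drawing the treatment and noise variables of unit `i` afresh preserves the law. -/
theorem measurePreserving_resample (i : Fin N) :
    MeasurePreserving (fun p : Exo N q × (ℝ × ℝ) => resample i p.1 p.2)
      (M.P.prod (unifLaw.prod M.noiseLaw)) M.P := by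
  have := M.prob_conf
  have := M.prob_noise
  let ν : Measure (ℝ × ℝ) := unifLaw.prod M.noiseLaw
  let m : Measure (Conf q × ℝ × ℝ) := M.confLaw.prod ν
  have hup : MeasurePreserving (fun p : Exo N q × (Conf q × ℝ × ℝ) => Function.update p.1 i p.2)
      (M.P.prod m) M.P := measurePreserving_update (fun _ : Fin N => m) i
  have h1 : MeasurePreserving (Prod.map
      (fun p : Exo N q × (Conf q × ℝ × ℝ) => Function.update p.1 i p.2) (id : ℝ × ℝ → ℝ × ℝ))
      ((M.P.prod m).prod ν) (M.P.prod ν) := hup.prod (MeasurePreserving.id ν)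
  have h2 : MeasurePreserving (Prod.map (Prod.fst : Conf q × ℝ × ℝ → Conf q)
      (id : ℝ × ℝ → ℝ × ℝ)) (m.prod ν) m := measurePreserving_fst.prod (MeasurePreserving.id ν)
  have h3 := hup.comp (((MeasurePreserving.id M.P).prod h2).comp
    (measurePreserving_prodAssoc M.P m ν))
  refine ⟨measurable_resample i, ?_⟩
  rw [← h1.map_eq, Measure.map_map (measurable_resample i) h1.measurable]
  convert h3.map_eq using 2
  funext p
  simp [resample, MeasurableEquiv.prodAssoc]

theorem resample_fst (i : Fin N) (ω : Exo N q) (a : ℝ × ℝ) (j : Fin N) :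
    (resample i ω a j).1 = (ω j).1 := by
  by_cases h : j = i
  · subst h; simp [resample]
  · simp [resample, h]

theorem C_resample (i : Fin N) (ω : Exo N q) (a : ℝ × ℝ) : C (resample i ω a) = C ω :=
  funext fun j => resample_fst i ω a j

theorem Z_resample (i j : Fin N) (ω : Exo N q) (a : ℝ × ℝ) :
    Z net (resample i ω a) j = Z net ω j := by
  unfold Z
  rw [C_resample]

theorem W_resample_of_ne (i : Fin N) (ω : Exo N q) (a : ℝ × ℝ) {j : Fin N} (hj : j ≠ i) :
    M.W net (resample i ω a) j = M.W net ω j := by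
  unfold W
  rw [C_resample, Z_resample]
  simp [resample, hj]

theorem W_resample (i : Fin N) (ω : Exo N q) (a : ℝ × ℝ) :
    M.W net (resample i ω a) i = decide (a.1 ≤ M.nuis.h (U net ω i)) := by
  unfold W U
  rw [C_resample, Z_resample]
  simp [resample]

theorem X_resample (i : Fin N) (ω : Exo N q) (a : ℝ × ℝ) :
    M.X net (resample i ω a) i = M.X net ω i :=
  net.featX_congr_of_ne i (fun _ hj => M.W_resample_of_ne net i ω a hj)
    fun j _ => congrFun (C_resample i ω a) j

/-- The data of unit `i` when its treatment is `b` and its noise is `v`. -/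
noncomputable def dataAt (i : Fin N) (ω : Exo N q) (b : Bool) (v : ℝ) : UnitData q r t :=
  (b, C ω i, M.X net ω i, Z net ω i, M.outcomeAt i b (C ω i) (M.X net ω i) v)

theorem S_resample (i : Fin N) (ω : Exo N q) (a : ℝ × ℝ) :
    M.S net (resample i ω a) i
      = M.dataAt net i ω (decide (a.1 ≤ M.nuis.h (U net ω i))) a.2 := by
  unfold S dataAt
  rw [Y_eq, W_resample, X_resample, Z_resample, C_resample]
  simp [resample]

/-- The conditional mean of the score at `η` given `C_i`, `X_i` and `Z_i`. -/
noncomputable def condScore (η : Nuisance q r t) (i : Fin N) (ω : Exo N q) : ℝ :=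
  η.g1 (M.D net ω i) - η.g0 (M.D net ω i)
    + M.nuis.h (U net ω i) / η.h (U net ω i) * (M.nuis.g1 (M.D net ω i) - η.g1 (M.D net ω i))
    - (1 - M.nuis.h (U net ω i)) / (1 - η.h (U net ω i))
      * (M.nuis.g0 (M.D net ω i) - η.g0 (M.D net ω i))

/-- Given everything but the treatment and noise variables of unit `i`, the score has mean
`condScore`, since the outcome noise is centred. -/
theorem integral_score_resample (η : Nuisance q r t) (i : Fin N) (ω : Exo N q) :
    ∫ a, score (M.S net (resample i ω a) i) η ∂(unifLaw.prod M.noiseLaw)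
      = M.condScore net η i ω := by
  have := M.prob_noise
  simp_rw [S_resample]
  have herr : ∀ b, Integrable (M.err i b (C ω i) (M.X net ω i)) M.noiseLaw := fun b =>
    M.integrable_err i b _ _
  have h1 : ∀ v, score (M.dataAt net i ω true v) η
      = (η.g1 (M.D net ω i) - η.g0 (M.D net ω i)
        + 1 / η.h (U net ω i) * (M.nuis.g1 (M.D net ω i) - η.g1 (M.D net ω i)))
        + 1 / η.h (U net ω i) * M.err i true (C ω i) (M.X net ω i) v := fun v => by
    simp only [dataAt, score, outcomeAt, ind, D, U]
    simp
    ring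
  have h0 : ∀ v, score (M.dataAt net i ω false v) η
      = (η.g1 (M.D net ω i) - η.g0 (M.D net ω i)
        - 1 / (1 - η.h (U net ω i)) * (M.nuis.g0 (M.D net ω i) - η.g0 (M.D net ω i)))
        - 1 / (1 - η.h (U net ω i)) * M.err i false (C ω i) (M.X net ω i) v := fun v => by
    simp only [dataAt, score, outcomeAt, ind, D, U]
    simp
    ring
  rw [integral_bernoulli_prod (fun b v => score (M.dataAt net i ω b v) η) ?_ (M.h_mem _)]
  · simp_rw [h1, h0]
    rw [integral_add (integrable_const _) ((herr true).const_mul _),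
      integral_sub (integrable_const _) ((herr false).const_mul _),
      integral_const_mul, integral_const_mul, M.centred_err, M.centred_err]
    simp only [integral_const, probReal_univ, smul_eq_mul, condScore]
    ring
  · rintro (_ | _)
    · simp_rw [h0]
      exact (integrable_const _).sub ((herr false).const_mul _)
    · simp_rw [h1]
      exact (integrable_const _).add ((herr true).const_mul _)

theorem integral_eq_integral_resample (i : Fin N) {f : Exo N q → ℝ} (hf : Integrable f M.P) :
    Integrable (fun ω => ∫ a, f (resample i ω a) ∂(unifLaw.prod M.noiseLaw)) M.P ∧
    ∫ ω, f ω ∂M.P = ∫ ω, ∫ a, f (resample i ω a) ∂(unifLaw.prod M.noiseLaw) ∂M.P := by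
  have := M.prob_noise
  have hmp := M.measurePreserving_resample i
  have hint : Integrable (fun p : Exo N q × (ℝ × ℝ) => f (resample i p.1 p.2))
      (M.P.prod (unifLaw.prod M.noiseLaw)) := hmp.integrable_comp_of_integrable hf
  refine ⟨hint.integral_prod_left, ?_⟩
  have hf' : AEStronglyMeasurable f (Measure.map
      (fun p : Exo N q × (ℝ × ℝ) => resample i p.1 p.2)
      (M.P.prod (unifLaw.prod M.noiseLaw))) := by
    rw [hmp.map_eq]
    exact hf.aestronglyMeasurable
  rw [← integral_prod _ hint, ← integral_map hmp.measurable.aemeasurable hf', hmp.map_eq]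

theorem integrable_condScore {η : Nuisance q r t} {i : Fin N}
    (h : Integrable (fun ω => score (M.S net ω i) η) M.P) :
    Integrable (M.condScore net η i) M.P := by
  have := (M.integral_eq_integral_resample i h).1
  simp_rw [integral_score_resample] at this
  exact this

theorem integral_score {η : Nuisance q r t} {i : Fin N}
    (h : Integrable (fun ω => score (M.S net ω i) η) M.P) :
    ∫ ω, score (M.S net ω i) η ∂M.P = ∫ ω, M.condScore net η i ω ∂M.P := by
  rw [(M.integral_eq_integral_resample i h).2]
  simp_rw [integral_score_resample]

theorem condScore_nuis (i : Fin N) (ω : Exo N q) :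
    M.condScore net M.nuis i ω = M.nuis.g1 (M.D net ω i) - M.nuis.g0 (M.D net ω i) := by
  simp [condScore]

end SEM

theorem ae_abs_le_of_eLpNorm_top_le {Ω : Type*} [MeasurableSpace Ω] {μ : Measure Ω} {f : Ω → ℝ}
    {C : ℝ≥0} (h : eLpNorm f ∞ μ ≤ C) : ∀ᵐ ω ∂μ, |f ω| ≤ C := by
  rw [eLpNorm_exponent_top] at h
  filter_upwards [ae_le_eLpNormEssSup (f := f) (μ := μ)] with ω hω
  have := hω.trans h
  rw [← Real.norm_eq_abs, ← coe_nnnorm]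
  exact_mod_cast (ENNReal.coe_le_coe.1 (by simpa [enorm] using this))

theorem unifLaw_ne_zero_of_Ioo_subset {s : Set ℝ} {a b : ℝ} (hab : a < b) (ha : 0 ≤ a) (hb : b ≤ 1)
    (hs : Set.Ioo a b ⊆ s) : unifLaw s ≠ 0 := by
  intro h
  have h2 := measure_mono_null hs h
  have hsub : Set.Ioo a b ⊆ Set.Icc 0 1 := fun u hu => ⟨ha.trans hu.1.le, hu.2.le.trans hb⟩
  rw [unifLaw, Measure.restrict_apply measurableSet_Ioo, Set.inter_eq_self_of_subset_left hsub,
    Real.volume_Ioo, ENNReal.ofReal_eq_zero] at h2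
  linarith

theorem integrable_of_ae_abs_le {Ω : Type*} [MeasurableSpace Ω] {μ : Measure Ω} [IsFiniteMeasure μ]
    {f : Ω → ℝ} (hf : Measurable f) {B : ℝ} (hB : ∀ᵐ ω ∂μ, |f ω| ≤ B) : Integrable f μ :=
  Integrable.of_bound hf.aestronglyMeasurable B hB

namespace Regular

variable {N q r t : ℕ} {M : SEM N q r t} {net : Network N q r t} {p C₁ C₂ : ℝ≥0} {C₃ C₄ : ℝ}

theorem ae_Y (h : Regular M net p C₁ C₂ C₃ C₄) (i : Fin N) : ∀ᵐ ω ∂M.P, |M.Y net ω i| ≤ C₂ :=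
  ae_abs_le_of_eLpNorm_top_le
    (((le_self_add.trans le_self_add).trans le_self_add).trans (h.bounded i))

theorem ae_g1 (h : Regular M net p C₁ C₂ C₃ C₄) (i : Fin N) :
    ∀ᵐ ω ∂M.P, |M.nuis.g1 (M.D net ω i)| ≤ C₂ :=
  ae_abs_le_of_eLpNorm_top_le
    (((le_add_self.trans le_self_add).trans le_self_add).trans (h.bounded i))

theorem ae_g0 (h : Regular M net p C₁ C₂ C₃ C₄) (i : Fin N) :
    ∀ᵐ ω ∂M.P, |M.nuis.g0 (M.D net ω i)| ≤ C₂ :=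
  ae_abs_le_of_eLpNorm_top_le ((le_add_self.trans le_self_add).trans (h.bounded i))

/-- Under overlap both values of the outcome noise are bounded, not only the one that enters the
observed outcome: given the confounders, the feature and the noise, each treatment has positive
probability. -/
theorem ae_err (h : Regular M net p C₁ C₂ C₃ C₄) (hC₃ : 0 < C₃) (i : Fin N) (b : Bool) :
    ∀ᵐ ω ∂M.P, |M.err i b (SEM.C ω i) (M.X net ω i) (ω i).2.2| ≤ 2 * C₂ := by
  have := M.prob_noise
  have hmp := M.measurePreserving_resample i
  have hobs : ∀ᵐ ω ∂M.P, M.W net ω i = b →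
      |M.err i b (SEM.C ω i) (M.X net ω i) (ω i).2.2| ≤ 2 * C₂ := by
    filter_upwards [h.ae_Y i, h.ae_g1 i, h.ae_g0 i] with ω hY h1 h0 hW
    rw [SEM.Y_eq, hW] at hY
    unfold SEM.outcomeAt at hY
    change |M.nuis.g1 (SEM.C ω i, M.X net ω i)| ≤ C₂ at h1
    change |M.nuis.g0 (SEM.C ω i, M.X net ω i)| ≤ C₂ at h0
    rw [abs_le] at *
    cases b <;> simp only [ind, if_true, if_false, Bool.false_eq_true] at hY <;>
      constructor <;> linarith [hY.1, hY.2, h1.1, h1.2, h0.1, h0.2]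
  have hres := hmp.quasiMeasurePreserving.ae hobs
  have hmeas : MeasurableSet {ω : Exo N q |
      |M.err i b (SEM.C ω i) (M.X net ω i) (ω i).2.2| ≤ 2 * C₂} := by
    refine measurableSet_le ?_ measurable_const
    exact measurable_abs.comp ((M.measurable_err i).comp (measurable_const.prodMk
      ((SEM.measurable_C i).prodMk ((M.measurable_X net i).prodMk (SEM.measurable_noise i)))))
  have hgoal : ∀ᵐ p ∂(M.P.prod (unifLaw.prod M.noiseLaw)),
      |M.err i b (SEM.C (SEM.resample i p.1 p.2) i) (M.X net (SEM.resample i p.1 p.2) i)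
        (SEM.resample i p.1 p.2 i).2.2| ≤ 2 * C₂ := by
    refine (Measure.ae_prod_iff_ae_ae (hmp.measurable hmeas)).2 ?_
    filter_upwards [Measure.ae_ae_of_ae_prod hres, h.overlap i] with ω hω hov
    have hsimp : ∀ a : ℝ × ℝ, (SEM.resample i ω a i).2.2 = a.2 := fun a => by
      simp [SEM.resample]
    simp only [SEM.C_resample, SEM.X_resample, SEM.W_resample, hsimp] at hω ⊢
    -- for almost every noise the bound holds under a set of treatment variables of positive mass
    have hswap : ∀ᵐ v ∂M.noiseLaw, ∀ᵐ u ∂unifLaw, decide (u ≤ M.nuis.h (SEM.U net ω i)) = b →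
        |M.err i b (SEM.C ω i) (M.X net ω i) v| ≤ 2 * C₂ :=
      Measure.ae_ae_of_ae_prod (Measure.measurePreserving_swap.quasiMeasurePreserving.ae hω)
    have hv : ∀ᵐ v ∂M.noiseLaw, |M.err i b (SEM.C ω i) (M.X net ω i) v| ≤ 2 * C₂ := by
      filter_upwards [hswap] with v hv
      by_contra hneg
      have hmem := M.h_mem (SEM.U net ω i)
      have hnull : ∀ᵐ u ∂unifLaw, ¬ decide (u ≤ M.nuis.h (SEM.U net ω i)) = b := by
        filter_upwards [hv] with u hu hb
        exact hneg (hu hb)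
      rw [ae_iff] at hnull
      revert hnull
      cases b
      · refine unifLaw_ne_zero_of_Ioo_subset (a := M.nuis.h (SEM.U net ω i)) (b := 1)
          (by linarith [hov.2]) hmem.1 le_rfl fun u hu => ?_
        simpa using hu.1
      · refine unifLaw_ne_zero_of_Ioo_subset (a := 0) (b := M.nuis.h (SEM.U net ω i))
          (by linarith [hov.1]) le_rfl hmem.2 fun u hu => ?_
        simpa using hu.2.le
    exact Measure.quasiMeasurePreserving_snd.ae hv
  rw [← hmp.map_eq, ae_map_iff hmp.measurable.aemeasurable hmeas]
  exact hgoal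

/-- The unit-level direct effect is the mean contrast of the outcome regressions. -/
theorem unitEffect_eq (h : Regular M net p C₁ C₂ C₃ C₄) (hC₃ : 0 < C₃) (i : Fin N) :
    M.unitEffect net i
      = ∫ ω, (M.nuis.g1 (M.D net ω i) - M.nuis.g0 (M.D net ω i)) ∂M.P := by
  have := M.prob_noise
  have hX : ∀ b ω, net.featX (Function.update (M.W net ω) i b) (SEM.C ω) i = M.X net ω i :=
    fun b ω => net.featX_congr_of_ne i (fun j hj => by rw [Function.update_of_ne hj])
      fun _ _ => rfl
  have hYdo : ∀ ω, M.Ydo net true ω i - M.Ydo net false ω i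
      = (M.nuis.g1 (M.D net ω i) - M.nuis.g0 (M.D net ω i))
        + (M.err i true (SEM.C ω i) (M.X net ω i) (ω i).2.2
          - M.err i false (SEM.C ω i) (M.X net ω i) (ω i).2.2) := fun ω => by
    simp only [SEM.Ydo, SEM.outcome, hX, Function.update_self, ind, SEM.D]
    simp
    ring
  have hgint : Integrable (fun ω => M.nuis.g1 (M.D net ω i) - M.nuis.g0 (M.D net ω i)) M.P :=
    (integrable_of_ae_abs_le (M.measurable_g1.comp (M.measurable_D net i)) (h.ae_g1 i)).sub
      (integrable_of_ae_abs_le (M.measurable_g0.comp (M.measurable_D net i)) (h.ae_g0 i))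
  have herrint : ∀ b, Integrable
      (fun ω => M.err i b (SEM.C ω i) (M.X net ω i) (ω i).2.2) M.P := fun b => by
    refine integrable_of_ae_abs_le ?_ (h.ae_err hC₃ i b)
    exact (M.measurable_err i).comp (measurable_const.prodMk
      ((SEM.measurable_C i).prodMk ((M.measurable_X net i).prodMk (SEM.measurable_noise i))))
  have herr0 : ∀ b, ∫ ω, M.err i b (SEM.C ω i) (M.X net ω i) (ω i).2.2 ∂M.P = 0 := fun b => by
    rw [(M.integral_eq_integral_resample i (herrint b)).2]
    have hsimp : ∀ (ω : Exo N q) (a : ℝ × ℝ), (SEM.resample i ω a i).2.2 = a.2 := fun ω a => by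
      simp [SEM.resample]
    have hin : ∀ ω, ∫ a, M.err i b (SEM.C (SEM.resample i ω a) i)
        (M.X net (SEM.resample i ω a) i) (SEM.resample i ω a i).2.2
        ∂(unifLaw.prod M.noiseLaw) = 0 := fun ω => by
      simp only [SEM.C_resample, SEM.X_resample, hsimp]
      have := integral_prod_mul (μ := unifLaw) (ν := M.noiseLaw) (fun _ => (1 : ℝ))
        (M.err i b (SEM.C ω i) (M.X net ω i))
      simpa [M.centred_err] using this
    simp [hin]
  unfold SEM.unitEffect
  simp_rw [hYdo]
  have hdiff : Integrable (fun ω => M.err i true (SEM.C ω i) (M.X net ω i) (ω i).2.2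
      - M.err i false (SEM.C ω i) (M.X net ω i) (ω i).2.2) M.P :=
    (herrint true).sub (herrint false)
  rw [integral_add hgint hdiff, integral_sub (herrint true) (herrint false), herr0, herr0]
  simp

end Regular

/-! ### Dependence of the score on the nuisance functions -/

/-- Lipschitz continuity of an inverse probability weighted residual in the weight and the
regression value. -/
theorem abs_residual_div_sub_le {y a a₀ k k₀ c B : ℝ} (hc : 0 < c) (hk : c ≤ k) (hk₀ : c ≤ k₀)
    (hB : |y - a₀| ≤ B) :
    |1 / k * (y - a) - 1 / k₀ * (y - a₀)| ≤ 1 / c * |a₀ - a| + B / c ^ 2 * |k₀ - k| := by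
  have hkp : 0 < k := hc.trans_le hk
  have hkp₀ : 0 < k₀ := hc.trans_le hk₀
  have e : 1 / k * (y - a) - 1 / k₀ * (y - a₀)
      = 1 / k * (a₀ - a) + (y - a₀) * (1 / (k * k₀)) * (k₀ - k) := by
    field_simp
    ring
  have h1 : 1 / k ≤ 1 / c := one_div_le_one_div_of_le hc hk
  have h2 : 1 / (k * k₀) ≤ 1 / c ^ 2 := by
    refine one_div_le_one_div_of_le (by positivity) ?_
    rw [sq]
    exact mul_le_mul hk hk₀ hc.le hkp.le
  rw [e]
  refine (abs_add_le _ _).trans ?_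
  rw [abs_mul, abs_mul, abs_mul, abs_of_pos (by positivity : 0 < 1 / k),
    abs_of_pos (by positivity : 0 < 1 / (k * k₀))]
  have h3 : |y - a₀| * (1 / (k * k₀)) ≤ B / c ^ 2 := by
    rw [div_eq_mul_one_div B]
    exact mul_le_mul hB h2 (by positivity) ((abs_nonneg _).trans hB)
  gcongr

theorem integral_sq_le_of_eLpNorm_le {Ω : Type*} [MeasurableSpace Ω] {μ : Measure Ω} {f : Ω → ℝ}
    (hf : MemLp f 2 μ) {a : ℝ} (ha : 0 ≤ a) (h : eLpNorm f 2 μ ≤ ENNReal.ofReal a) :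
    ∫ ω, f ω ^ 2 ∂μ ≤ a ^ 2 := by
  have h1 := hf.eLpNorm_eq_integral_rpow_norm (by norm_num) (by norm_num)
  rw [h1] at h
  have h2 := (ENNReal.ofReal_le_ofReal_iff ha).1 h
  have h0 : 0 ≤ ∫ ω, f ω ^ 2 ∂μ := integral_nonneg fun ω => sq_nonneg _
  have h3 : √(∫ ω, f ω ^ 2 ∂μ) ≤ a := by
    rw [Real.sqrt_eq_rpow]
    simpa using h2
  exact (Real.sqrt_le_left ha).1 h3

theorem eLpNorm_two_le_of_ae_abs_le {Ω : Type*} [MeasurableSpace Ω] {μ : Measure Ω}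
    {F f g k : Ω → ℝ} {L : ℝ} (hL : 0 ≤ L) (hf : MemLp f 2 μ) (hg : MemLp g 2 μ)
    (hk : MemLp k 2 μ) (h : ∀ᵐ ω ∂μ, |F ω| ≤ L * (|f ω| + |g ω| + |k ω|)) :
    eLpNorm F 2 μ ≤ ENNReal.ofReal L * (eLpNorm f 2 μ + eLpNorm g 2 μ + eLpNorm k 2 μ) := by
  have hf' : AEStronglyMeasurable (fun ω => |f ω|) μ := hf.abs.1
  have hg' : AEStronglyMeasurable (fun ω => |g ω|) μ := hg.abs.1
  have hk' : AEStronglyMeasurable (fun ω => |k ω|) μ := hk.abs.1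
  have ef : eLpNorm (fun ω => |f ω|) 2 μ = eLpNorm f 2 μ := eLpNorm_norm f
  have eg : eLpNorm (fun ω => |g ω|) 2 μ = eLpNorm g 2 μ := eLpNorm_norm g
  have ek : eLpNorm (fun ω => |k ω|) 2 μ = eLpNorm k 2 μ := eLpNorm_norm k
  have e1 : eLpNorm F 2 μ ≤ ENNReal.ofReal L
      * eLpNorm (((fun ω => |f ω|) + fun ω => |g ω|) + fun ω => |k ω|) 2 μ := by
    have := eLpNorm_const_smul (μ := μ) (p := 2) L
      (((fun ω => |f ω|) + fun ω => |g ω|) + fun ω => |k ω|)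
    rw [Real.enorm_eq_ofReal hL] at this
    rw [← this]
    refine eLpNorm_mono_ae ?_
    filter_upwards [h] with ω hω
    exact hω.trans (le_abs_self _)
  have e2 := eLpNorm_add_le (hf'.add hg') hk' (p := 2) one_le_two
  have e3 := eLpNorm_add_le hf' hg' (p := 2) one_le_two
  rw [ef, eg] at e3
  rw [ek] at e2
  refine e1.trans ?_
  gcongr
  exact e2.trans (by gcongr)

/-- The Cauchy-Schwarz inequality. -/
theorem integral_abs_mul_le_eLpNorm {Ω : Type*} [MeasurableSpace Ω] {μ : Measure Ω} {f g : Ω → ℝ}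
    (hf : MemLp f 2 μ) (hg : MemLp g 2 μ) :
    ENNReal.ofReal (∫ ω, |f ω| * |g ω| ∂μ) ≤ eLpNorm f 2 μ * eLpNorm g 2 μ := by
  have h1 : eLpNorm (fun ω => f ω * g ω) 1 μ ≤ eLpNorm f 2 μ * eLpNorm g 2 μ := by
    have := eLpNorm_le_eLpNorm_mul_eLpNorm_of_nnnorm (p := 2) (q := 2) (r := 1) (μ := μ)
      hf.1 hg.1 (fun a b : ℝ => a * b) 1 (Eventually.of_forall fun ω => by simp [nnnorm_mul])
    simpa using this
  have hi : Integrable (fun ω => f ω * g ω) μ := hf.integrable_mul hg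
  refine le_trans (le_of_eq ?_) h1
  rw [eLpNorm_one_eq_lintegral_enorm, ← ofReal_integral_norm_eq_lintegral_enorm hi]
  simp

namespace Regular

variable {N q r t : ℕ} {M : SEM N q r t} {net : Network N q r t} {p C₁ C₂ : ℝ≥0} {C₃ C₄ ρ τ : ℝ}
  {T : Set (Nuisance q r t)} {η : Nuisance q r t}

theorem ae_abs_score_le (h : Regular M net p C₁ C₂ C₃ C₄) (hC₃ : 0 < C₃) (i : Fin N) :
    ∀ᵐ ω ∂M.P, |score (M.S net ω i) M.nuis| ≤ 2 * C₂ + 2 * C₂ / C₃ := by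
  filter_upwards [h.ae_Y i, h.ae_g1 i, h.ae_g0 i, h.overlap i] with ω hY h1 h0 hov
  simp only [SEM.S, score]
  simp only [SEM.D, SEM.U] at h1 h0 hov
  have hinv : ∀ k : ℝ, C₃ ≤ k → ∀ g : ℝ, |g| ≤ C₂ →
      |1 / k * (M.Y net ω i - g)| ≤ 2 * C₂ / C₃ := fun k hk g hg => by
    have hkp : 0 < k := hC₃.trans_le hk
    rw [abs_mul, abs_of_pos (by positivity : 0 < 1 / k), one_div_mul_eq_div]
    refine div_le_div₀ (by positivity) ?_ hC₃ hk
    exact (abs_sub _ _).trans (by linarith)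
  have hb1 := hinv _ hov.1 _ h1
  have hb0 := hinv (1 - M.nuis.h (SEM.C ω i, SEM.Z net ω i)) (by linarith [hov.2]) _ h0
  have hdiff : |M.nuis.g1 (SEM.C ω i, M.X net ω i) - M.nuis.g0 (SEM.C ω i, M.X net ω i)|
      ≤ 2 * C₂ := (abs_sub _ _).trans (by linarith)
  cases M.W net ω i
  · simp only [ind, Bool.false_eq_true, if_false, zero_div, zero_mul, add_zero, sub_zero]
    exact (abs_sub _ _).trans (add_le_add hdiff hb0)
  · simp only [ind, if_true, sub_self, zero_div, zero_mul, sub_zero]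
    exact (abs_add_le _ _).trans (add_le_add hdiff hb1)

/-- The score is Lipschitz continuous in the nuisance functions. -/
theorem ae_abs_score_sub_le (h : Regular M net p C₁ C₂ C₃ C₄) (hC₃ : 0 < C₃)
    (hT : RealizationSet M net T p C₃ ρ τ) (hη : η ∈ T) (i : Fin N) :
    ∀ᵐ ω ∂M.P, |score (M.S net ω i) η - score (M.S net ω i) M.nuis|
      ≤ (1 + 1 / C₃ + 2 * C₂ / C₃ ^ 2)
        * (|M.nuis.h (SEM.U net ω i) - η.h (SEM.U net ω i)|
          + |M.nuis.g1 (M.D net ω i) - η.g1 (M.D net ω i)|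
          + |M.nuis.g0 (M.D net ω i) - η.g0 (M.D net ω i)|) := by
  filter_upwards [h.ae_Y i, h.ae_g1 i, h.ae_g0 i, h.overlap i, hT.overlap η hη i] with
    ω hY h1 h0 hov hov'
  simp only [SEM.S, score]
  simp only [SEM.D, SEM.U] at h1 h0 hov hov' ⊢
  set a1 := M.nuis.g1 (SEM.C ω i, M.X net ω i)
  set a0 := M.nuis.g0 (SEM.C ω i, M.X net ω i)
  set b1 := η.g1 (SEM.C ω i, M.X net ω i)
  set b0 := η.g0 (SEM.C ω i, M.X net ω i)
  set k := M.nuis.h (SEM.C ω i, SEM.Z net ω i)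
  set l := η.h (SEM.C ω i, SEM.Z net ω i)
  have hy1 : |M.Y net ω i - a1| ≤ 2 * C₂ := (abs_sub _ _).trans (by linarith)
  have hy0 : |M.Y net ω i - a0| ≤ 2 * C₂ := (abs_sub _ _).trans (by linarith)
  have r1 := abs_residual_div_sub_le (a := b1) hC₃ hov'.1 hov.1 hy1
  have r0 := abs_residual_div_sub_le (a := b0) (k := 1 - l) (k₀ := 1 - k) hC₃
    (by linarith [hov'.2]) (by linarith [hov.2]) hy0
  have hkl : |1 - k - (1 - l)| = |k - l| := by rw [← abs_neg]; ring_nf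
  rw [hkl] at r0
  have hA : 0 ≤ 1 / C₃ := by positivity
  have hB : 0 ≤ 2 * (C₂ : ℝ) / C₃ ^ 2 := by positivity
  have hp1 := abs_nonneg (a1 - b1)
  have hp0 := abs_nonneg (a0 - b0)
  have hph := abs_nonneg (k - l)
  have hd : |(b1 - b0) - (a1 - a0)| ≤ |a1 - b1| + |a0 - b0| := by
    have : (b1 - b0) - (a1 - a0) = (a0 - b0) - (a1 - b1) := by ring
    rw [this]
    exact (abs_sub _ _).trans_eq (add_comm _ _)
  have hfin1 : |a1 - b1| + |a0 - b0| + (1 / C₃ * |a1 - b1| + 2 * C₂ / C₃ ^ 2 * |k - l|)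
      ≤ (1 + 1 / C₃ + 2 * C₂ / C₃ ^ 2) * (|k - l| + |a1 - b1| + |a0 - b0|) := by
    nlinarith [mul_nonneg hA hp1, mul_nonneg hA hp0, mul_nonneg hA hph, mul_nonneg hB hp1,
      mul_nonneg hB hp0, mul_nonneg hB hph]
  have hfin0 : |a1 - b1| + |a0 - b0| + (1 / C₃ * |a0 - b0| + 2 * C₂ / C₃ ^ 2 * |k - l|)
      ≤ (1 + 1 / C₃ + 2 * C₂ / C₃ ^ 2) * (|k - l| + |a1 - b1| + |a0 - b0|) := by
    nlinarith [mul_nonneg hA hp1, mul_nonneg hA hp0, mul_nonneg hA hph, mul_nonneg hB hp1,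
      mul_nonneg hB hp0, mul_nonneg hB hph]
  cases M.W net ω i
  · simp only [ind, Bool.false_eq_true, if_false, zero_div, zero_mul, add_zero, sub_zero]
    refine le_trans ?_ hfin0
    have e : b1 - b0 - 1 / (1 - l) * (M.Y net ω i - b0)
          - (a1 - a0 - 1 / (1 - k) * (M.Y net ω i - a0))
        = ((b1 - b0) - (a1 - a0))
          - (1 / (1 - l) * (M.Y net ω i - b0) - 1 / (1 - k) * (M.Y net ω i - a0)) := by ring
    rw [e]
    exact (abs_sub _ _).trans (add_le_add hd r0)
  · simp only [ind, if_true, sub_self, zero_div, zero_mul, sub_zero]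
    refine le_trans ?_ hfin1
    have e : b1 - b0 + 1 / l * (M.Y net ω i - b1) - (a1 - a0 + 1 / k * (M.Y net ω i - a1))
        = ((b1 - b0) - (a1 - a0))
          + (1 / l * (M.Y net ω i - b1) - 1 / k * (M.Y net ω i - a1)) := by ring
    rw [e]
    exact (abs_add_le _ _).trans (add_le_add hd r1)

theorem measurable_score_S {M : SEM N q r t} (h1 : Measurable η.g1) (h0 : Measurable η.g0)
    (hh : Measurable η.h) (i : Fin N) : Measurable fun ω => score (M.S net ω i) η :=
  (measurable_score h1 h0 hh).comp (M.measurable_S net i)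

theorem measurable_score_nuis (M : SEM N q r t) (net : Network N q r t) (i : Fin N) :
    Measurable fun ω => score (M.S net ω i) M.nuis :=
  measurable_score_S M.measurable_g1 M.measurable_g0 M.measurable_h i

theorem memLp_err (hT : RealizationSet M net T p C₃ ρ τ) (hη : η ∈ T) (i : Fin N) :
    MemLp (fun ω => M.nuis.h (SEM.U net ω i) - η.h (SEM.U net ω i)) 2 M.P ∧
    MemLp (fun ω => M.nuis.g1 (M.D net ω i) - η.g1 (M.D net ω i)) 2 M.P ∧
    MemLp (fun ω => M.nuis.g0 (M.D net ω i) - η.g0 (M.D net ω i)) 2 M.P := by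
  have herr := (hT.errors η hη i).trans_lt ENNReal.ofReal_lt_top
  obtain ⟨m1, m0, mh⟩ := hT.measurable η hη
  have hD := M.measurable_D net i
  have hU := SEM.measurable_U net i
  refine ⟨⟨?_, ?_⟩, ⟨?_, ?_⟩, ⟨?_, ?_⟩⟩
  · exact ((M.measurable_h.comp hU).sub (mh.comp hU)).aestronglyMeasurable
  · exact (le_self_add.trans le_self_add).trans_lt herr
  · exact ((M.measurable_g1.comp hD).sub (m1.comp hD)).aestronglyMeasurable
  · exact (le_add_self.trans le_self_add).trans_lt herr
  · exact ((M.measurable_g0.comp hD).sub (m0.comp hD)).aestronglyMeasurable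
  · exact le_add_self.trans_lt herr

/-- The mean square change of the score is of the order of the squared nuisance error. -/
theorem memLp_score_sub (h : Regular M net p C₁ C₂ C₃ C₄) (hC₃ : 0 < C₃)
    (hT : RealizationSet M net T p C₃ ρ τ) (hη : η ∈ T) (i : Fin N) :
    MemLp (fun ω => score (M.S net ω i) η - score (M.S net ω i) M.nuis) 2 M.P ∧
    ∫ ω, (score (M.S net ω i) η - score (M.S net ω i) M.nuis) ^ 2 ∂M.P
      ≤ ((1 + 1 / C₃ + 2 * C₂ / C₃ ^ 2) * τ) ^ 2 := by
  obtain ⟨lh, l1, l0⟩ := memLp_err hT hη i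
  obtain ⟨m1, m0, mh⟩ := hT.measurable η hη
  set L : ℝ := 1 + 1 / C₃ + 2 * C₂ / C₃ ^ 2 with hL
  have hL0 : 0 ≤ L := by positivity
  have hnorm : eLpNorm (fun ω => score (M.S net ω i) η - score (M.S net ω i) M.nuis) 2 M.P
      ≤ ENNReal.ofReal (L * max τ 0) := by
    calc eLpNorm (fun ω => score (M.S net ω i) η - score (M.S net ω i) M.nuis) 2 M.P
        ≤ ENNReal.ofReal L * (M.errH net η i + M.errG1 net η i + M.errG0 net η i) :=
          eLpNorm_two_le_of_ae_abs_le hL0 lh l1 l0 (h.ae_abs_score_sub_le hC₃ hT hη i)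
      _ ≤ ENNReal.ofReal L * ENNReal.ofReal τ := mul_le_mul_right (hT.errors η hη i) _
      _ = ENNReal.ofReal (L * max τ 0) := by
          rw [ENNReal.ofReal_mul hL0]
          congr 1
          rcases le_total τ 0 with hτ | hτ
          · rw [max_eq_right hτ, ENNReal.ofReal_of_nonpos hτ, ENNReal.ofReal_zero]
          · rw [max_eq_left hτ]
  have hmem : MemLp (fun ω => score (M.S net ω i) η - score (M.S net ω i) M.nuis) 2 M.P :=
    ⟨((measurable_score_S m1 m0 mh i).sub (measurable_score_nuis M net i)).aestronglyMeasurable,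
      hnorm.trans_lt ENNReal.ofReal_lt_top⟩
  refine ⟨hmem, (integral_sq_le_of_eLpNorm_le hmem (by positivity) hnorm).trans ?_⟩
  rw [mul_pow, mul_pow]
  refine mul_le_mul_of_nonneg_left ?_ (sq_nonneg L)
  rcases le_total τ 0 with hτ | hτ
  · rw [max_eq_right hτ]; nlinarith [sq_nonneg τ]
  · rw [max_eq_left hτ]

theorem integrable_score_nuis (h : Regular M net p C₁ C₂ C₃ C₄) (hC₃ : 0 < C₃) (i : Fin N) :
    Integrable (fun ω => score (M.S net ω i) M.nuis) M.P :=
  integrable_of_ae_abs_le (measurable_score_nuis M net i) (h.ae_abs_score_le hC₃ i)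

/-- The score at the true nuisance functions is unbiased for the unit-level effect. -/
theorem integral_score_nuis (h : Regular M net p C₁ C₂ C₃ C₄) (hC₃ : 0 < C₃) (i : Fin N) :
    ∫ ω, score (M.S net ω i) M.nuis ∂M.P = M.unitEffect net i := by
  rw [M.integral_score net (h.integrable_score_nuis hC₃ i), h.unitEffect_eq hC₃ i]
  simp_rw [SEM.condScore_nuis]

/-- **Neyman orthogonality**: the bias of the score at `η` is bounded by the product of the errors
of `h` and of the outcome regressions. -/
theorem abs_integral_score_sub_le (h : Regular M net p C₁ C₂ C₃ C₄) (hC₃ : 0 < C₃)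
    (hT : RealizationSet M net T p C₃ ρ τ) (hη : η ∈ T) (i : Fin N) :
    |∫ ω, (score (M.S net ω i) η - score (M.S net ω i) M.nuis) ∂M.P| ≤ 1 / C₃ * max ρ 0 := by
  obtain ⟨lh, l1, l0⟩ := memLp_err hT hη i
  have i0 := h.integrable_score_nuis hC₃ i
  have isub := (h.memLp_score_sub hC₃ hT hη i).1.integrable one_le_two
  have i1 : Integrable (fun ω => score (M.S net ω i) η) M.P := by
    refine (isub.add i0).congr (Eventually.of_forall fun ω => ?_)
    simp
  have hmean : ∫ ω, (score (M.S net ω i) η - score (M.S net ω i) M.nuis) ∂M.P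
      = ∫ ω, (M.condScore net η i ω - M.condScore net M.nuis i ω) ∂M.P := by
    rw [integral_sub i1 i0, integral_sub (M.integrable_condScore net i1)
      (M.integrable_condScore net i0), M.integral_score net i1, M.integral_score net i0]
  rw [hmean]
  have p1 : Integrable (fun ω => |M.nuis.h (SEM.U net ω i) - η.h (SEM.U net ω i)|
      * |M.nuis.g1 (M.D net ω i) - η.g1 (M.D net ω i)|) M.P := lh.abs.integrable_mul l1.abs
  have p0 : Integrable (fun ω => |M.nuis.h (SEM.U net ω i) - η.h (SEM.U net ω i)|
      * |M.nuis.g0 (M.D net ω i) - η.g0 (M.D net ω i)|) M.P := lh.abs.integrable_mul l0.abs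
  have hpt : ∀ᵐ ω ∂M.P, ‖M.condScore net η i ω - M.condScore net M.nuis i ω‖
      ≤ 1 / C₃ * (|M.nuis.h (SEM.U net ω i) - η.h (SEM.U net ω i)|
        * |M.nuis.g1 (M.D net ω i) - η.g1 (M.D net ω i)|
        + |M.nuis.h (SEM.U net ω i) - η.h (SEM.U net ω i)|
        * |M.nuis.g0 (M.D net ω i) - η.g0 (M.D net ω i)|) := by
    filter_upwards [hT.overlap η hη i] with ω hov
    rw [SEM.condScore_nuis, SEM.condScore]
    set a1 := M.nuis.g1 (M.D net ω i)
    set a0 := M.nuis.g0 (M.D net ω i)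
    set b1 := η.g1 (M.D net ω i)
    set b0 := η.g0 (M.D net ω i)
    set k := M.nuis.h (SEM.U net ω i)
    set l := η.h (SEM.U net ω i)
    have hl : 0 < l := hC₃.trans_le hov.1
    have hl' : 0 < 1 - l := by linarith [hov.2]
    have e : b1 - b0 + k / l * (a1 - b1) - (1 - k) / (1 - l) * (a0 - b0) - (a1 - a0)
        = 1 / l * ((k - l) * (a1 - b1)) + 1 / (1 - l) * ((k - l) * (a0 - b0)) := by
      field_simp
      ring
    rw [e, mul_add]
    refine (norm_add_le _ _).trans ?_
    rw [norm_mul, norm_mul, norm_mul, norm_mul]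
    simp only [Real.norm_eq_abs]
    rw [abs_of_pos (by positivity : 0 < 1 / l), abs_of_pos (by positivity : 0 < 1 / (1 - l))]
    have hle1 : 1 / l ≤ 1 / C₃ := one_div_le_one_div_of_le hC₃ hov.1
    have hle2 : 1 / (1 - l) ≤ 1 / C₃ := one_div_le_one_div_of_le hC₃ (by linarith [hov.2])
    gcongr
  have hfin := norm_integral_le_of_norm_le ((p1.add p0).const_mul (1 / C₃)) hpt
  rw [Real.norm_eq_abs] at hfin
  refine hfin.trans ?_
  have hsplit : ∫ ω, 1 / C₃ * ((fun ω => |M.nuis.h (SEM.U net ω i) - η.h (SEM.U net ω i)|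
        * |M.nuis.g1 (M.D net ω i) - η.g1 (M.D net ω i)|) + fun ω =>
        |M.nuis.h (SEM.U net ω i) - η.h (SEM.U net ω i)|
        * |M.nuis.g0 (M.D net ω i) - η.g0 (M.D net ω i)|) ω ∂M.P
      = 1 / C₃ * (∫ ω, |M.nuis.h (SEM.U net ω i) - η.h (SEM.U net ω i)|
        * |M.nuis.g1 (M.D net ω i) - η.g1 (M.D net ω i)| ∂M.P
        + ∫ ω, |M.nuis.h (SEM.U net ω i) - η.h (SEM.U net ω i)|
        * |M.nuis.g0 (M.D net ω i) - η.g0 (M.D net ω i)| ∂M.P) := by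
    rw [integral_const_mul, integral_add' p1 p0]
  rw [hsplit]
  refine mul_le_mul_of_nonneg_left ?_ (by positivity)
  have n1 : 0 ≤ ∫ ω, |M.nuis.h (SEM.U net ω i) - η.h (SEM.U net ω i)|
      * |M.nuis.g1 (M.D net ω i) - η.g1 (M.D net ω i)| ∂M.P :=
    integral_nonneg fun ω => by positivity
  have n0 : 0 ≤ ∫ ω, |M.nuis.h (SEM.U net ω i) - η.h (SEM.U net ω i)|
      * |M.nuis.g0 (M.D net ω i) - η.g0 (M.D net ω i)| ∂M.P :=
    integral_nonneg fun ω => by positivity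
  refine (ENNReal.ofReal_le_ofReal_iff (le_max_right _ _)).1 ?_
  calc ENNReal.ofReal _
      ≤ M.errH net η i * M.errG1 net η i + M.errH net η i * M.errG0 net η i := by
        rw [ENNReal.ofReal_add n1 n0]
        exact add_le_add (integral_abs_mul_le_eLpNorm lh l1) (integral_abs_mul_le_eLpNorm lh l0)
    _ ≤ M.errH net η i * (M.errG1 net η i + M.errG0 net η i + M.errH net η i) := by
        rw [← mul_add]
        exact mul_le_mul_right le_self_add _
    _ ≤ ENNReal.ofReal ρ := hT.product η hη i
    _ ≤ ENNReal.ofReal (max ρ 0) := ENNReal.ofReal_le_ofReal (le_max_left _ _)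

end Regular

/-! ### The error of the estimated nuisance functions -/

theorem measureReal_abs_ge_le {Ω : Type*} [MeasurableSpace Ω] {μ : Measure Ω} [IsFiniteMeasure μ]
    {f : Ω → ℝ} (hf : MemLp f 2 μ) {ε : ℝ} (hε : 0 < ε) :
    μ.real {ω | ε ≤ |f ω|} ≤ (∫ ω, f ω ^ 2 ∂μ) / ε ^ 2 := by
  rw [le_div_iff₀ (by positivity), mul_comm]
  have := mul_meas_ge_le_integral_of_nonneg (μ := μ) (f := fun ω => f ω ^ 2)
    (Eventually.of_forall fun ω => sq_nonneg _) hf.integrable_sq (ε ^ 2)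
  have hset : {ω | ε ≤ |f ω|} = {ω | ε ^ 2 ≤ f ω ^ 2} := Set.ext fun ω => by
    change ε ≤ |f ω| ↔ ε ^ 2 ≤ f ω ^ 2
    rw [← sq_abs (f ω)]
    exact (pow_le_pow_iff_left₀ hε.le (abs_nonneg _) two_ne_zero).symm
  rwa [hset]

section

variable {N q r t K : ℕ} {M : SEM N q r t} {net : Network N q r t} {p C₁ C₂ : ℝ≥0}
  {C₃ C₄ ρ τ : ℝ} {T : Set (Nuisance q r t)} {η : Nuisance q r t}

/-- The data of units that are not adjacent in the dependency graph are independent. -/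
theorem indepFun_S (M : SEM N q r t) (net : Network N q r t) {i j : Fin N} (h : j ∉ net.nbhd i) :
    IndepFun (fun ω => M.S net ω i) (fun ω => M.S net ω j) M.P := by
  have := M.prob_conf
  have := M.prob_noise
  exact DependsOn.indepFun _ (M.dependsOn_S net i) (M.dependsOn_S net j) (M.measurable_S net i)
    (M.measurable_S net j) (net.sources_disjoint_of_notMem_nbhd h)

/-- The training data of a fold are independent of the data in the fold. -/
theorem indepFun_trainData (M : SEM N q r t) (net : Network N q r t) (fold : Fin N → Fin K)
    (k : Fin K) : IndepFun (M.trainData net fold k)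
      (fun ω (i : {i // fold i = k}) => M.S net ω i) M.P := by
  have := M.prob_conf
  have := M.prob_noise
  refine DependsOn.indepFun (s := ⋃ j : net.train fold k, net.sources j)
    (t := ⋃ i : {i // fold i = k}, net.sources i) _ ?_ ?_ (M.measurable_trainData net fold k)
    (measurable_pi_lambda _ fun i => M.measurable_S net i) ?_
  · intro ω ω' h
    funext j
    exact M.dependsOn_S net j fun l hl => h l (Set.mem_iUnion.2 ⟨j, hl⟩)
  · intro ω ω' h
    funext i
    exact M.dependsOn_S net i fun l hl => h l (Set.mem_iUnion.2 ⟨i, hl⟩)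
  · refine Set.disjoint_iUnion_left.2 fun j => Set.disjoint_iUnion_right.2 fun i => ?_
    refine (net.sources_disjoint (fun hij => j.2.1 ?_) (j.2.2 i i.2)).symm
    rw [← hij]
    exact i.2

/-- The second moment of a sum of score differences: the variance part is small by local
dependence and consistency, the squared bias by Neyman orthogonality. -/
theorem integral_sum_score_sub_sq_le (h : Regular M net p C₁ C₂ C₃ C₄) (hC₃ : 0 < C₃)
    (hT : RealizationSet M net T p C₃ ρ τ) (hη : η ∈ T) (I : Finset (Fin N)) :
    ∫ ω, (∑ i ∈ I, (score (M.S net ω i) η - score (M.S net ω i) M.nuis)) ^ 2 ∂M.P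
      ≤ 2 * (I.card * ((net.maxDeg + 1 : ℕ) : ℝ) * ((1 + 1 / C₃ + 2 * C₂ / C₃ ^ 2) * τ) ^ 2)
        + 2 * (I.card * (1 / C₃ * max ρ 0)) ^ 2 := by
  obtain ⟨m1, m0, mh⟩ := hT.measurable η hη
  let f (i : Fin N) (ω : Exo N q) : ℝ := score (M.S net ω i) η - score (M.S net ω i) M.nuis
  let Y (i : Fin N) (ω : Exo N q) : ℝ := f i ω - ∫ ω, f i ω ∂M.P
  have hf : ∀ i, MemLp (f i) 2 M.P := fun i => (h.memLp_score_sub hC₃ hT hη i).1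
  have hY : ∀ i, MemLp (Y i) 2 M.P := fun i => (hf i).sub (memLp_const _)
  have hYm : ∀ i, ∫ ω, Y i ω ^ 2 ∂M.P ≤ ((1 + 1 / C₃ + 2 * C₂ / C₃ ^ 2) * τ) ^ 2 := fun i => by
    refine le_trans ?_ (h.memLp_score_sub hC₃ hT hη i).2
    have h1 := variance_eq_integral (hf i).1.aemeasurable
    have h2 := variance_eq_sub (hf i)
    change _ ≤ ∫ ω, f i ω ^ 2 ∂M.P
    have h3 : ∫ ω, Y i ω ^ 2 ∂M.P = ∫ ω, f i ω ^ 2 ∂M.P - (∫ ω, f i ω ∂M.P) ^ 2 :=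
      h1.symm.trans h2
    rw [h3]
    linarith [sq_nonneg (∫ ω, f i ω ∂M.P)]
  have hY0 : ∀ i, ∫ ω, Y i ω ∂M.P = 0 := fun i => by
    rw [integral_sub ((hf i).integrable one_le_two) (integrable_const _)]
    simp
  have horth : ∀ i ∈ I, ∀ j ∈ I, j ∉ net.nbhd i → ∫ ω, Y i ω * Y j ω ∂M.P = 0 := by
    intro i _ j _ hij
    have hg : ∀ i, Measurable fun s : UnitData q r t =>
        score s η - score s M.nuis - ∫ ω, f i ω ∂M.P := fun i =>
      ((measurable_score m1 m0 mh).sub (measurable_score M.measurable_g1 M.measurable_g0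
        M.measurable_h)).sub measurable_const
    have hind : IndepFun (Y i) (Y j) M.P := (indepFun_S M net hij).comp (hg i) (hg j)
    rw [hind.integral_fun_mul_eq_mul_integral (hY i).1 (hY j).1, hY0 i, zero_mul]
  have hvar := integral_sum_sq_le I Y net.nbhd (net.maxDeg + 1) (fun i _ => hY i)
    (fun i _ => hYm i) (fun i _ => net.card_nbhd_le i) horth
  have hbias : |∑ i ∈ I, ∫ ω, f i ω ∂M.P| ≤ I.card * (1 / C₃ * max ρ 0) := by
    refine (Finset.abs_sum_le_sum_abs _ _).trans ?_
    rw [← nsmul_eq_mul]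
    exact Finset.sum_le_card_nsmul _ _ _ fun i _ => h.abs_integral_score_sub_le hC₃ hT hη i
  have hbias2 : (∑ i ∈ I, ∫ ω, f i ω ∂M.P) ^ 2 ≤ (I.card * (1 / C₃ * max ρ 0)) ^ 2 := by
    rw [← sq_abs]
    exact pow_le_pow_left₀ (abs_nonneg _) hbias 2
  have hYs : MemLp (fun ω => ∑ i ∈ I, Y i ω) 2 M.P := memLp_finsetSum _ fun i _ => hY i
  have hfs : MemLp (fun ω => ∑ i ∈ I, f i ω) 2 M.P := memLp_finsetSum _ fun i _ => hf i
  calc ∫ ω, (∑ i ∈ I, f i ω) ^ 2 ∂M.P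
      ≤ ∫ ω, (2 * (∑ i ∈ I, Y i ω) ^ 2 + 2 * (∑ i ∈ I, ∫ ω, f i ω ∂M.P) ^ 2) ∂M.P := by
        refine integral_mono hfs.integrable_sq
          ((hYs.integrable_sq.const_mul 2).add (integrable_const _)) fun ω => ?_
        have e : ∑ i ∈ I, f i ω = ∑ i ∈ I, Y i ω + ∑ i ∈ I, ∫ ω, f i ω ∂M.P := by
          rw [← Finset.sum_add_distrib]
          exact Finset.sum_congr rfl fun i _ => (sub_add_cancel _ _).symm
        dsimp only
        rw [e]
        nlinarith [sq_nonneg (∑ i ∈ I, Y i ω - ∑ i ∈ I, ∫ ω, f i ω ∂M.P)]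
    _ = 2 * ∫ ω, (∑ i ∈ I, Y i ω) ^ 2 ∂M.P + 2 * (∑ i ∈ I, ∫ ω, f i ω ∂M.P) ^ 2 := by
        rw [integral_add (hYs.integrable_sq.const_mul 2) (integrable_const _), integral_const_mul]
        simp
    _ ≤ _ := by linarith

/-- Cross-fitting: as the training data of a fold are independent of the data in the fold, the
estimated nuisance functions can be treated as fixed elements of the realization set. -/
theorem measure_sum_score_sub_ge_le (h : Regular M net p C₁ C₂ C₃ C₄) (hC₃ : 0 < C₃)
    (hT : RealizationSet M net T p C₃ ρ τ) (fold : Fin N → Fin K) (k : Fin K)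
    {L : (net.train fold k → UnitData q r t) → Nuisance q r t} (hL : MeasurableLearner L)
    {Δ : ℝ} (hΔ : 0 ≤ Δ)
    (hmem : (M.P.map (M.trainData net fold k)) {s | L s ∉ T} ≤ ENNReal.ofReal Δ)
    {ε : ℝ} (hε : 0 < ε) :
    M.P.real {ω | ε ≤ |∑ i with fold i = k,
        (score (M.S net ω i) (L (M.trainData net fold k ω)) - score (M.S net ω i) M.nuis)|}
      ≤ Δ + (2 * (N * ((net.maxDeg + 1 : ℕ) : ℝ) * ((1 + 1 / C₃ + 2 * C₂ / C₃ ^ 2) * τ) ^ 2)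
        + 2 * (N * (1 / C₃ * max ρ 0)) ^ 2) / ε ^ 2 := by
  set c : ℝ := (2 * (N * ((net.maxDeg + 1 : ℕ) : ℝ) * ((1 + 1 / C₃ + 2 * C₂ / C₃ ^ 2) * τ) ^ 2)
        + 2 * (N * (1 / C₃ * max ρ 0)) ^ 2) / ε ^ 2 with hc
  have hc0 : 0 ≤ c := by positivity
  let V (ω : Exo N q) (i : {i // fold i = k}) : UnitData q r t := M.S net ω i
  let G (x : (net.train fold k → UnitData q r t) × ({i // fold i = k} → UnitData q r t)) : ℝ :=
    ∑ i, (score (x.2 i) (L x.1) - score (x.2 i) M.nuis)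
  have hVm : Measurable V := measurable_pi_lambda _ fun i => M.measurable_S net i
  have htm := M.measurable_trainData net fold k
  have hGm : Measurable G := by
    refine Finset.measurable_fun_sum _ fun i _ => ?_
    have hi : Measurable fun x : (net.train fold k → UnitData q r t)
        × ({i // fold i = k} → UnitData q r t) => x.2 i :=
      (measurable_pi_apply i).comp measurable_snd
    exact (hL.measurable_score.comp (measurable_fst.prodMk hi)).sub
      ((measurable_score M.measurable_g1 M.measurable_g0 M.measurable_h).comp hi)
  have hsum : ∀ (s : net.train fold k → UnitData q r t) (ω : Exo N q), G (s, V ω)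
      = ∑ i with fold i = k, (score (M.S net ω i) (L s) - score (M.S net ω i) M.nuis) :=
    fun s ω => (Finset.sum_subtype _ (fun i => by simp)
      fun i => score (M.S net ω i) (L s) - score (M.S net ω i) M.nuis).symm
  have hEm : MeasurableSet {x | ε ≤ |G x|} :=
    measurableSet_le measurable_const (measurable_abs.comp hGm)
  -- Chebyshev's inequality for a fixed value of the training data.
  have hfix : ∀ s, L s ∈ T → (M.P.map V) (Prod.mk s ⁻¹' {x | ε ≤ |G x|}) ≤ ENNReal.ofReal c := by
    intro s hs
    rw [Measure.map_apply hVm (hEm.preimage measurable_prodMk_left)]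
    have hset : V ⁻¹' (Prod.mk s ⁻¹' {x | ε ≤ |G x|}) = {ω | ε ≤ |∑ i with fold i = k,
        (score (M.S net ω i) (L s) - score (M.S net ω i) M.nuis)|} := by
      ext ω
      simp only [Set.mem_preimage, Set.mem_ofPred_eq, hsum]
    rw [hset, ← ofReal_measureReal]
    refine ENNReal.ofReal_le_ofReal ?_
    have hLp : MemLp (fun ω => ∑ i with fold i = k,
        (score (M.S net ω i) (L s) - score (M.S net ω i) M.nuis)) 2 M.P :=
      memLp_finsetSum _ fun i _ => (h.memLp_score_sub hC₃ hT hs i).1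
    refine (measureReal_abs_ge_le hLp hε).trans ?_
    rw [hc]
    refine div_le_div_of_nonneg_right ?_ (by positivity)
    refine (integral_sum_score_sub_sq_le h hC₃ hT hs _).trans ?_
    have hcard : ((Finset.univ.filter fun i => fold i = k).card : ℝ) ≤ N := by
      have := Finset.card_filter_le (Finset.univ : Finset (Fin N)) fun i => fold i = k
      rw [Finset.card_univ, Fintype.card_fin] at this
      exact_mod_cast this
    gcongr
  set B := toMeasurable (M.P.map (M.trainData net fold k)) {s | L s ∉ T} with hB
  have : IsProbabilityMeasure (M.P.map (M.trainData net fold k)) :=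
    Measure.isProbabilityMeasure_map htm.aemeasurable
  have : IsProbabilityMeasure (M.P.map V) := Measure.isProbabilityMeasure_map hVm.aemeasurable
  have hmain : M.P {ω | ε ≤ |∑ i with fold i = k,
        (score (M.S net ω i) (L (M.trainData net fold k ω)) - score (M.S net ω i) M.nuis)|}
      ≤ ENNReal.ofReal Δ + ENNReal.ofReal c := by
    have hset : {ω | ε ≤ |∑ i with fold i = k,
        (score (M.S net ω i) (L (M.trainData net fold k ω)) - score (M.S net ω i) M.nuis)|}
        = (fun ω => (M.trainData net fold k ω, V ω)) ⁻¹' {x | ε ≤ |G x|} := by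
      ext ω
      simp only [Set.mem_preimage, Set.mem_ofPred_eq, hsum]
    rw [hset, ← Measure.map_apply (htm.prodMk hVm) hEm,
      (indepFun_iff_map_prod_eq_prod_map_map htm.aemeasurable hVm.aemeasurable).1
        (indepFun_trainData M net fold k), Measure.prod_apply hEm]
    calc ∫⁻ s, (M.P.map V) (Prod.mk s ⁻¹' {x | ε ≤ |G x|}) ∂(M.P.map (M.trainData net fold k))
        ≤ ∫⁻ s, (B.indicator 1 s + ENNReal.ofReal c) ∂(M.P.map (M.trainData net fold k)) := by
          refine lintegral_mono fun s => ?_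
          by_cases hs : s ∈ B
          · rw [Set.indicator_of_mem hs]
            exact prob_le_one.trans le_self_add
          · have hsT : L s ∈ T := by
              by_contra hns
              exact hs (subset_toMeasurable _ _ hns)
            exact (hfix s hsT).trans le_add_self
      _ = (M.P.map (M.trainData net fold k)) B + ENNReal.ofReal c := by
          rw [lintegral_add_right _ measurable_const,
            lintegral_indicator_one (measurableSet_toMeasurable _ _), lintegral_const,
            measure_univ, mul_one]
      _ ≤ ENNReal.ofReal Δ + ENNReal.ofReal c := by
          rw [hB, measure_toMeasurable]
          exact add_le_add_left hmem _
  rw [← ENNReal.ofReal_add hΔ hc0] at hmain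
  exact ENNReal.toReal_le_of_le_ofReal (by positivity) hmain

end

/-! ### Comparison of the estimator with the average of the true scores -/

/-- Characteristic functions of random variables that are close in probability are close. -/
theorem norm_charFun_map_sub_le {Ω : Type*} [MeasurableSpace Ω] {μ : Measure Ω}
    [IsProbabilityMeasure μ] {A S : Ω → ℝ} (hA : Measurable A) (hS : Measurable S) (t : ℝ) {ε : ℝ}
    (hε : 0 ≤ ε) :
    ‖charFun (μ.map A) t - charFun (μ.map S) t‖ ≤ |t| * ε + 2 * μ.real {ω | ε ≤ |A ω - S ω|} := by
  have hn : ∀ x : ℝ, ‖Complex.exp (t * x * Complex.I)‖ = 1 := fun x => by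
    rw [← Complex.ofReal_mul, Complex.norm_exp_ofReal_mul_I]
  have hint : ∀ {f : Ω → ℝ}, Measurable f →
      Integrable (fun ω => Complex.exp (t * f ω * Complex.I)) μ := fun hf =>
    Integrable.of_bound (by fun_prop) 1 (Eventually.of_forall fun ω => (hn _).le)
  have hE : MeasurableSet {ω | ε ≤ |A ω - S ω|} :=
    measurableSet_le measurable_const (measurable_abs.comp (hA.sub hS))
  rw [charFun_apply_real, charFun_apply_real, integral_map hA.aemeasurable (by fun_prop),
    integral_map hS.aemeasurable (by fun_prop), ← integral_sub (hint hA) (hint hS)]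
  have hind : Integrable ({ω | ε ≤ |A ω - S ω|}.indicator fun _ => (2 : ℝ)) μ :=
    (integrable_const _).indicator hE
  calc ‖∫ ω, (Complex.exp (t * A ω * Complex.I) - Complex.exp (t * S ω * Complex.I)) ∂μ‖
      ≤ ∫ ω, (|t| * ε + {ω | ε ≤ |A ω - S ω|}.indicator (fun _ => (2 : ℝ)) ω) ∂μ := by
        refine norm_integral_le_of_norm_le ((integrable_const _).add hind)
          (Eventually.of_forall fun ω => ?_)
        by_cases hω : ω ∈ {ω | ε ≤ |A ω - S ω|}
        · rw [Set.indicator_of_mem hω]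
          refine (norm_sub_le _ _).trans ?_
          rw [hn, hn]
          have : 0 ≤ |t| * ε := by positivity
          linarith
        · rw [Set.indicator_of_notMem hω, add_zero]
          have hlt : |A ω - S ω| ≤ ε := (not_le.1 hω).le
          have e : Complex.exp (t * A ω * Complex.I) - Complex.exp (t * S ω * Complex.I)
              = Complex.exp (t * S ω * Complex.I)
                * (Complex.exp (Complex.I * (t * (A ω - S ω) : ℝ)) - 1) := by
            rw [mul_sub, ← Complex.exp_add, mul_one]
            congr 2
            push_cast
            ring
          rw [e, norm_mul, hn, one_mul]
          refine Real.norm_exp_I_mul_ofReal_sub_one_le.trans ?_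
          rw [Real.norm_eq_abs, abs_mul]
          exact mul_le_mul_of_nonneg_left hlt (abs_nonneg _)
    _ = |t| * ε + 2 * μ.real {ω | ε ≤ |A ω - S ω|} := by
        rw [integral_add (integrable_const _) hind, integral_indicator hE, setIntegral_const]
        simp [mul_comm]

/-- The number of units in a fold differs from `N / K` by at most one. -/
theorem abs_sub_mul_card_fold_le {N K : ℕ} (fold : Fin N → Fin K)
    (hfold : ∀ k k' : Fin K, (Finset.univ.filter fun i => fold i = k).card
        ≤ (Finset.univ.filter fun i => fold i = k').card + 1) (k : Fin K) :
    |(N : ℝ) - K * ((Finset.univ.filter fun i => fold i = k).card : ℝ)| ≤ K := by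
  have hsum : N = ∑ k' : Fin K, (Finset.univ.filter fun i => fold i = k').card := by
    have := Finset.card_eq_sum_card_fiberwise (s := (Finset.univ : Finset (Fin N)))
      (t := (Finset.univ : Finset (Fin K))) (f := fold) fun i _ => by simp
    simpa using this
  have h1 : N ≤ K * ((Finset.univ.filter fun i => fold i = k).card + 1) := by
    conv_lhs => rw [hsum]
    refine (Finset.sum_le_card_nsmul _ _ _ fun k' _ => hfold k' k).trans ?_
    simp
  have h2 : K * (Finset.univ.filter fun i => fold i = k).card ≤ N + K := by
    have : ∑ _k' : Fin K, (Finset.univ.filter fun i => fold i = k).card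
        ≤ ∑ k' : Fin K, ((Finset.univ.filter fun i => fold i = k').card + 1) :=
      Finset.sum_le_sum fun k' _ => hfold k k'
    rw [Finset.sum_add_distrib, ← hsum] at this
    simpa using this
  have h1' : (N : ℝ) ≤ K * (((Finset.univ.filter fun i => fold i = k).card : ℝ) + 1) := by
    exact_mod_cast h1
  have h2' : (K : ℝ) * ((Finset.univ.filter fun i => fold i = k).card : ℝ) ≤ N + K := by
    exact_mod_cast h2
  rw [abs_le]
  constructor <;> linarith

namespace SEM

variable {N q r t K : ℕ} (M : SEM N q r t) (net : Network N q r t)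

/-- `N^{-1/2} ∑ ψ(S_i, θ_i⁰, η⁰)`, the error of the infeasible estimator that knows the nuisance
functions, scaled by `√N`. -/
noncomputable def oracleError (ω : Exo N q) : ℝ :=
  (1 / √(N : ℝ)) * ∑ i, (score (M.S net ω i) M.nuis - M.unitEffect net i)

theorem measurable_oracleError : Measurable (M.oracleError net) :=
  (Finset.measurable_fun_sum _ fun i _ =>
    (Regular.measurable_score_nuis M net i).sub measurable_const).const_mul _

/-- The sum over fold `k` of the score differences due to estimating the nuisance functions. -/
noncomputable def foldError (fold : Fin N → Fin K)
    (learner : (k : Fin K) → (net.train fold k → UnitData q r t) → Nuisance q r t) (k : Fin K)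
    (ω : Exo N q) : ℝ :=
  ∑ i with fold i = k,
    (score (M.S net ω i) (learner k (M.trainData net fold k ω)) - score (M.S net ω i) M.nuis)

/-- The estimator differs from the oracle by the estimation errors of the nuisance functions and
by the effect of unequal fold sizes. -/
theorem scaledError_sub_oracleError (fold : Fin N → Fin K)
    (learner : (k : Fin K) → (net.train fold k → UnitData q r t) → Nuisance q r t)
    (ω : Exo N q) :
    M.scaledError net fold learner ω - M.oracleError net ω
      = ∑ k : Fin K,
        (√(N : ℝ) / (K * ((Finset.univ.filter fun i => fold i = k).card : ℝ))
            * M.foldError net fold learner k ω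
          + (√(N : ℝ) / (K * ((Finset.univ.filter fun i => fold i = k).card : ℝ)) - 1 / √(N : ℝ))
            * ∑ i with fold i = k, score (M.S net ω i) M.nuis) := by
  have hN : √(N : ℝ) * (1 / (N : ℝ)) = 1 / √(N : ℝ) := by
    rcases Nat.eq_zero_or_pos N with h | h
    · subst h; simp
    · have : (0 : ℝ) < N := by exact_mod_cast h
      rw [mul_one_div, div_eq_div_iff this.ne' (Real.sqrt_pos.2 this).ne',
        Real.mul_self_sqrt this.le, one_mul]
  have e1 : M.scaledError net fold learner ω
      = ∑ k : Fin K, √(N : ℝ) / (K * ((Finset.univ.filter fun i => fold i = k).card : ℝ))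
          * (∑ i with fold i = k, score (M.S net ω i) (learner k (M.trainData net fold k ω)))
        - 1 / √(N : ℝ) * ∑ i, M.unitEffect net i := by
    rw [scaledError, thetaHat, eate, mul_sub, ← mul_assoc (√(N : ℝ)) (1 / (N : ℝ)), hN,
      ← mul_assoc (√(N : ℝ)), Finset.mul_sum]
    congr 1
    refine Finset.sum_congr rfl fun k _ => ?_
    rw [← mul_assoc]
    congr 1
    rw [mul_assoc, one_div_mul_one_div, mul_one_div]
  have e2 : M.oracleError net ω
      = ∑ k : Fin K, 1 / √(N : ℝ) * (∑ i with fold i = k, score (M.S net ω i) M.nuis)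
        - 1 / √(N : ℝ) * ∑ i, M.unitEffect net i := by
    rw [oracleError, Finset.sum_sub_distrib, mul_sub, ← Finset.mul_sum, Finset.sum_fiberwise]
  rw [e1, e2, sub_sub_sub_cancel_right, ← Finset.sum_sub_distrib]
  refine Finset.sum_congr rfl fun k _ => ?_
  rw [foldError, Finset.sum_sub_distrib]
  ring

/-- As `K |I_k|` differs from `N` by at most `K`, the weights `√N / (K |I_k|)` are at most
`2 / √N` and differ from `1 / √N` by at most `1 / (|I_k| √N)`. -/
theorem abs_scaledError_sub_oracleError_le (hKN : 2 * K ≤ N) (fold : Fin N → Fin K)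
    (hfold : ∀ k k' : Fin K, (Finset.univ.filter fun i => fold i = k).card
        ≤ (Finset.univ.filter fun i => fold i = k').card + 1)
    (learner : (k : Fin K) → (net.train fold k → UnitData q r t) → Nuisance q r t)
    {ω : Exo N q} {B a : ℝ} (hB : ∀ i, |score (M.S net ω i) M.nuis| ≤ B)
    (ha : ∀ k, |M.foldError net fold learner k ω| ≤ √(N : ℝ) * a) :
    |M.scaledError net fold learner ω - M.oracleError net ω|
      ≤ 2 * K * a + K * B * (1 / √(N : ℝ)) := by
  rw [scaledError_sub_oracleError]
  refine (Finset.abs_sum_le_sum_abs _ _).trans ?_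
  have hk : ∀ k : Fin K, |√(N : ℝ) / (K * ((Finset.univ.filter fun i => fold i = k).card : ℝ))
            * M.foldError net fold learner k ω
          + (√(N : ℝ) / (K * ((Finset.univ.filter fun i => fold i = k).card : ℝ)) - 1 / √(N : ℝ))
            * ∑ i with fold i = k, score (M.S net ω i) M.nuis| ≤ 2 * a + B * (1 / √(N : ℝ)) := by
    intro k
    have hK : (0 : ℝ) < K := by exact_mod_cast k.pos
    have hKN' : 2 * (K : ℝ) ≤ N := by exact_mod_cast hKN
    have hN : (0 : ℝ) < N := by linarith
    have hs : 0 < √(N : ℝ) := Real.sqrt_pos.2 hN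
    have hss : √(N : ℝ) * √(N : ℝ) = N := Real.mul_self_sqrt hN.le
    have hcard := abs_sub_mul_card_fold_le fold hfold k
    set n : ℝ := ((Finset.univ.filter fun i => fold i = k).card : ℝ) with hn
    have hNn : (N : ℝ) ≤ 2 * (K * n) := by linarith [(abs_le.1 hcard).2]
    have hKn : 0 < K * n := by linarith
    have hnpos : 0 < n := by
      by_contra hneg
      nlinarith [not_lt.1 hneg]
    have hB0 : |∑ i with fold i = k, score (M.S net ω i) M.nuis| ≤ n * B := by
      refine (Finset.abs_sum_le_sum_abs _ _).trans ?_
      rw [hn, ← nsmul_eq_mul]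
      exact Finset.sum_le_card_nsmul _ _ _ fun i _ => hB i
    have ha0 : 0 ≤ √(N : ℝ) * a := (abs_nonneg _).trans (ha k)
    have h1 : √(N : ℝ) / (K * n) * (√(N : ℝ) * a) ≤ 2 * a := by
      have ha1 : 0 ≤ a := nonneg_of_mul_nonneg_right ha0 hs
      have : √(N : ℝ) / (K * n) * (√(N : ℝ) * a) = (√(N : ℝ) * √(N : ℝ) / (K * n)) * a := by ring
      rw [this, hss]
      refine mul_le_mul_of_nonneg_right ?_ ha1
      rwa [div_le_iff₀ hKn]
    have h2 : |√(N : ℝ) / (K * n) - 1 / √(N : ℝ)| * n ≤ 1 / √(N : ℝ) := by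
      have e : √(N : ℝ) / (K * n) - 1 / √(N : ℝ) = (N - K * n) / (K * n * √(N : ℝ)) := by
        rw [div_sub_div _ _ hKn.ne' hs.ne', hss, mul_one]
      rw [e, abs_div, abs_of_pos (mul_pos hKn hs), div_mul_eq_mul_div,
        div_le_div_iff₀ (mul_pos hKn hs) hs]
      have := mul_le_mul_of_nonneg_right hcard (mul_pos hnpos hs).le
      nlinarith
    refine (abs_add_le _ _).trans (add_le_add ?_ ?_)
    · rw [abs_mul, abs_of_nonneg (by positivity : 0 ≤ √(N : ℝ) / (K * n))]
      exact (mul_le_mul_of_nonneg_left (ha k) (by positivity)).trans h1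
    · have hBn : 0 ≤ B := by
        have := (abs_nonneg _).trans hB0
        exact nonneg_of_mul_nonneg_right this hnpos
      rw [abs_mul]
      calc _ ≤ |√(N : ℝ) / (K * n) - 1 / √(N : ℝ)| * (n * B) :=
            mul_le_mul_of_nonneg_left hB0 (abs_nonneg _)
        _ = B * (|√(N : ℝ) / (K * n) - 1 / √(N : ℝ)| * n) := by ring
        _ ≤ B * (1 / √(N : ℝ)) := mul_le_mul_of_nonneg_left h2 hBn
  refine (Finset.sum_le_card_nsmul _ _ _ fun k _ => hk k).trans (le_of_eq ?_)
  simp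
  ring

end SEM

section

variable {N q r t K : ℕ} {M : SEM N q r t} {net : Network N q r t} {p C₁ C₂ : ℝ≥0}
  {C₃ C₄ ρ τ : ℝ} {T : Set (Nuisance q r t)}

/-- The union bound over the folds. -/
theorem measureReal_scaledError_sub_ge_le (h : Regular M net p C₁ C₂ C₃ C₄) (hC₃ : 0 < C₃)
    (hT : RealizationSet M net T p C₃ ρ τ) (hK : 0 < K) (hKN : 2 * K ≤ N) (fold : Fin N → Fin K)
    (hfold : ∀ k k' : Fin K, (Finset.univ.filter fun i => fold i = k).card
        ≤ (Finset.univ.filter fun i => fold i = k').card + 1)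
    {learner : (k : Fin K) → (net.train fold k → UnitData q r t) → Nuisance q r t}
    (hL : ∀ k, MeasurableLearner (learner k)) {Δ : ℝ} (hΔ : 0 ≤ Δ)
    (hmem : ∀ k, (M.P.map (M.trainData net fold k)) {s | learner k s ∉ T} ≤ ENNReal.ofReal Δ)
    {ε a : ℝ} (ha : 0 < a)
    (hε : 2 * K * a + K * (2 * C₂ + 2 * C₂ / C₃) * (1 / √(N : ℝ)) < ε) :
    M.P.real {ω | ε ≤ |M.scaledError net fold learner ω - M.oracleError net ω|}
      ≤ K * (Δ + 2 / a ^ 2 * (((net.maxDeg + 1 : ℕ) : ℝ)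
        * ((1 + 1 / C₃ + 2 * C₂ / C₃ ^ 2) * τ) ^ 2 + N * (1 / C₃ * max ρ 0) ^ 2)) := by
  have hN : (0 : ℝ) < N := by exact_mod_cast (by omega : 0 < N)
  have hs : 0 < √(N : ℝ) := Real.sqrt_pos.2 hN
  have hsub : M.P.real {ω | ε ≤ |M.scaledError net fold learner ω - M.oracleError net ω|}
      ≤ M.P.real (⋃ k : Fin K, {ω | √(N : ℝ) * a ≤ |M.foldError net fold learner k ω|}) := by
    refine ENNReal.toReal_mono (measure_ne_top _ _) (measure_mono_ae ?_)
    filter_upwards [ae_all_iff.2 fun i => h.ae_abs_score_le hC₃ i] with ω hB hω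
    by_contra hnot
    have hall : ∀ k, |M.foldError net fold learner k ω| ≤ √(N : ℝ) * a := fun k => by
      by_contra hk
      exact hnot (Set.mem_iUnion.2 ⟨k, (not_le.1 hk).le⟩)
    have := M.abs_scaledError_sub_oracleError_le net hKN fold hfold learner hB hall
    have hω' : ε ≤ |M.scaledError net fold learner ω - M.oracleError net ω| := hω
    linarith
  refine hsub.trans ((measureReal_iUnion_fintype_le _).trans ?_)
  refine (Finset.sum_le_card_nsmul _ _ _ fun k _ =>
    measure_sum_score_sub_ge_le h hC₃ hT fold k (hL k) hΔ (hmem k)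
      (mul_pos hs ha)).trans (le_of_eq ?_)
  rw [Finset.card_univ, Fintype.card_fin, nsmul_eq_mul, mul_pow (√(N : ℝ)) a, Real.sq_sqrt hN.le]
  congr 2
  field_simp

/-- The true scores form a locally dependent family. -/
theorem locallyDependent_score (h : Regular M net p C₁ C₂ C₃ C₄) (hC₃ : 0 < C₃) :
    LocallyDependent (fun _ : Fin N => M.confLaw.prod (unifLaw.prod M.noiseLaw))
      (fun i ω => (1 / √(N : ℝ)) * (score (M.S net ω i) M.nuis - M.unitEffect net i))
      net.sources net.nbhd (net.maxDeg + 1)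
      ((1 / √(N : ℝ)) * (2 * C₂ + 2 * C₂ / C₃ + |C₄|)) where
  measurable i := ((Regular.measurable_score_nuis M net i).sub measurable_const).const_mul _
  dependsOn i := (M.dependsOn_S net i).map fun s =>
    (1 / √(N : ℝ)) * (score s M.nuis - M.unitEffect net i)
  centred i := by
    change ∫ ω, (1 / √(N : ℝ)) * (score (M.S net ω i) M.nuis - M.unitEffect net i) ∂M.P = 0
    rw [integral_const_mul, integral_sub (h.integrable_score_nuis hC₃ i) (integrable_const _),
      h.integral_score_nuis hC₃ i]
    simp
  bound i := by
    change ∀ᵐ ω ∂M.P, |(1 / √(N : ℝ)) * (score (M.S net ω i) M.nuis - M.unitEffect net i)| ≤ _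
    filter_upwards [h.ae_abs_score_le hC₃ i] with ω hω
    rw [abs_mul, abs_of_nonneg (by positivity : 0 ≤ 1 / √(N : ℝ))]
    refine mul_le_mul_of_nonneg_left ?_ (by positivity)
    exact (abs_sub _ _).trans (add_le_add hω ((h.effects i).trans (le_abs_self _)))
  nonneg := by positivity
  symm _ _ := net.mem_nbhd_symm
  disjoint _ _ := net.sources_disjoint_of_notMem_nbhd
  card_le := net.card_nbhd_le

theorem norm_charFun_oracleError_sub_le (h : Regular M net p C₁ C₂ C₃ C₄) (hC₃ : 0 < C₃)
    (x : ℝ) :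
    ‖charFun (M.P.map (M.oracleError net)) x
      - Complex.exp (-(M.scoreVariance net : ℂ) * x ^ 2 / 2)‖
      ≤ 3 * N * ((net.maxDeg + 1 : ℕ) : ℝ) ^ 2
          * ((1 / √(N : ℝ)) * (2 * C₂ + 2 * C₂ / C₃ + |C₄|)) ^ 3 * |x| ^ 3
        + 4 * √(N * ((net.maxDeg + 1 : ℕ) : ℝ) ^ 3
          * ((1 / √(N : ℝ)) * (2 * C₂ + 2 * C₂ / C₃ + |C₄|)) ^ 4) * x ^ 2 := by
  have := M.prob_conf
  have := M.prob_noise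
  have hld := locallyDependent_score h hC₃
  have hmain := hld.norm_charFun_sub_le x
  have hS : (fun ω => ∑ i, (1 / √(N : ℝ)) * (score (M.S net ω i) M.nuis - M.unitEffect net i))
      = M.oracleError net := by
    funext ω
    rw [SEM.oracleError, Finset.mul_sum]
  have hv : ∫ ω, (∑ i, (1 / √(N : ℝ)) * (score (M.S net ω i) M.nuis - M.unitEffect net i)) ^ 2 ∂M.P
      = M.scoreVariance net := by
    have hzero : ∫ ω, M.oracleError net ω ∂M.P = 0 := by
      have hint : ∀ i, Integrable (fun ω => (1 / √(N : ℝ))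
          * (score (M.S net ω i) M.nuis - M.unitEffect net i)) M.P := fun i =>
        (hld.memLp_two i).integrable one_le_two
      rw [← hS]
      refine (integral_finsetSum _ fun i _ => hint i).trans ?_
      exact Finset.sum_eq_zero fun i _ => hld.centred i
    have := variance_of_integral_eq_zero (M.measurable_oracleError net).aemeasurable hzero
    rw [← hS] at this
    rw [SEM.scoreVariance]
    refine Eq.trans ?_ (this.symm.trans (congrArg (fun f => variance f M.P) hS))
    rfl
  change ‖charFun (M.P.map _) x - Complex.exp (-((∫ ω, _ ∂M.P : ℝ) : ℂ) * x ^ 2 / 2)‖ ≤ _ at hmain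
  rw [hS, hv, Fintype.card_fin] at hmain
  exact hmain

end

/-! ### Rates -/

/-- For bounded summands scaled by `N^{-1/2}` and a dependency graph of degree `o(N^{1/4})`, the
error in the central limit theorem for locally dependent variables vanishes. -/
theorem tendsto_normal_approximation_error {d : ℕ → ℕ}
    (hd : (fun N => (d N : ℝ)) =o[atTop] (fun N : ℕ => (N : ℝ) ^ (1 / 4 : ℝ))) (B x : ℝ) :
    Tendsto (fun N : ℕ => 3 * N * ((d N + 1 : ℕ) : ℝ) ^ 2 * ((1 / √(N : ℝ)) * B) ^ 3 * |x| ^ 3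
      + 4 * √(N * ((d N + 1 : ℕ) : ℝ) ^ 3 * ((1 / √(N : ℝ)) * B) ^ 4) * x ^ 2) atTop (𝓝 0) := by
  have hs : Tendsto (fun N : ℕ => (N : ℝ) ^ (1 / 4 : ℝ)) atTop atTop :=
    (tendsto_rpow_atTop (by norm_num)).comp tendsto_natCast_atTop_atTop
  have hone : (fun _ : ℕ => (1 : ℝ)) =o[atTop] (fun N : ℕ => (N : ℝ) ^ (1 / 4 : ℝ)) :=
    isLittleO_const_left.2 (Or.inr (tendsto_norm_atTop_atTop.comp hs))
  have hu : Tendsto (fun N : ℕ => ((d N : ℝ) + 1) / (N : ℝ) ^ (1 / 4 : ℝ)) atTop (𝓝 0) :=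
    (hd.add hone).tendsto_div_nhds_zero
  have hv : Tendsto (fun N : ℕ => ((N : ℝ) ^ (1 / 4 : ℝ))⁻¹) atTop (𝓝 0) :=
    tendsto_inv_atTop_zero.comp hs
  have hlim : Tendsto (fun N : ℕ =>
      3 * B ^ 3 * (((d N : ℝ) + 1) / (N : ℝ) ^ (1 / 4 : ℝ)) ^ 2 * |x| ^ 3
      + 4 * √(B ^ 4 * (((d N : ℝ) + 1) / (N : ℝ) ^ (1 / 4 : ℝ)) ^ 3
        * ((N : ℝ) ^ (1 / 4 : ℝ))⁻¹) * x ^ 2) atTop (𝓝 0) := by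
    have h1 := ((hu.pow 2).const_mul (3 * B ^ 3)).mul_const (|x| ^ 3)
    have h2 := (((((hu.pow 3).const_mul (B ^ 4)).mul hv).sqrt).const_mul 4).mul_const (x ^ 2)
    simpa using h1.add h2
  refine hlim.congr' ?_
  filter_upwards [eventually_gt_atTop 0] with N hN
  have hN' : (0 : ℝ) < N := by exact_mod_cast hN
  set s : ℝ := (N : ℝ) ^ (1 / 4 : ℝ) with hsdef
  have hs0 : 0 < s := Real.rpow_pos_of_pos hN' _
  have hs4 : (N : ℝ) = s ^ 4 := by
    rw [hsdef, ← Real.rpow_natCast, ← Real.rpow_mul hN'.le]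
    norm_num
  have hsq : √(N : ℝ) = s ^ 2 := by
    rw [hs4, show s ^ 4 = (s ^ 2) ^ 2 by ring, Real.sqrt_sq (by positivity)]
  rw [hsq, hs4]
  push_cast
  congr 1
  · field_simp
  · congr 3
    field_simp

/-- The bound on the effect of the estimated nuisance functions vanishes under the rate
assumptions. -/
theorem tendsto_nuisance_error {d : ℕ → ℕ} {δ Δ : ℕ → ℝ} {κ C₃ C₅ C₆ C₇ : ℝ} {K : ℕ}
    (hδ_nonneg : ∀ N, 0 ≤ δ N) (hΔ_nonneg : ∀ N, 0 ≤ Δ N)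
    (hδ : Tendsto δ atTop (𝓝 0)) (hΔ : Tendsto Δ atTop (𝓝 0)) (hκ : 0 ≤ κ)
    (hκdeg : ∀ N, K ≤ N → (d N : ℝ) * (N : ℝ) ^ (-(2 * κ)) ≤ C₆) (L a : ℝ) :
    Tendsto (fun N : ℕ => K * (Δ N + 2 / a ^ 2 * (((d N + 1 : ℕ) : ℝ)
        * (L * (C₇ * √(δ N) * (N : ℝ) ^ (-κ))) ^ 2
        + N * (1 / C₃ * max (C₅ * δ N * (N : ℝ) ^ (-(1 / 2) : ℝ)) 0) ^ 2))) atTop (𝓝 0) := by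
  have hlim : Tendsto (fun N : ℕ => K * (Δ N + 2 / a ^ 2 * (L ^ 2 * C₇ ^ 2 * (C₆ + 1) * δ N
      + (1 / C₃) ^ 2 * C₅ ^ 2 * δ N ^ 2))) atTop (𝓝 0) := by
    have h := (hΔ.add (((hδ.const_mul (L ^ 2 * C₇ ^ 2 * (C₆ + 1))).add
      ((hδ.pow 2).const_mul ((1 / C₃) ^ 2 * C₅ ^ 2))).const_mul (2 / a ^ 2))).const_mul (K : ℝ)
    simpa using h
  refine squeeze_zero' (Eventually.of_forall fun N => ?_) ?_ hlim
  · have := hΔ_nonneg N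
    positivity
  filter_upwards [eventually_gt_atTop 0, eventually_ge_atTop K] with N hN hKN
  have hN' : (1 : ℝ) ≤ N := by exact_mod_cast hN
  have hN0 : (0 : ℝ) < N := by linarith
  have hδN := hδ_nonneg N
  have h1 : ((d N + 1 : ℕ) : ℝ) * (L * (C₇ * √(δ N) * (N : ℝ) ^ (-κ))) ^ 2
      ≤ L ^ 2 * C₇ ^ 2 * (C₆ + 1) * δ N := by
    have e : ((N : ℝ) ^ (-κ)) ^ 2 = (N : ℝ) ^ (-(2 * κ)) := by
      rw [← Real.rpow_natCast, ← Real.rpow_mul hN0.le]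
      congr 1
      push_cast
      ring
    have hle : (N : ℝ) ^ (-(2 * κ)) ≤ 1 := Real.rpow_le_one_of_one_le_of_nonpos hN' (by linarith)
    have hdeg : ((d N : ℝ) + 1) * (N : ℝ) ^ (-(2 * κ)) ≤ C₆ + 1 := by
      linarith [hκdeg N hKN]
    push_cast
    rw [mul_pow, mul_pow, mul_pow, Real.sq_sqrt hδN, e]
    have h0 : 0 ≤ L ^ 2 * C₇ ^ 2 * δ N := by positivity
    nlinarith [mul_le_mul_of_nonneg_left hdeg h0]
  have h2 : (N : ℝ) * (1 / C₃ * max (C₅ * δ N * (N : ℝ) ^ (-(1 / 2) : ℝ)) 0) ^ 2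
      ≤ (1 / C₃) ^ 2 * C₅ ^ 2 * δ N ^ 2 := by
    set ρ := C₅ * δ N * (N : ℝ) ^ (-(1 / 2) : ℝ) with hρ
    have e : (N : ℝ) * ((N : ℝ) ^ (-(1 / 2) : ℝ)) ^ 2 = 1 := by
      rw [← Real.rpow_natCast, ← Real.rpow_mul hN0.le]
      norm_num
      rw [Real.rpow_neg_one, mul_inv_cancel₀ hN0.ne']
    have hmax : (max ρ 0) ^ 2 ≤ ρ ^ 2 := by
      rcases le_total ρ 0 with h | h
      · rw [max_eq_right h]; nlinarith [sq_nonneg ρ]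
      · rw [max_eq_left h]
    calc (N : ℝ) * (1 / C₃ * max ρ 0) ^ 2 = (1 / C₃) ^ 2 * N * (max ρ 0) ^ 2 := by ring
      _ ≤ (1 / C₃) ^ 2 * N * ρ ^ 2 := mul_le_mul_of_nonneg_left hmax (by positivity)
      _ = (1 / C₃) ^ 2 * C₅ ^ 2 * δ N ^ 2 * (N * ((N : ℝ) ^ (-(1 / 2) : ℝ)) ^ 2) := by
          rw [hρ]; ring
      _ = (1 / C₃) ^ 2 * C₅ ^ 2 * δ N ^ 2 := by rw [e, mul_one]
  gcongr

/-! ### Asymptotic normality, uniformly over the law -/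

section

variable {q r t K : ℕ} {net : ∀ N : ℕ, Network N q r t} {laws : ∀ N : ℕ, Set (SEM N q r t)}
  {p C₁ C₂ : ℝ≥0} {C₃ C₄ C₅ C₆ C₇ κ : ℝ}

/-- The characteristic function of the oracle error converges to the Gaussian one. -/
theorem eventually_norm_charFun_oracleError_sub_lt (hC₃ : 0 < C₃) {σ2 : ℝ≥0}
    (hreg : ∀ N, K ≤ N → ∀ M ∈ laws N, Regular M (net N) p C₁ C₂ C₃ C₄)
    (hdeg : (fun N => ((net N).maxDeg : ℝ)) =o[atTop] (fun N : ℕ => (N : ℝ) ^ (1 / 4 : ℝ)))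
    (hvar : ∀ ε > 0, ∀ᶠ N in atTop, ∀ M ∈ laws N, |M.scoreVariance (net N) - σ2| < ε)
    (x : ℝ) {ε : ℝ} (hε : 0 < ε) :
    ∀ᶠ N in atTop, ∀ M ∈ laws N,
      ‖charFun (M.P.map (M.oracleError (net N))) x - charFun (gaussianReal 0 σ2) x‖ < ε := by
  have hcont : Continuous fun v : ℝ => Complex.exp (-(v : ℂ) * x ^ 2 / 2) := by fun_prop
  obtain ⟨η, hη, hv⟩ := Metric.continuousAt_iff.1 (hcont.continuousAt (x := (σ2 : ℝ))) (ε / 2)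
    (by positivity)
  have hclt := (tendsto_normal_approximation_error hdeg
    (2 * C₂ + 2 * C₂ / C₃ + |C₄|) x).eventually_lt_const (by positivity : 0 < ε / 2)
  filter_upwards [hclt, hvar η hη, eventually_ge_atTop K] with N h1 h2 hKN M hM
  have h3 := norm_charFun_oracleError_sub_le (hreg N hKN M hM) hC₃ x
  have h4 := hv (x := M.scoreVariance (net N)) (h2 M hM)
  have hg : charFun (gaussianReal 0 σ2) x = Complex.exp (-((σ2 : ℝ) : ℂ) * x ^ 2 / 2) := by
    rw [charFun_gaussianReal]
    congr 1
    push_cast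
    ring
  rw [hg]
  rw [dist_eq_norm] at h4
  calc _ ≤ ‖charFun (M.P.map (M.oracleError (net N))) x
        - Complex.exp (-(M.scoreVariance (net N) : ℂ) * x ^ 2 / 2)‖
      + ‖Complex.exp (-(M.scoreVariance (net N) : ℂ) * x ^ 2 / 2)
        - Complex.exp (-((σ2 : ℝ) : ℂ) * x ^ 2 / 2)‖ := norm_sub_le_norm_sub_add_norm_sub _ _ _
    _ < ε := by linarith [h3.trans_lt h1]

/-- Estimating the nuisance functions has no effect on the limit distribution. -/
theorem eventually_measureReal_scaledError_sub_ge_lt (hK : 0 < K)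
    {fold : ∀ N : ℕ, Fin N → Fin K}
    (hfold : ∀ N, ∀ k k' : Fin K,
      (Finset.univ.filter fun i => fold N i = k).card
        ≤ (Finset.univ.filter fun i => fold N i = k').card + 1)
    {learner : ∀ (N : ℕ) (k : Fin K),
      ((net N).train (fold N) k → UnitData q r t) → Nuisance q r t}
    (hlearner : ∀ N k, MeasurableLearner (learner N k))
    {T : ∀ N : ℕ, SEM N q r t → Set (Nuisance q r t)}
    {δ Δ : ℕ → ℝ} (hδ_nonneg : ∀ N, 0 ≤ δ N) (hΔ_nonneg : ∀ N, 0 ≤ Δ N)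
    (hδ : Tendsto δ atTop (𝓝 0)) (hΔ : Tendsto Δ atTop (𝓝 0))
    (hC₃ : 0 < C₃) (hκ : 0 ≤ κ)
    (hreg : ∀ N, K ≤ N → ∀ M ∈ laws N, Regular M (net N) p C₁ C₂ C₃ C₄)
    (hT : ∀ N, K ≤ N → ∀ M ∈ laws N, RealizationSet M (net N) (T N M) p C₃
        (C₅ * δ N * (N : ℝ) ^ (-(1 / 2) : ℝ)) (C₇ * √(δ N) * (N : ℝ) ^ (-κ)))
    (hκdeg : ∀ N, K ≤ N → ((net N).maxDeg : ℝ) * (N : ℝ) ^ (-(2 * κ)) ≤ C₆)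
    (hmem : ∀ N, K ≤ N → ∀ M ∈ laws N, ∀ k,
      (M.P.map (M.trainData (net N) (fold N) k)) {s | learner N k s ∉ T N M}
        ≤ ENNReal.ofReal (Δ N)) {ε ε' : ℝ} (hε : 0 < ε) (hε' : 0 < ε') :
    ∀ᶠ N in atTop, ∀ M ∈ laws N, M.P.real {ω |
      ε ≤ |M.scaledError (net N) (fold N) (learner N) ω - M.oracleError (net N) ω|} < ε' := by
  have hK' : (0 : ℝ) < K := by exact_mod_cast hK
  -- Half of `ε` is for the folds' nuisance errors, the rest for the unequal fold sizes.
  set a : ℝ := ε / (4 * K) with ha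
  have ha0 : 0 < a := by positivity
  have hinv : Tendsto (fun N : ℕ => K * (2 * C₂ + 2 * C₂ / C₃) * (1 / √(N : ℝ))) atTop (𝓝 0) := by
    have : Tendsto (fun N : ℕ => 1 / √(N : ℝ)) atTop (𝓝 0) := by
      simp_rw [one_div]
      exact tendsto_inv_atTop_zero.comp (Real.tendsto_sqrt_atTop.comp tendsto_natCast_atTop_atTop)
    simpa using this.const_mul (K * (2 * (C₂ : ℝ) + 2 * C₂ / C₃))
  filter_upwards [(tendsto_nuisance_error (C₃ := C₃) (C₅ := C₅) (C₇ := C₇) hδ_nonneg hΔ_nonneg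
      hδ hΔ hκ hκdeg (1 + 1 / C₃ + 2 * C₂ / C₃ ^ 2) a).eventually_lt_const hε',
    hinv.eventually_lt_const (by positivity : 0 < ε / 2), eventually_ge_atTop (2 * K)]
    with N h1 h2 hKN M hM
  have hKN' : K ≤ N := by omega
  have hsum : 2 * K * a + K * (2 * C₂ + 2 * C₂ / C₃) * (1 / √(N : ℝ)) < ε := by
    have : 2 * K * a = ε / 2 := by
      rw [ha]
      field_simp
      ring
    linarith
  exact (measureReal_scaledError_sub_ge_le (hreg N hKN' M hM) hC₃ (hT N hKN' M hM) hK hKN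
    (fold N) (hfold N) (hlearner N) (hΔ_nonneg N) (hmem N hKN' M hM) ha0 hsum).trans_lt h1

end

end NetworkAIPW

theorem theorem1
    {q r t K : ℕ} (hK : 2 ≤ K)
    -- networks with their feature maps, and folds, for every number of units
    (net : ∀ N : ℕ, NetworkAIPW.Network N q r t)
    (fold : ∀ N : ℕ, Fin N → Fin K)
    (hfold : ∀ N, ∀ k k' : Fin K,
      (Finset.univ.filter fun i => fold N i = k).card
        ≤ (Finset.univ.filter fun i => fold N i = k').card + 1)
    -- the machine learners
    (learner : ∀ (N : ℕ) (k : Fin K),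
      ((net N).train (fold N) k → NetworkAIPW.UnitData q r t) → NetworkAIPW.Nuisance q r t)
    (hlearner : ∀ N k, NetworkAIPW.MeasurableLearner (learner N k))
    -- the sets of laws, and the nuisance realization sets
    (laws : ∀ N : ℕ, Set (NetworkAIPW.SEM N q r t))
    (T : ∀ N : ℕ, NetworkAIPW.SEM N q r t → Set (NetworkAIPW.Nuisance q r t))
    (δ Δ : ℕ → ℝ) (hδ_nonneg : ∀ N, 0 ≤ δ N) (hΔ_nonneg : ∀ N, 0 ≤ Δ N)
    (hδ : Tendsto δ atTop (𝓝 0)) (hΔ : Tendsto Δ atTop (𝓝 0))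
    -- constants, none of which depends on the number of units or on the law
    (p : ℝ≥0) (hp : 4 ≤ p) (C₁ C₂ : ℝ≥0) (C₃ C₄ C₅ C₆ C₇ κ : ℝ) (hC₃ : 0 < C₃) (hκ : 0 ≤ κ)
    (σ2 : ℝ≥0) (hσ2 : 0 < σ2)
    -- regularity
    (hreg : ∀ N, K ≤ N → ∀ M ∈ laws N, NetworkAIPW.Regular M (net N) p C₁ C₂ C₃ C₄)
    -- sparse dependency graph
    (hdeg : (fun N => ((net N).maxDeg : ℝ)) =o[atTop] (fun N : ℕ => (N : ℝ) ^ (1 / 4 : ℝ)))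
    -- limiting variance, for every sequence of laws
    (hvar : ∀ ε > 0, ∀ᶠ N in atTop, ∀ M ∈ laws N, |M.scoreVariance (net N) - σ2| < ε)
    -- nuisance realization sets: overlap, product rate and slowest rate of the learners
    (hT : ∀ N, K ≤ N → ∀ M ∈ laws N,
      NetworkAIPW.RealizationSet M (net N) (T N M) p C₃
        (C₅ * δ N * (N : ℝ) ^ (-(1 / 2) : ℝ)) (C₇ * √(δ N) * (N : ℝ) ^ (-κ)))
    (hκdeg : ∀ N, K ≤ N → ((net N).maxDeg : ℝ) * (N : ℝ) ^ (-(2 * κ)) ≤ C₆)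
    -- the learners produce elements of the realization sets with high probability
    (hmem : ∀ N, K ≤ N → ∀ M ∈ laws N, ∀ k,
      (M.P.map (M.trainData (net N) (fold N) k)) {s | learner N k s ∉ T N M}
        ≤ ENNReal.ofReal (Δ N)) :
    -- convergence in distribution, uniformly over the law
    (∀ ε > 0, ∀ᶠ N in atTop, ∀ M ∈ laws N, ∀ x : ℝ,
      |M.P.real {ω | M.scaledError (net N) (fold N) (learner N) ω ≤ x}
        - (gaussianReal 0 σ2).real (Set.Iic x)| < ε)
    -- in particular, convergence in distribution for every choice of laws from the sets
    ∧ ∀ M : ∀ N, NetworkAIPW.SEM N q r t,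
        TendstoInDistribution
          (fun N => (M N).scaledError (net N) (fold N) (learner N))
          (atTop ⊓ 𝓟 {N | M N ∈ laws N})
          (fun x : ℝ => x) (fun N => (M N).P) (gaussianReal 0 σ2) := by
  have hCLT : ∀ x : ℝ, ∀ ε > 0, ∀ᶠ N in atTop, ∀ M ∈ laws N,
      ‖charFun (M.P.map (M.scaledError (net N) (fold N) (learner N))) x
        - charFun (gaussianReal 0 σ2) x‖ < ε := by
    intro x ε hε
    set a : ℝ := ε / (4 * (|x| + 1)) with ha
    have hx : 0 < |x| + 1 := by positivity
    have ha0 : 0 < a := by positivity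
    have hxa : |x| * a ≤ ε / 4 := by
      rw [ha, mul_div_assoc', div_le_div_iff₀ (by positivity) (by norm_num)]
      nlinarith
    filter_upwards [NetworkAIPW.eventually_norm_charFun_oracleError_sub_lt hC₃ hreg hdeg hvar x
        (by positivity : 0 < ε / 4),
      NetworkAIPW.eventually_measureReal_scaledError_sub_ge_lt (by omega) hfold hlearner
        hδ_nonneg hΔ_nonneg hδ hΔ hC₃ hκ hreg hT hκdeg hmem ha0 (by positivity : 0 < ε / 8)]
      with N h1 h2 M hM
    have h3 := NetworkAIPW.norm_charFun_map_sub_le (μ := M.P)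
      (M.measurable_scaledError (net N) (fold N) (hlearner N))
      (M.measurable_oracleError (net N)) x ha0.le
    refine (norm_sub_le_norm_sub_add_norm_sub _
      (charFun (M.P.map (M.oracleError (net N))) x) _).trans_lt ?_
    linarith [h1 M hM, h2 M hM]
  let law (N : ℕ) (M : NetworkAIPW.SEM N q r t) : ProbabilityMeasure ℝ :=
    ⟨M.P.map (M.scaledError (net N) (fold N) (learner N)), Measure.isProbabilityMeasure_map
      (M.measurable_scaledError (net N) (fold N) (hlearner N)).aemeasurable⟩
  let γ : ProbabilityMeasure ℝ := ⟨gaussianReal 0 σ2, inferInstance⟩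
  have hchar : ∀ x : ℝ, ∀ ε > 0, ∀ᶠ N in atTop, ∀ μ ∈ law N '' laws N,
      ‖charFun (μ : Measure ℝ) x - charFun (γ : Measure ℝ) x‖ < ε := by
    intro x ε hε
    filter_upwards [hCLT x ε hε] with N hN
    rintro _ ⟨M, hM, rfl⟩
    exact hN M hM
  refine ⟨fun ε hε => ?_, fun M => ?_⟩
  · have : NullSingletonClass (γ : Measure ℝ) := nullSingletonClass_gaussianReal hσ2.ne'
    filter_upwards [NetworkAIPW.cdf_uniform_of_charFun_uniform hchar hε] with N hN M hM x
    have h := hN (law N M) ⟨M, hM, rfl⟩ x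
    have hlaw : (law N M : Measure ℝ).real (Set.Iic x)
        = M.P.real {ω | M.scaledError (net N) (fold N) (learner N) ω ≤ x} :=
      map_measureReal_apply (M.measurable_scaledError (net N) (fold N) (hlearner N))
        measurableSet_Iic
    rw [hlaw] at h
    exact h
  · have hmeas : ∀ N, AEMeasurable ((M N).scaledError (net N) (fold N) (learner N)) (M N).P :=
      fun N => ((M N).measurable_scaledError (net N) (fold N) (hlearner N)).aemeasurable
    refine ⟨hmeas, aemeasurable_id', ?_⟩
    have h := NetworkAIPW.tendsto_of_charFun_uniform hchar fun N => law N (M N)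
    have hle : atTop ⊓ 𝓟 {N | M N ∈ laws N}
        ≤ atTop ⊓ 𝓟 {N | law N (M N) ∈ law N '' laws N} :=
      inf_le_inf_left _ (principal_mono.2 fun N hN => ⟨M N, hN, rfl⟩)
    have hγ : γ = ⟨(gaussianReal 0 σ2).map fun x : ℝ => x,
        Measure.isProbabilityMeasure_map aemeasurable_id'⟩ :=
      Subtype.ext Measure.map_id'.symm
    rw [← hγ]
    exact h.mono_left hle
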